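/- **Notation.** All contours below run from $\infty e^{5\pi i/6}$ to $\infty e^{\pi i/6}$. Let $\mathrm{Ai}(u)=\frac1{2\pi}\int e^{i(ua+\frac13a^3)}\,da$ be the Airy function, let $\mathbf A(u,v)=\int_0^\infty \mathrm{Ai}(u+z)\,\mathrm{Ai}(z+v)\,dz$, and for real $x$ let $\mathbf A_x$ be the integral operator with kernel $\mathbf A(u,v)$ on $L^2((x,\infty))$ and $F_0(x)=\det(1-\mathbf A_x)$ its Fredholm determinant. For complex numbers $w,w_1,w_2,\dots$ put $$C_w(u)=\frac1{2\pi}\int \frac{e^{i(\frac13a^3+ua)}}{w+ia}\,da,\qquad s^{(m)}(u;w_1,\dots,w_m)=\frac1{2\pi}\int e^{i(\frac13a^3+ua)}\prod_{j=1}^m\frac1{w_j+ia}\,da\quad(m\ge1),$$ where the poles $a=iw$, respectively $a=iw_1,\dots,iw_m$, lie above the contour, and $$t^{(n)}(v;w_1,\dots,w_{n-1})=\frac1{2\pi}\int e^{i(\frac13b^3+vb)}\prod_{j=1}^{n-1}(w_j-ib)\,db\quad(n\ge1).$$ For functions $h,g$ let $\langle\frac1{1-\mathbf A_x}h,g\rangle=\int_x^\infty\bigl(\frac1{1-\mathbf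 A_x}h\bigr)(u)\,g(u)\,du$ (no complex conjugation). When $h\notin L^2((x,\infty))$ but $\mathbf A_xh\in L^2((x,\infty))$, which can happen for $h=C_w$ with $\mathrm{Re}\,w\le0$ and for $h=s^{(m)}$, the function $\frac1{1-\mathbf A_x}h$ means $h+\frac1{1-\mathbf A_x}(\mathbf A_xh)$; for $h\in L^2((x,\infty))$ the two agree. Finally, for $k\ge0$ put $$F_k(x;w_1,\dots,w_k)=F_0(x)\,\det\Bigl(\delta_{mn}-\bigl\langle\tfrac1{1-\mathbf A_x}s^{(m)}(w_1,\dots,w_m),\,t^{(n)}(w_1,\dots,w_{n-1})\bigr\rangle\Bigr)_{1\le m,n\le k},\qquad f(x,w)=1-\bigl\langle\tfrac1{1-\mathbf A_x}C_w,\mathrm{Ai}\bigr\rangle .$$ **Theorem.** Let $x$ be real. All these objects are well defined: $1-\mathbf A_x$ is invertible on $L^2((x,\infty))$, the Fredholm series $\sum_n\frac{(-1)^n}{n!}\int_{(x,\infty)^n}\det(\mathbf A(u_i,u_j))\,du$ of $F_0(x)$ and its terms converge absolutely, all the pairings above converge absolutely, and $y\mapsto f(y,w)$ is smooth on $\mathbb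 R$ for every complex $w$. Let $k\ge0$. 1. For distinct complex numbers $w_1,\dots,w_k$, $$F_k(x;w_1,\dots,w_k)=F_0(x)\cdot\frac{\det\bigl((w_m+D_x)^{n-1}f(x,w_m)\bigr)_{1\le m,n\le k}}{\prod_{1\le m<n\le k}(w_n-w_m)},\qquad D_x=\frac{\partial}{\partial x}.$$ 2. The formula remains true when some of the $w_j$ coincide, if its right-hand side is understood as a limit (l'Hôpital's rule): for all $w_1,\dots,w_k\in\mathbb C$, the right-hand side evaluated at distinct $w_1',\dots,w_k'$ converges to $F_k(x;w_1,\dots,w_k)$ as $(w_1',\dots,w_k')\to(w_1,\dots,w_k)$. 3. Consequently $F_k(x;w_1,\dots,w_k)$ is a symmetric function of $w_1,\dots,w_k\in\mathbb C$. -/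

import Mathlib

open MeasureTheory Set Filter Topology
open scoped ContDiff

noncomputable section

namespace AirySpiked

/-! ### Contours -/

/-- The integral of `g` along the contour from `∞ e^{5πi/6}` to `∞ e^{πi/6}` which consists of the
two rays with these directions and common end point `p`. -/
def wedgeIntegral (p : ℂ) (g : ℂ → ℂ) : ℂ :=
  (∫ r in Ioi (0 : ℝ), g (p + r * Complex.exp ((Real.pi / 6 : ℝ) * Complex.I)) *
      Complex.exp ((Real.pi / 6 : ℝ) * Complex.I)) -
  ∫ r in Ioi (0 : ℝ), g (p + r * Complex.exp ((5 * Real.pi / 6 : ℝ) * Complex.I)) *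
      Complex.exp ((5 * Real.pi / 6 : ℝ) * Complex.I)

/-- The point `a` lies (strictly) above the contour with vertex `p`. -/
def LiesAbove (p a : ℂ) : Prop :=
  p.im + |a.re - p.re| * Real.tan (Real.pi / 6) < a.im

/-- A vertex, on the negative imaginary axis, of a contour below all the points `i w_j`. By Cauchy's
theorem the integrals below do not depend on which contour below the poles is used. -/
def vertex {m : ℕ} (w : Fin m → ℂ) : ℂ := -((1 + 2 * ∑ j, ‖w j‖ : ℝ) * Complex.I)

/-- The poles `i w_j` lie above the contour with vertex `vertex w`. -/
theorem liesAbove_vertex {m : ℕ} (w : Fin m → ℂ) (j : Fin m) :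
    LiesAbove (vertex w) (Complex.I * w j) := by
  have h1 : ‖w j‖ ≤ ∑ i, ‖w i‖ :=
    Finset.single_le_sum (f := fun i => ‖w i‖) (fun i _ => norm_nonneg _) (Finset.mem_univ j)
  have h2 := Complex.abs_im_le_norm (w j)
  have h3 := (abs_le.1 (Complex.abs_re_le_norm (w j))).1
  have h4 : Real.tan (Real.pi / 6) ≤ 1 := by
    rw [Real.tan_pi_div_six, div_le_one (by positivity)]
    exact Real.one_le_sqrt.2 (by norm_num)
  have h5 : |(w j).im| * Real.tan (Real.pi / 6) ≤ |(w j).im| :=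
    mul_le_of_le_one_right (abs_nonneg _) h4
  simp only [LiesAbove, vertex, Complex.neg_im, Complex.neg_re, Complex.mul_im, Complex.mul_re,
    Complex.ofReal_re, Complex.ofReal_im, Complex.I_re, Complex.I_im]
  simp only [mul_zero, zero_mul, mul_one, one_mul, sub_zero, zero_sub, neg_zero, add_zero, zero_add,
    abs_neg]
  linarith

/-! ### The special functions -/

/-- The Airy function. -/
def airy (u : ℝ) : ℂ :=
  1 / (2 * Real.pi) * wedgeIntegral Complex.I
    (fun a => Complex.exp (Complex.I * (u * a + a ^ 3 / 3)))

/-- `s^{(m)}(u; w_1, …, w_m)`. -/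
def sFun {m : ℕ} (w : Fin m → ℂ) (u : ℝ) : ℂ :=
  1 / (2 * Real.pi) * wedgeIntegral (vertex w)
    (fun a => Complex.exp (Complex.I * (u * a + a ^ 3 / 3)) * ∏ j, 1 / (w j + Complex.I * a))

/-- `t^{(m+1)}(v; w_1, …, w_m)`. -/
def tFun {m : ℕ} (w : Fin m → ℂ) (v : ℝ) : ℂ :=
  1 / (2 * Real.pi) * wedgeIntegral Complex.I
    (fun b => Complex.exp (Complex.I * (v * b + b ^ 3 / 3)) * ∏ j, (w j - Complex.I * b))

/-- `C_w(u)`. -/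
def cFun (w : ℂ) (u : ℝ) : ℂ :=
  1 / (2 * Real.pi) * wedgeIntegral (vertex ![w])
    (fun a => Complex.exp (Complex.I * (u * a + a ^ 3 / 3)) * (1 / (w + Complex.I * a)))

/-! ### The Airy kernel and the Airy operator -/

/-- The Airy kernel. -/
def airyKernel (u v : ℝ) : ℂ := ∫ z in Ioi (0 : ℝ), airy (u + z) * airy (z + v)

/-- Lebesgue measure on `(x, ∞)`. -/
abbrev halfLine (x : ℝ) : Measure ℝ := volume.restrict (Ioi x)

/-- The function `u ↦ ∫_x^∞ A(u, v) h(v) dv`. -/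
def airyApply (x : ℝ) (h : ℝ → ℂ) (u : ℝ) : ℂ := ∫ v, airyKernel u v * h v ∂(halfLine x)

theorem norm_exp_ray (u r θ : ℝ) (hs : Real.sin θ = 1 / 2) :
    ‖Complex.exp (Complex.I * (u * (Complex.I + r * Complex.exp (θ * Complex.I)) +
      (Complex.I + r * Complex.exp (θ * Complex.I)) ^ 3 / 3)) * Complex.exp (θ * Complex.I)‖ =
      Real.exp (-u - u * r / 2 + 1 / 3 + r / 2 - r ^ 2 / 2 - r ^ 3 / 3) := by
  have hc : Real.cos θ ^ 2 = 3 / 4 := by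
    have := Real.sin_sq_add_cos_sq θ
    rw [hs] at this; linarith
  rw [norm_mul, Complex.norm_exp_ofReal_mul_I, mul_one, Complex.norm_exp]
  congr 1
  rw [Complex.exp_mul_I, ← Complex.ofReal_cos, ← Complex.ofReal_sin, hs]
  have key : Complex.I * (u * (Complex.I + r * (((Real.cos θ : ℝ) : ℂ) + ((1 / 2 : ℝ) : ℂ) *
      Complex.I)) + (Complex.I + r * (((Real.cos θ : ℝ) : ℂ) + ((1 / 2 : ℝ) : ℂ) *
      Complex.I)) ^ 3 / 3) =
      ((-(u * (1 + r / 2)) - ((r * Real.cos θ) ^ 2 * (1 + r / 2)) + (1 + r / 2) ^ 3 / 3 : ℝ) : ℂ) +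
      ((u * (r * Real.cos θ) + (r * Real.cos θ) ^ 3 / 3 - (r * Real.cos θ) * (1 + r / 2) ^ 2 : ℝ)
        : ℂ) * Complex.I := by
    have hI3 : Complex.I ^ 3 = -Complex.I := by
      rw [pow_succ, Complex.I_sq]; ring
    have hI4 : Complex.I ^ 4 = 1 := Complex.I_pow_four
    push_cast
    ring_nf
    simp only [Complex.I_sq, hI3, hI4]
    ring
  rw [key]
  simp only [Complex.add_re, Complex.mul_re, Complex.ofReal_re, Complex.ofReal_im, Complex.I_re,
    Complex.I_im, mul_zero, zero_mul, sub_zero, add_zero]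
  rw [mul_pow, hc]; ring

theorem norm_ray_integral_le (x u θ : ℝ) (hu : x ≤ u) (hs : Real.sin θ = 1 / 2) :
    ‖∫ r in Ioi (0 : ℝ), Complex.exp (Complex.I * (u * (Complex.I + r * Complex.exp (θ * Complex.I)) +
      (Complex.I + r * Complex.exp (θ * Complex.I)) ^ 3 / 3)) * Complex.exp (θ * Complex.I)‖ ≤
      Real.exp (1 / 3 + (3 / 2 + |x| / 2) ^ 2 / 2) * Real.exp (-u) := by
  have hint : IntegrableOn (fun r : ℝ => Real.exp (-r)) (Ioi 0) := integrableOn_exp_neg_Ioi 0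
  calc _ ≤ ∫ r in Ioi (0 : ℝ), Real.exp (1 / 3 + (3 / 2 + |x| / 2) ^ 2 / 2) * Real.exp (-u) *
        Real.exp (-r) := by
        refine norm_integral_le_of_norm_le (hint.const_mul _) ?_
        refine (ae_restrict_iff' measurableSet_Ioi).2 (Eventually.of_forall fun r hr => ?_)
        have hr : 0 < r := hr
        rw [norm_exp_ray u r θ hs, ← Real.exp_add, ← Real.exp_add]
        apply Real.exp_le_exp.2
        have h1 : -u * r ≤ |x| * r :=
          mul_le_mul_of_nonneg_right (by linarith [neg_abs_le x]) hr.le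
        have h2 : 0 < r ^ 3 := by positivity
        nlinarith [sq_nonneg (r - (3 / 2 + |x| / 2))]
    _ = _ := by
        rw [integral_const_mul, integral_exp_neg_Ioi_zero, mul_one]

theorem norm_airy_le (x : ℝ) : ∃ C : ℝ, 0 ≤ C ∧ ∀ u, x ≤ u → ‖airy u‖ ≤ C * Real.exp (-u) := by
  refine ⟨‖(1 / (2 * Real.pi) : ℂ)‖ * (2 * Real.exp (1 / 3 + (3 / 2 + |x| / 2) ^ 2 / 2)),
    by positivity, fun u hu => ?_⟩
  have h1 : Real.sin (Real.pi / 6) = 1 / 2 := Real.sin_pi_div_six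
  have h2 : Real.sin (5 * Real.pi / 6) = 1 / 2 := by
    rw [← h1, ← Real.sin_pi_sub]; congr 1; ring
  rw [airy, norm_mul, mul_assoc, mul_assoc]
  refine mul_le_mul_of_nonneg_left ?_ (norm_nonneg _)
  refine (norm_sub_le _ _).trans ?_
  have a1 := norm_ray_integral_le x u _ hu h1
  have a2 := norm_ray_integral_le x u _ hu h2
  linarith

theorem stronglyMeasurable_airy : StronglyMeasurable airy := by
  have key : ∀ θ : ℝ, StronglyMeasurable fun u : ℝ => ∫ r in Ioi (0 : ℝ),
      Complex.exp (Complex.I * (u * (Complex.I + r * Complex.exp (θ * Complex.I)) +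
      (Complex.I + r * Complex.exp (θ * Complex.I)) ^ 3 / 3)) * Complex.exp (θ * Complex.I) := by
    intro θ
    refine StronglyMeasurable.integral_prod_right (f := fun u r : ℝ =>
      Complex.exp (Complex.I * (u * (Complex.I + r * Complex.exp (θ * Complex.I)) +
      (Complex.I + r * Complex.exp (θ * Complex.I)) ^ 3 / 3)) * Complex.exp (θ * Complex.I)) ?_
    apply Continuous.stronglyMeasurable
    unfold Function.uncurry
    fun_prop
  exact ((key _).sub (key _)).const_mul _

theorem stronglyMeasurable_airyKernel : StronglyMeasurable (Function.uncurry airyKernel) := by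
  refine StronglyMeasurable.integral_prod_right (f := fun (p : ℝ × ℝ) (z : ℝ) =>
    airy (p.1 + z) * airy (z + p.2)) ?_
  have h1 : Measurable fun q : (ℝ × ℝ) × ℝ => q.1.1 + q.2 := by fun_prop
  have h2 : Measurable fun q : (ℝ × ℝ) × ℝ => q.2 + q.1.2 := by fun_prop
  exact (stronglyMeasurable_airy.comp_measurable h1).mul
    (stronglyMeasurable_airy.comp_measurable h2)

theorem norm_airyKernel_le (x : ℝ) : ∃ C : ℝ, 0 ≤ C ∧ ∀ u v, x ≤ u → x ≤ v →
    ‖airyKernel u v‖ ≤ C * (Real.exp (-u) * Real.exp (-v)) := by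
  obtain ⟨C, hC, h⟩ := norm_airy_le x
  refine ⟨C ^ 2, by positivity, fun u v hu hv => ?_⟩
  have hint : IntegrableOn (fun r : ℝ => Real.exp (-r)) (Ioi 0) := integrableOn_exp_neg_Ioi 0
  calc _ ≤ ∫ z in Ioi (0 : ℝ), C ^ 2 * (Real.exp (-u) * Real.exp (-v)) * Real.exp (-z) := by
        refine norm_integral_le_of_norm_le (hint.const_mul _) ?_
        refine (ae_restrict_iff' measurableSet_Ioi).2 (Eventually.of_forall fun z hz => ?_)
        have hz : 0 < z := hz
        have e1 := h (u + z) (by linarith)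
        have e2 := h (z + v) (by linarith)
        rw [norm_mul]
        refine (mul_le_mul e1 e2 (norm_nonneg _) (by positivity)).trans ?_
        have e3 : Real.exp (-(u + z)) ≤ Real.exp (-u) := Real.exp_le_exp.2 (by linarith)
        have e4 : Real.exp (-(z + v)) = Real.exp (-v) * Real.exp (-z) := by
          rw [← Real.exp_add]; congr 1; ring
        rw [e4]
        have : C * Real.exp (-(u + z)) * (C * (Real.exp (-v) * Real.exp (-z))) =
          C ^ 2 * (Real.exp (-(u + z)) * Real.exp (-v)) * Real.exp (-z) := by ring
        rw [this]
        gcongr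
    _ = _ := by
        rw [integral_const_mul, integral_exp_neg_Ioi_zero, mul_one]

theorem memLp_exp_neg (x : ℝ) : MemLp (fun v : ℝ => Real.exp (-v)) 2 (halfLine x) := by
  rw [memLp_two_iff_integrable_sq (by fun_prop)]
  have : (fun v : ℝ => Real.exp (-v) ^ 2) = fun v => Real.exp (-2 * v) := by
    funext v; rw [← Real.exp_nat_mul]; congr 1; push_cast; ring
  rw [this]
  exact integrableOn_exp_mul_Ioi (by norm_num) x

theorem memLp_airyKernel (x u : ℝ) (hu : x ≤ u) :
    MemLp (fun v => airyKernel u v) 2 (halfLine x) := by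
  obtain ⟨C, hC, h⟩ := norm_airyKernel_le x
  refine MemLp.of_le_mul (c := C * Real.exp (-u)) (memLp_exp_neg x)
    (stronglyMeasurable_airyKernel.comp_measurable
      (g := fun v => (u, v)) (by fun_prop)).aestronglyMeasurable ?_
  refine (ae_restrict_iff' measurableSet_Ioi).2 (Eventually.of_forall fun v hv => ?_)
  rw [Real.norm_of_nonneg (Real.exp_pos _).le, mul_assoc]
  exact h u v hu (le_of_lt hv)

theorem integrable_airyKernel_mul {x u : ℝ} (hu : x ≤ u) {h : ℝ → ℂ}
    (hh : MemLp h 2 (halfLine x)) : Integrable (fun v => airyKernel u v * h v) (halfLine x) :=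
  (memLp_airyKernel x u hu).integrable_mul hh

theorem airyApply_add {x u : ℝ} (hu : x ≤ u) {g h : ℝ → ℂ} (hg : MemLp g 2 (halfLine x))
    (hh : MemLp h 2 (halfLine x)) :
    airyApply x (fun v => g v + h v) u = airyApply x g u + airyApply x h u := by
  unfold airyApply
  rw [← integral_add (integrable_airyKernel_mul hu hg) (integrable_airyKernel_mul hu hh)]
  simp only [mul_add]

theorem airyApply_const_mul (x u : ℝ) (c : ℂ) (h : ℝ → ℂ) :
    airyApply x (fun v => c * h v) u = c * airyApply x h u := by
  unfold airyApply
  rw [← integral_const_mul]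
  congr 1; funext v; ring

theorem airyApply_congr (x u : ℝ) {g h : ℝ → ℂ} (hgh : g =ᵐ[halfLine x] h) :
    airyApply x g u = airyApply x h u :=
  integral_congr_ae (hgh.mono fun v hv => by simp only [hv])

theorem norm_airyApply_le (x : ℝ) : ∃ C : ℝ, 0 ≤ C ∧ ∀ (φ : Lp ℂ 2 (halfLine x)) (u : ℝ), x ≤ u →
    ‖airyApply x φ u‖ ≤ C * ‖φ‖ * Real.exp (-u) := by
  obtain ⟨C, hC, h⟩ := norm_airyKernel_le x
  refine ⟨C * ‖(memLp_exp_neg x).toLp‖, by positivity, fun φ u hu => ?_⟩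
  have hφ := (Lp.memLp φ).norm
  have h1 : ‖airyApply x φ u‖ ≤ ∫ v, C * Real.exp (-u) * (Real.exp (-v) * ‖φ v‖) ∂(halfLine x) := by
    refine norm_integral_le_of_norm_le (((memLp_exp_neg x).integrable_mul hφ).const_mul _) ?_
    refine (ae_restrict_iff' measurableSet_Ioi).2 (Eventually.of_forall fun v hv => ?_)
    rw [norm_mul]
    calc _ ≤ C * (Real.exp (-u) * Real.exp (-v)) * ‖φ v‖ :=
          mul_le_mul_of_nonneg_right (h u v hu (le_of_lt hv)) (norm_nonneg _)
      _ = _ := by ring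
  rw [integral_const_mul] at h1
  have h2 : ∫ v, Real.exp (-v) * ‖φ v‖ ∂(halfLine x) =
      inner ℝ (memLp_exp_neg x).toLp hφ.toLp := by
    rw [L2.inner_def]
    refine integral_congr_ae ?_
    filter_upwards [(memLp_exp_neg x).coeFn_toLp, hφ.coeFn_toLp] with v e1 e2
    rw [e1, e2]; simp [mul_comm]
  have h3 : ‖hφ.toLp‖ = ‖φ‖ := by
    rw [Lp.norm_toLp, eLpNorm_norm, Lp.norm_def]
  have h4 := real_inner_le_norm (memLp_exp_neg x).toLp hφ.toLp
  rw [← h2, h3] at h4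
  calc _ ≤ _ := h1
    _ ≤ C * Real.exp (-u) * (‖(memLp_exp_neg x).toLp‖ * ‖φ‖) :=
        mul_le_mul_of_nonneg_left h4 (by positivity)
    _ = _ := by ring

theorem aestronglyMeasurable_airyApply (x : ℝ) {h : ℝ → ℂ}
    (hh : AEStronglyMeasurable h (halfLine x)) :
    AEStronglyMeasurable (airyApply x h) (halfLine x) := by
  have e : airyApply x h = airyApply x (hh.mk h) :=
    funext fun u => airyApply_congr x u hh.ae_eq_mk
  rw [e]
  refine (StronglyMeasurable.integral_prod_right (f := fun u v : ℝ =>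
    airyKernel u v * hh.mk h v) ?_).aestronglyMeasurable
  exact stronglyMeasurable_airyKernel.mul
    (hh.stronglyMeasurable_mk.comp_measurable measurable_snd)

theorem memLp_airyApply (x : ℝ) (φ : Lp ℂ 2 (halfLine x)) :
    MemLp (airyApply x φ) 2 (halfLine x) := by
  obtain ⟨C, hC, h⟩ := norm_airyApply_le x
  refine MemLp.of_le_mul (c := C * ‖φ‖) (memLp_exp_neg x)
    (aestronglyMeasurable_airyApply x (Lp.memLp φ).1) ?_
  refine (ae_restrict_iff' measurableSet_Ioi).2 (Eventually.of_forall fun u hu => ?_)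
  rw [Real.norm_of_nonneg (Real.exp_pos _).le]
  exact h φ u (le_of_lt hu)

/-- The Airy operator `A_x` on `L²((x, ∞))`, as a linear map. -/
def airyLinear (x : ℝ) : Lp ℂ 2 (halfLine x) →ₗ[ℂ] Lp ℂ 2 (halfLine x) where
  toFun φ := (memLp_airyApply x φ).toLp (airyApply x φ)
  map_add' φ ψ := by
    rw [← MemLp.toLp_add, MemLp.toLp_eq_toLp_iff]
    refine (ae_restrict_iff' measurableSet_Ioi).2 (Eventually.of_forall fun u hu => ?_)
    rw [airyApply_congr x u (Lp.coeFn_add φ ψ)]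
    exact airyApply_add (le_of_lt hu) (Lp.memLp φ) (Lp.memLp ψ)
  map_smul' c φ := by
    rw [RingHom.id_apply, ← MemLp.toLp_const_smul, MemLp.toLp_eq_toLp_iff]
    refine Eventually.of_forall fun u => ?_
    rw [airyApply_congr x u (Lp.coeFn_smul c φ)]
    exact airyApply_const_mul x u c φ

theorem norm_airyLinear_le (x : ℝ) : ∃ C : ℝ, ∀ φ, ‖airyLinear x φ‖ ≤ C * ‖φ‖ := by
  obtain ⟨C, hC, h⟩ := norm_airyApply_le x
  refine ⟨C * ‖(memLp_exp_neg x).toLp‖, fun φ => ?_⟩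
  have : ‖airyLinear x φ‖ ≤ (C * ‖φ‖) * ‖(memLp_exp_neg x).toLp‖ := by
    refine Lp.norm_le_mul_norm_of_ae_le_mul ?_
    have hpos : ∀ᵐ u ∂(halfLine x), u ∈ Ioi x := ae_restrict_mem measurableSet_Ioi
    filter_upwards [(memLp_airyApply x φ).coeFn_toLp, (memLp_exp_neg x).coeFn_toLp, hpos]
      with u e1 e2 hu
    rw [e2, Real.norm_of_nonneg (Real.exp_pos _).le]
    change ‖((memLp_airyApply x φ).toLp (airyApply x φ) : ℝ → ℂ) u‖ ≤ _
    rw [e1]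
    exact h φ u (le_of_lt hu)
  linarith [this, mul_right_comm C ‖φ‖ ‖(memLp_exp_neg x).toLp‖]

/-- The Airy operator `A_x`, as a bounded operator on `L²((x, ∞))`. -/
def airyOp (x : ℝ) : Lp ℂ 2 (halfLine x) →L[ℂ] Lp ℂ 2 (halfLine x) :=
  (airyLinear x).mkContinuousOfExistsBound (norm_airyLinear_le x)

theorem coeFn_airyOp (x : ℝ) (φ : Lp ℂ 2 (halfLine x)) :
    airyOp x φ =ᵐ[halfLine x] airyApply x φ :=
  (memLp_airyApply x φ).coeFn_toLp

/-! ### The resolvent and the Fredholm determinant -/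

open Classical in
/-- The function `(1 - A_x)⁻¹ h`, for every `h` with `A_x h ∈ L²((x, ∞))`. For `h` in `L²((x, ∞))`
it is the value at `h` of the inverse of the operator `1 - A_x` on `L²((x, ∞))`. A function `h`
outside this space (such as `C_w` for `Re w ≤ 0`, which behaves like a constant times `e^{-uw}` at
infinity) is treated through `(1 - A_x)⁻¹ h = h + (1 - A_x)⁻¹ (A_x h)`. -/
def airyResolvent (x : ℝ) (h : ℝ → ℂ) (u : ℝ) : ℂ :=
  if H : MemLp (airyApply x h) 2 (halfLine x) then
    h u + (Ring.inverse (1 - airyOp x) (H.toLp (airyApply x h)) : Lp ℂ 2 (halfLine x)) u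
  else 0

/-- On `L²((x, ∞))` the function `airyResolvent x h` is the inverse of `1 - A_x` applied to `h`. -/
theorem airyResolvent_of_memLp (x : ℝ) (hx : IsUnit (1 - airyOp x)) {h : ℝ → ℂ}
    (hh : MemLp h 2 (halfLine x)) :
    airyResolvent x h =ᵐ[halfLine x] (Ring.inverse (1 - airyOp x) (hh.toLp h) : Lp ℂ 2 (halfLine x)) := by
  have e0 : airyApply x h = airyApply x (hh.toLp h) :=
    funext fun u => airyApply_congr x u hh.coeFn_toLp.symm
  have H : MemLp (airyApply x h) 2 (halfLine x) := e0 ▸ memLp_airyApply x (hh.toLp h)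
  have e1 : H.toLp (airyApply x h) = airyOp x (hh.toLp h) := by
    refine Lp.ext (H.coeFn_toLp.trans ?_)
    rw [e0]; exact (coeFn_airyOp x _).symm
  have e2 : (Ring.inverse (1 - airyOp x)) ((1 - airyOp x) (hh.toLp h)) = hh.toLp h := by
    rw [← mul_apply_eq_comp, Ring.inverse_mul_cancel _ hx,
      one_apply_eq_self]
  have e3 : Ring.inverse (1 - airyOp x) (hh.toLp h) =
      hh.toLp h + Ring.inverse (1 - airyOp x) (H.toLp (airyApply x h)) := by
    rw [e1]
    nth_rewrite 2 [← e2]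
    rw [sub_apply, one_apply_eq_self, map_sub, sub_add_cancel]
  rw [e3]
  filter_upwards [hh.coeFn_toLp, Lp.coeFn_add (hh.toLp h)
    (Ring.inverse (1 - airyOp x) (H.toLp (airyApply x h)))] with u a1 a2
  rw [a2, Pi.add_apply, a1, airyResolvent, dif_pos H]

/-- The real (bilinear) pairing `⟨(1 - A_x)⁻¹ h, g⟩` over `(x, ∞)`. -/
def pairing (x : ℝ) (h g : ℝ → ℂ) : ℂ := ∫ u in Ioi x, airyResolvent x h u * g u

/-- All integrals in `⟨(1 - A_x)⁻¹ h, g⟩` converge and `A_x h` is in `L²((x, ∞))`. -/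
def PairingConverges (x : ℝ) (h g : ℝ → ℂ) : Prop :=
  (∀ u, x < u → IntegrableOn (fun v => airyKernel u v * h v) (Ioi x)) ∧
  MemLp (airyApply x h) 2 (halfLine x) ∧
  IntegrableOn (fun u => airyResolvent x h u * g u) (Ioi x)

/-- The `n`-th term of the Fredholm series of `det (1 - A_x)`, without the factor `(-1) ^ n / n!`:
`∫_{(x,∞)^n} det (A(u_i, u_j)) du`. -/
def fredholmTerm (x : ℝ) (n : ℕ) : ℂ :=
  ∫ u : Fin n → ℝ, (Matrix.of fun i j => airyKernel (u i) (u j)).det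
    ∂(Measure.pi fun _ => halfLine x)

/-- `F_0(x) = det (1 - A_x)`, the Fredholm determinant. -/
def F0 (x : ℝ) : ℂ := ∑' n : ℕ, (-1) ^ n / (n.factorial : ℂ) * fredholmTerm x n

/-! ### The functions of the theorem -/

/-- `F_k(x; w_1, …, w_k)`. The index `m : Fin k` stands for the index `m + 1` of the usual notation. -/
def Fk (x : ℝ) {k : ℕ} (w : Fin k → ℂ) : ℂ :=
  F0 x * (Matrix.of fun m n : Fin k => (if m = n then 1 else 0) -
    pairing x (sFun fun j : Fin (m + 1) => w (Fin.castLE m.isLt j))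
      (tFun fun j : Fin n => w (Fin.castLE n.isLt.le j))).det

/-- `f(x, w) = 1 - ⟨(1 - A_x)⁻¹ C_w, Ai⟩`. -/
def f (x : ℝ) (w : ℂ) : ℂ := 1 - pairing x (cFun w) airy

/-- The operator `w + D_x`. -/
def shiftedDeriv (w : ℂ) (g : ℝ → ℂ) (x : ℝ) : ℂ := w * g x + deriv g x

/-- The right-hand side of the determinantal formula, for distinct `w_1, …, w_k`. -/
def detFormula (x : ℝ) {k : ℕ} (w : Fin k → ℂ) : ℂ :=
  F0 x * ((Matrix.of fun m n : Fin k =>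
      ((shiftedDeriv (w m))^[(n : ℕ)] (fun y => f y (w m))) x).det /
    ∏ m, ∏ n ∈ Finset.Ioi m, (w n - w m))

end AirySpiked

end

open AirySpiked

/-!
For distinct `w_j` the theorem comes from an identity `(w + D)^n f = w^n - ⟨(1 - A_x)⁻¹ C_w,
Ai^{(n)}⟩ + …`, where the dots stand for a combination of the `(w + D)^j f`, `j < n`, with
coefficients which do not depend on `w`. It is a consequence of three differential equations:
`∂_x` of the kernel `A(x + u, x + v)` is `-Ai(x + u) Ai(x + v)`, of rank one, `C_w' = Ai - w
C_w`, and the derivative of `Ai^{(n)}` is `Ai^{(n+1)}` (`RankOneFlow.hasDerivAt_pairing`,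
`RankOneFlow.exists_triangular`). Hence, up to a unipotent triangular factor, the matrix `N` of
the `(w_m + D)^{n-1} f(x, w_m)` is `V - G`, with `V` the Vandermonde matrix and `G` the matrix
of the pairings `⟨(1 - A_x)⁻¹ C_{w_m}, Ai^{(n-1)}⟩`. By partial fractions `s^{(m)}` is a
combination of the `C_{w_l}`, `l ≤ m`, and `t^{(n)}` is a combination of derivatives of `Ai`
with the coefficients of `∏_{j<n} (w_j - X)`; so the matrix of the pairings in `F_k` is `P G Q`
for two matrices `P` and `Q`, and Lagrange interpolation gives `P V Q = 1`. Therefore `1 - P G Q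
= P (V - G) Q` has determinant `det N / det V` (`Fk_eq_detFormula`). Since `F_k` is continuous
in `w` (`continuous_Fk`), and tuples with distinct entries are dense, the statements on
coinciding parameters and on symmetry follow.

To differentiate in `x`, all operators are moved to the fixed space `L²((0, ∞))` by translation.
The additional weight `e^{-Mu}` makes room for the functions `s^{(m)}` and `C_w`, which may grow
exponentially; the kernel tolerates it because `Ai` decays faster than any exponential. The
weighted operator is an integral of operators of rank one along the curve of translates of `Ai`
(`airyWeightedOp`), which yields compactness and the derivative in `x` in operator norm
(`hasDerivAt_airyWeightedOp`), and its resolvent computes the pairings of the theorem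
(`pairing_eq`).

By compactness `1 - A_x` is invertible as soon as it is injective (`airyOp_fixed_eq_zero`).
Write `A_x` as a product of two Airy transforms. Each is a contraction in `L²`, by Plancherel's
theorem and a contour in the upper half-plane close to the real line. If `A_x φ = φ`, then the
Airy transform of `φ` has all its mass on `(0, ∞)`; being the restriction of an entire function,
it vanishes.

The estimates on `Ai`, `s^{(m)}` and `C_w` come from shifting the vertex of the contour
(`airyWedge_shift`). The Fredholm series converges by a form of Hadamard's inequality
(`norm_det_sq_le`).
-/

open MeasureTheory Set Filter Topology
open scoped ContDiff

noncomputable section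

namespace AirySpiked

/-! ### Contour integrals with the Airy phase -/

/-- The exponential `e^{i(ua + a³/3)}`, for complex `u`. -/
def phase (u a : ℂ) : ℂ := Complex.exp (Complex.I * (u * a + a ^ 3 / 3))

/-- The directions `e` of the two rays of a wedge contour. -/
def IsRayDir (e : ℂ) : Prop := e.im = 1 / 2 ∧ e.re ^ 2 = 3 / 4

/-- The direction `e^{πi/6}`. -/
def dirR : ℂ := Complex.exp ((Real.pi / 6 : ℝ) * Complex.I)

/-- The direction `e^{5πi/6}`. -/
def dirL : ℂ := Complex.exp ((5 * Real.pi / 6 : ℝ) * Complex.I)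

theorem isRayDir_of_sin {θ : ℝ} (h : Real.sin θ = 1 / 2) :
    IsRayDir (Complex.exp (θ * Complex.I)) := by
  refine ⟨by rw [Complex.exp_ofReal_mul_I_im, h], ?_⟩
  rw [Complex.exp_ofReal_mul_I_re]
  have := Real.sin_sq_add_cos_sq θ
  rw [h] at this
  linarith

theorem isRayDir_dirR : IsRayDir dirR := isRayDir_of_sin Real.sin_pi_div_six

theorem isRayDir_dirL : IsRayDir dirL := by
  refine isRayDir_of_sin ?_
  rw [← Real.sin_pi_div_six, ← Real.sin_pi_sub]; congr 1; ring

theorem IsRayDir.norm_eq {e : ℂ} (he : IsRayDir e) : ‖e‖ = 1 := by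
  have h : ‖e‖ ^ 2 = 1 := by
    rw [Complex.sq_norm, Complex.normSq_apply]
    obtain ⟨h1, h2⟩ := he
    rw [h1]; linarith
  nlinarith [norm_nonneg e]

theorem IsRayDir.norm_point_le {e : ℂ} (he : IsRayDir e) (q : ℝ) {r : ℝ} (hr : 0 ≤ r) :
    ‖(q : ℂ) * Complex.I + r * e‖ ≤ |q| + r := by
  refine (norm_add_le _ _).trans ?_
  simp [he.norm_eq, abs_of_nonneg hr]

theorem norm_phase (u a : ℂ) : ‖phase u a‖ =
    Real.exp (-(u.re * a.im + u.im * a.re) - a.re ^ 2 * a.im + a.im ^ 3 / 3) := by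
  have h3 : (a ^ 3).im = 3 * a.re ^ 2 * a.im - a.im ^ 3 := by
    simp only [pow_succ, pow_zero, one_mul, Complex.mul_im, Complex.mul_re]; ring
  have h4 : (a ^ 3 / 3 : ℂ).im = (a ^ 3).im / 3 := by
    rw [show (3 : ℂ) = ((3 : ℝ) : ℂ) by norm_num, Complex.div_ofReal_im]
  rw [phase, Complex.norm_exp]
  congr 1
  rw [Complex.mul_re, Complex.I_re, Complex.I_im, Complex.add_im, h4, h3, Complex.mul_im]
  ring

/-- A cubic polynomial with negative leading coefficient is bounded above on `[0, ∞)`. Beyond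
`3b + 3c + 1` its values are nonpositive. -/
theorem cubic_le (b c : ℝ) (hb : 0 ≤ b) (hc : 0 ≤ c) :
    ∃ D, ∀ r : ℝ, 0 ≤ r → -r ^ 3 / 3 + b * r ^ 2 + c * r ≤ D := by
  set R := 3 * b + 3 * c + 1
  refine ⟨b * R ^ 2 + c * R, fun r hr => ?_⟩
  rcases le_total R r with h | h
  · have h1 : 1 ≤ r := le_trans (by simp only [R]; linarith) h
    have h2 : R * r ^ 2 ≤ r * r ^ 2 := by gcongr
    have h3 : c * r ≤ c * r ^ 2 := mul_le_mul_of_nonneg_left (by nlinarith) hc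
    have h4 : 0 ≤ b * R ^ 2 + c * R := by positivity
    have h5 : R * r ^ 2 = 3 * (b * r ^ 2) + 3 * (c * r ^ 2) + r ^ 2 := by simp only [R]; ring
    nlinarith [sq_nonneg r]
  · have h0 : 0 ≤ r ^ 3 := by positivity
    have : b * r ^ 2 + c * r ≤ b * R ^ 2 + c * R := by gcongr
    linarith

/-- On a ray of a wedge contour the phase decays faster than any exponential, uniformly in
`u` with `Re u` bounded below and `Im u` bounded, and in bounded vertices. -/
theorem norm_phase_ray_le (Q κ x₀ M : ℝ) : ∃ D : ℝ, 0 ≤ D ∧ ∀ (q : ℝ) (e u : ℂ) (r : ℝ),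
    |q| ≤ Q → IsRayDir e → x₀ ≤ u.re → |u.im| ≤ M → 0 ≤ r →
    ‖phase u (q * Complex.I + r * e)‖ * Real.exp (κ * r) ≤
      D * Real.exp (-(q * u.re)) * Real.exp (-r) := by
  obtain ⟨D, hD⟩ := cubic_le (|Q| / 2) (|x₀| / 2 + |M| + |κ| + 1 + Q ^ 2 / 2)
    (by positivity) (by positivity)
  refine ⟨Real.exp (D + |Q| ^ 3 / 3), (Real.exp_pos _).le, fun q e u r hq he hu hM hr => ?_⟩
  obtain ⟨he1, he2⟩ := he
  have hre : ((q : ℂ) * Complex.I + r * e).re = r * e.re := by simp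
  have him : ((q : ℂ) * Complex.I + r * e).im = q + r / 2 := by simp [he1]; ring
  rw [norm_phase, hre, him, ← Real.exp_add, ← Real.exp_add, ← Real.exp_add, Real.exp_le_exp]
  have hD' := hD r hr
  have hQ : |q| ≤ |Q| := hq.trans (le_abs_self Q)
  have a1 : -(u.re) * r ≤ |x₀| * r :=
    mul_le_mul_of_nonneg_right (by linarith [neg_abs_le x₀]) hr
  have hre1 : |e.re| ≤ 1 := by
    rw [← sq_le_one_iff_abs_le_one]; linarith
  have a2 : -(u.im * (r * e.re)) ≤ |M| * r := by
    have : |u.im * (r * e.re)| ≤ |M| * (r * 1) := by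
      rw [abs_mul, abs_mul, abs_of_nonneg hr]
      have : |u.im| ≤ |M| := hM.trans (le_abs_self M)
      gcongr
    linarith [neg_abs_le (u.im * (r * e.re))]
  have a3 : κ * r ≤ |κ| * r := mul_le_mul_of_nonneg_right (le_abs_self κ) hr
  have a4 : -q * r ^ 2 ≤ |Q| * r ^ 2 :=
    mul_le_mul_of_nonneg_right (by linarith [neg_abs_le q]) (by positivity)
  have a5 : q ^ 2 * r ≤ Q ^ 2 * r := mul_le_mul_of_nonneg_right (sq_le_sq.2 hQ) hr
  have a6 : q ^ 3 ≤ |Q| ^ 3 := by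
    calc q ^ 3 ≤ |q ^ 3| := le_abs_self _
      _ = |q| ^ 3 := abs_pow q 3
      _ ≤ _ := by gcongr
  -- the cubic terms of the exponent combine to `-r³ / 3`, since `Re(i e³) = -1`
  have key : -((r * e.re) ^ 2) * (q + r / 2) + (q + r / 2) ^ 3 / 3 =
      -r ^ 3 / 3 - q * r ^ 2 / 2 + q ^ 2 * r / 2 + q ^ 3 / 3 := by
    rw [mul_pow, he2]; ring
  nlinarith

/-- A weight function on the rays of the wedge contour with vertex `q i` which grows at most
exponentially there. -/
structure RayBound (q κ B : ℝ) (φ : ℂ → ℂ) : Prop where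
  meas : ∀ e, IsRayDir e → AEStronglyMeasurable (fun r : ℝ => φ (q * Complex.I + r * e))
    (volume.restrict (Ioi 0))
  bound : ∀ e, IsRayDir e → ∀ r : ℝ, 0 < r → ‖φ (q * Complex.I + r * e)‖ ≤ B * Real.exp (κ * r)

/-- The integral `1/(2π) ∫ e^{i(ua + a³/3)} φ(a) da` along the wedge contour with vertex `q i`. -/
def airyWedge (q : ℝ) (φ : ℂ → ℂ) (u : ℂ) : ℂ :=
  1 / (2 * Real.pi) * wedgeIntegral (q * Complex.I) (fun a => phase u a * φ a)

theorem airyWedge_eq (q : ℝ) (φ : ℂ → ℂ) (u : ℂ) : airyWedge q φ u = 1 / (2 * Real.pi) *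
    ((∫ r in Ioi (0 : ℝ), phase u (q * Complex.I + r * dirR) * φ (q * Complex.I + r * dirR) * dirR) -
      ∫ r in Ioi (0 : ℝ), phase u (q * Complex.I + r * dirL) * φ (q * Complex.I + r * dirL) * dirL) :=
  rfl

theorem aestronglyMeasurable_phase_ray (q : ℝ) (e u : ℂ) (μ : Measure ℝ) :
    AEStronglyMeasurable (fun r : ℝ => phase u (q * Complex.I + r * e)) μ := by
  apply Continuous.aestronglyMeasurable
  unfold phase; fun_prop

theorem integrableOn_exp_neg : IntegrableOn (fun r : ℝ => Real.exp (-r)) (Ioi 0) :=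
  integrableOn_exp_neg_Ioi 0

theorem RayBound.integrable {q κ B : ℝ} {φ : ℂ → ℂ} (hB : 0 ≤ B) (h : RayBound q κ B φ) (u : ℂ) {e : ℂ}
    (he : IsRayDir e) : IntegrableOn (fun r : ℝ =>
      phase u (q * Complex.I + r * e) * φ (q * Complex.I + r * e) * e) (Ioi 0) := by
  obtain ⟨D, hD, hb⟩ := norm_phase_ray_le |q| κ u.re |u.im|
  refine Integrable.mono' (integrableOn_exp_neg.const_mul (B * (D * Real.exp (-(q * u.re)))))
    (((aestronglyMeasurable_phase_ray q e u _).mul (h.meas e he)).mul_const e) ?_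
  refine (ae_restrict_iff' measurableSet_Ioi).2 (Eventually.of_forall fun r hr => ?_)
  have h1 := hb q e u r le_rfl he le_rfl le_rfl (le_of_lt hr)
  have h2 := h.bound e he r hr
  rw [norm_mul, norm_mul, he.norm_eq, mul_one]
  calc _ ≤ ‖phase u (q * Complex.I + r * e)‖ * (B * Real.exp (κ * r)) := by gcongr
    _ = B * (‖phase u (q * Complex.I + r * e)‖ * Real.exp (κ * r)) := by ring
    _ ≤ B * (D * Real.exp (-(q * u.re)) * Real.exp (-r)) := by gcongr
    _ = _ := by ring

theorem norm_airyWedge_le (q κ x₀ : ℝ) : ∃ D : ℝ, 0 ≤ D ∧ ∀ (φ : ℂ → ℂ) (B : ℝ), 0 ≤ B →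
    RayBound q κ B φ → ∀ u : ℝ, x₀ ≤ u → ‖airyWedge q φ u‖ ≤ D * B * Real.exp (-(q * u)) := by
  obtain ⟨D, hD, hb⟩ := norm_phase_ray_le |q| κ x₀ 0
  refine ⟨‖(1 / (2 * Real.pi) : ℂ)‖ * (2 * D), by positivity, fun φ B hB h u hu => ?_⟩
  have key : ∀ e, IsRayDir e → ‖∫ r in Ioi (0 : ℝ), phase u (q * Complex.I + r * e) *
      φ (q * Complex.I + r * e) * e‖ ≤ B * (D * Real.exp (-(q * u))) := by
    intro e he
    calc _ ≤ ∫ r in Ioi (0 : ℝ), B * (D * Real.exp (-(q * u))) * Real.exp (-r) := by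
          refine norm_integral_le_of_norm_le (integrableOn_exp_neg.const_mul _) ?_
          refine (ae_restrict_iff' measurableSet_Ioi).2 (Eventually.of_forall fun r hr => ?_)
          have h1 := hb q e u r le_rfl he hu (by simp) (le_of_lt hr)
          rw [Complex.ofReal_re] at h1
          have h2 := h.bound e he r hr
          rw [norm_mul, norm_mul, he.norm_eq, mul_one]
          calc _ ≤ ‖phase u (q * Complex.I + r * e)‖ * (B * Real.exp (κ * r)) := by gcongr
            _ = B * (‖phase u (q * Complex.I + r * e)‖ * Real.exp (κ * r)) := by ring
            _ ≤ B * (D * Real.exp (-(q * u)) * Real.exp (-r)) := by gcongr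
            _ = _ := by ring
      _ = _ := by rw [integral_const_mul, integral_exp_neg_Ioi_zero, mul_one]
  rw [airyWedge_eq, norm_mul, mul_assoc, mul_assoc]
  refine mul_le_mul_of_nonneg_left ?_ (norm_nonneg _)
  refine (norm_sub_le _ _).trans ?_
  have := key _ isRayDir_dirR
  have := key _ isRayDir_dirL
  linarith

theorem RayBound.mul {q κ B κ' B' : ℝ} {φ ψ : ℂ → ℂ} (hB : 0 ≤ B)
    (h : RayBound q κ B φ) (h' : RayBound q κ' B' ψ) :
    RayBound q (κ + κ') (B * B') (fun a => φ a * ψ a) where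
  meas e he := (h.meas e he).mul (h'.meas e he)
  bound e he r hr := by
    have h1 := h.bound e he r hr
    have h2 := h'.bound e he r hr
    rw [norm_mul, add_mul, Real.exp_add]
    calc _ ≤ (B * Real.exp (κ * r)) * (B' * Real.exp (κ' * r)) := by gcongr
      _ = _ := by ring

theorem RayBound.id (q : ℝ) : RayBound q 1 (|q| + 1) (fun a => Complex.I * a) where
  meas e he := by
    apply Continuous.aestronglyMeasurable
    fun_prop
  bound e he r hr := by
    rw [norm_mul, Complex.norm_I, one_mul, one_mul]
    refine (he.norm_point_le q hr.le).trans ?_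
    have h1 := Real.add_one_le_exp r
    have h2 : |q| * 1 ≤ |q| * Real.exp r :=
      mul_le_mul_of_nonneg_left (by linarith) (abs_nonneg q)
    nlinarith

theorem RayBound.add {q κ B B' : ℝ} {φ ψ : ℂ → ℂ}
    (h : RayBound q κ B φ) (h' : RayBound q κ B' ψ) :
    RayBound q κ (B + B') (fun a => φ a + ψ a) where
  meas e he := (h.meas e he).add (h'.meas e he)
  bound e he r hr := by
    have h1 := h.bound e he r hr
    have h2 := h'.bound e he r hr
    refine (norm_add_le _ _).trans ?_
    linarith

theorem RayBound.const (q : ℝ) (c : ℂ) : RayBound q 0 ‖c‖ (fun _ => c) where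
  meas _ _ := aestronglyMeasurable_const
  bound e he r hr := by simp

/-- Differentiation under the integral sign: `∂_u` multiplies the weight by `i a`. -/
theorem hasDerivAt_airyWedge {q κ B : ℝ} {φ : ℂ → ℂ} (hB : 0 ≤ B) (h : RayBound q κ B φ) (u : ℂ) :
    HasDerivAt (airyWedge q φ) (airyWedge q (fun a => Complex.I * a * φ a) u) u := by
  have h' : RayBound q (1 + κ) ((|q| + 1) * B) (fun a => Complex.I * a * φ a) :=
    (RayBound.id q).mul (by positivity) h
  have key : ∀ e, IsRayDir e → HasDerivAt (fun v => ∫ r in Ioi (0 : ℝ),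
      phase v (q * Complex.I + r * e) * φ (q * Complex.I + r * e) * e)
      (∫ r in Ioi (0 : ℝ), phase u (q * Complex.I + r * e) *
        (Complex.I * (q * Complex.I + r * e) * φ (q * Complex.I + r * e)) * e) u := by
    intro e he
    obtain ⟨D, hD, hb⟩ := norm_phase_ray_le |q| (1 + κ) (u.re - 1) (|u.im| + 1)
    refine (hasDerivAt_integral_of_dominated_loc_of_deriv_le (s := Metric.ball u 1)
      (bound := fun r => (|q| + 1) * B * (D * Real.exp (|q| * (|u.re| + 1))) * Real.exp (-r))
      (Metric.ball_mem_nhds u one_pos) ?_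
      (F := fun v r => phase v (q * Complex.I + r * e) * φ (q * Complex.I + r * e) * e)
      (h.integrable hB u he)
      (F' := fun v r => phase v (q * Complex.I + r * e) *
        (Complex.I * (q * Complex.I + r * e) * φ (q * Complex.I + r * e)) * e)
      ((h'.integrable (by positivity) u he).aestronglyMeasurable) ?_
      (integrableOn_exp_neg.const_mul _) ?_).2
    · exact Eventually.of_forall fun v => (h.integrable hB v he).aestronglyMeasurable
    · refine (ae_restrict_iff' measurableSet_Ioi).2 (Eventually.of_forall fun r hr v hv => ?_)
      have hv' : ‖v - u‖ < 1 := by rwa [Metric.mem_ball, dist_eq_norm] at hv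
      have hre := (abs_lt.1 ((Complex.abs_re_le_norm (v - u)).trans_lt hv'))
      have him := (Complex.abs_im_le_norm (v - u)).trans_lt hv'
      rw [Complex.sub_re] at hre
      rw [Complex.sub_im] at him
      have i1 : |v.im| ≤ |u.im| + 1 := by
        have := abs_sub_abs_le_abs_sub v.im u.im
        linarith
      have i2 : |v.re| ≤ |u.re| + 1 := by
        have := abs_sub_abs_le_abs_sub v.re u.re
        have := (Complex.abs_re_le_norm (v - u)).trans_lt hv'
        rw [Complex.sub_re] at this
        linarith
      have h1 := hb q e v r le_rfl he (by linarith) i1 (le_of_lt hr)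
      have h2 := h'.bound e he r hr
      have h3 : Real.exp (-(q * v.re)) ≤ Real.exp (|q| * (|u.re| + 1)) := by
        apply Real.exp_le_exp.2
        calc -(q * v.re) ≤ |q * v.re| := neg_le_abs _
          _ = |q| * |v.re| := abs_mul _ _
          _ ≤ _ := by gcongr
      rw [norm_mul, norm_mul, he.norm_eq, mul_one]
      calc _ ≤ ‖phase v (q * Complex.I + r * e)‖ * ((|q| + 1) * B * Real.exp ((1 + κ) * r)) := by
            gcongr
        _ = (|q| + 1) * B * (‖phase v (q * Complex.I + r * e)‖ * Real.exp ((1 + κ) * r)) := by ring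
        _ ≤ (|q| + 1) * B * (D * Real.exp (-(q * v.re)) * Real.exp (-r)) := by gcongr
        _ ≤ (|q| + 1) * B * (D * Real.exp (|q| * (|u.re| + 1)) * Real.exp (-r)) := by gcongr
        _ = _ := by ring
    · refine Eventually.of_forall fun r v _ => ?_
      set a := (q : ℂ) * Complex.I + r * e
      have : HasDerivAt (fun v => phase v a) (phase v a * (Complex.I * (1 * a))) v :=
        (((((hasDerivAt_id v).mul_const a).add_const (a ^ 3 / 3)).const_mul Complex.I)).cexp
      refine ((this.mul_const (φ a)).mul_const e).congr_deriv ?_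
      ring
  have e1 : airyWedge q φ = fun v => 1 / (2 * Real.pi) *
    ((∫ r in Ioi (0 : ℝ), phase v (q * Complex.I + r * dirR) * φ (q * Complex.I + r * dirR) * dirR) -
      ∫ r in Ioi (0 : ℝ), phase v (q * Complex.I + r * dirL) * φ (q * Complex.I + r * dirL) * dirL) :=
    funext fun v => airyWedge_eq q φ v
  rw [e1, airyWedge_eq]
  exact ((key _ isRayDir_dirR).sub (key _ isRayDir_dirL)).const_mul _

theorem airyWedge_add {q κ B κ' B' : ℝ} {φ ψ : ℂ → ℂ} (hB : 0 ≤ B) (hB' : 0 ≤ B')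
    (h : RayBound q κ B φ) (h' : RayBound q κ' B' ψ) (u : ℂ) :
    airyWedge q (fun a => φ a + ψ a) u = airyWedge q φ u + airyWedge q ψ u := by
  have key : ∀ e, IsRayDir e → ∫ r in Ioi (0 : ℝ), phase u (q * Complex.I + r * e) *
      (φ (q * Complex.I + r * e) + ψ (q * Complex.I + r * e)) * e =
      (∫ r in Ioi (0 : ℝ), phase u (q * Complex.I + r * e) * φ (q * Complex.I + r * e) * e) +
      ∫ r in Ioi (0 : ℝ), phase u (q * Complex.I + r * e) * ψ (q * Complex.I + r * e) * e := by
    intro e he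
    rw [← integral_add (h.integrable hB u he) (h'.integrable hB' u he)]
    congr 1; funext r; ring
  simp only [airyWedge_eq]
  rw [key _ isRayDir_dirR, key _ isRayDir_dirL]
  ring

theorem airyWedge_const_mul (q : ℝ) (c : ℂ) (φ : ℂ → ℂ) (u : ℂ) :
    airyWedge q (fun a => c * φ a) u = c * airyWedge q φ u := by
  have key : ∀ e : ℂ, ∫ r in Ioi (0 : ℝ), phase u (q * Complex.I + r * e) *
      (c * φ (q * Complex.I + r * e)) * e =
      c * ∫ r in Ioi (0 : ℝ), phase u (q * Complex.I + r * e) * φ (q * Complex.I + r * e) * e := by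
    intro e
    rw [← integral_const_mul]
    congr 1; funext r; ring
  simp only [airyWedge_eq]
  rw [key, key]
  ring

theorem airyWedge_congr {q : ℝ} {φ ψ : ℂ → ℂ}
    (h : ∀ e, IsRayDir e → ∀ r : ℝ, 0 < r → φ (q * Complex.I + r * e) = ψ (q * Complex.I + r * e))
    (u : ℂ) : airyWedge q φ u = airyWedge q ψ u := by
  have key : ∀ e, IsRayDir e → ∫ r in Ioi (0 : ℝ), phase u (q * Complex.I + r * e) *
      φ (q * Complex.I + r * e) * e =
      ∫ r in Ioi (0 : ℝ), phase u (q * Complex.I + r * e) * ψ (q * Complex.I + r * e) * e := by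
    intro e he
    exact setIntegral_congr_fun measurableSet_Ioi fun r hr => by simp only [h e he r hr]
  rw [airyWedge_eq, airyWedge_eq, key _ isRayDir_dirR, key _ isRayDir_dirL]

/-! ### Deformation of contours -/

/-- Cauchy's theorem for the linear homotopy between the rays `p₀ + r e₀` and
`(p₀ + p₁) + r (e₀ + e₁)`: the two integrals differ by the integral over the segment between the
vertices. Both are iterated integrals of the same function, integrated in either order. -/
theorem ray_homotopy {g g' : ℂ → ℂ} {p₀ p₁ e₀ e₁ : ℂ} {C : ℝ} (hC : 0 ≤ C)
    (hg : ∀ t ∈ Icc (0 : ℝ) 1, ∀ r : ℝ, 0 ≤ r →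
      HasDerivAt g (g' (p₀ + t * p₁ + r * (e₀ + t * e₁))) (p₀ + t * p₁ + r * (e₀ + t * e₁)))
    (hc : ContinuousOn (fun z : ℝ × ℝ => g' (p₀ + z.1 * p₁ + z.2 * (e₀ + z.1 * e₁)))
      (Icc 0 1 ×ˢ Ici 0))
    (hb : ∀ t ∈ Icc (0 : ℝ) 1, ∀ r : ℝ, 0 ≤ r →
      ‖g (p₀ + t * p₁ + r * (e₀ + t * e₁))‖ ≤ C * Real.exp (-(2 * r)))
    (hb' : ∀ t ∈ Icc (0 : ℝ) 1, ∀ r : ℝ, 0 ≤ r →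
      ‖g' (p₀ + t * p₁ + r * (e₀ + t * e₁))‖ ≤ C * Real.exp (-(2 * r))) :
    (∫ r in Ioi (0 : ℝ), g (p₀ + p₁ + r * (e₀ + e₁)) * (e₀ + e₁)) -
      ∫ r in Ioi (0 : ℝ), g (p₀ + r * e₀) * e₀ =
    -∫ t in (0 : ℝ)..1, g (p₀ + t * p₁) * p₁ := by
  set P : ℝ → ℝ → ℂ := fun t r => p₀ + t * p₁ + r * (e₀ + t * e₁) with hP
  set Φ : ℝ → ℝ → ℂ := fun t r => g' (P t r) * (p₁ + r * e₁) * (e₀ + t * e₁) + g (P t r) * e₁ with hΦ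
  have hPt : ∀ t r : ℝ, HasDerivAt (fun s : ℝ => P s r) (p₁ + r * e₁) t := by
    intro t r
    have h0 : HasDerivAt (fun s : ℝ => (s : ℂ)) 1 t := Complex.ofRealCLM.hasDerivAt
    refine (((h0.mul_const p₁).const_add p₀).add
      (((h0.mul_const e₁).const_add e₀).const_mul (r : ℂ))).congr_deriv ?_
    ring
  have hPr : ∀ t r : ℝ, HasDerivAt (fun s : ℝ => P t s) (e₀ + t * e₁) r := by
    intro t r
    have h0 : HasDerivAt (fun s : ℝ => (s : ℂ)) 1 r := Complex.ofRealCLM.hasDerivAt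
    refine ((h0.mul_const (e₀ + t * e₁)).const_add (p₀ + t * p₁)).congr_deriv ?_
    ring
  have hPcont : Continuous fun z : ℝ × ℝ => P z.1 z.2 := by
    simp only [hP]; fun_prop
  have hgc : ContinuousOn (fun z : ℝ × ℝ => g (P z.1 z.2)) (Icc 0 1 ×ˢ Ici 0) := by
    intro z hz
    exact ContinuousAt.comp_continuousWithinAt (g := g) (f := fun z : ℝ × ℝ => P z.1 z.2)
      (hg z.1 hz.1 z.2 hz.2).continuousAt hPcont.continuousWithinAt
  have hΦc : ContinuousOn (Function.uncurry Φ) (Icc 0 1 ×ˢ Ici 0) := by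
    have h1 : ContinuousOn (fun z : ℝ × ℝ => (p₁ + z.2 * e₁) * (e₀ + z.1 * e₁))
        (Icc 0 1 ×ˢ Ici 0) := by fun_prop
    refine ((hc.mul h1).add (hgc.mul (continuousOn_const (c := e₁)))).congr fun z _ => ?_
    simp only [Function.uncurry, hΦ, hP, Pi.add_apply, Pi.mul_apply]; ring
  set K := (‖p₁‖ + ‖e₁‖) * (‖e₀‖ + ‖e₁‖) + ‖e₁‖ with hK
  have hΦb : ∀ t ∈ Icc (0 : ℝ) 1, ∀ r : ℝ, 0 ≤ r → ‖Φ t r‖ ≤ C * K * Real.exp (-r) := by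
    intro t ht r hr
    have e2 : Real.exp (-(2 * r)) = Real.exp (-r) * Real.exp (-r) := by
      rw [← Real.exp_add]; congr 1; ring
    have e3 : (1 + r) * Real.exp (-r) ≤ 1 := by
      have := Real.add_one_le_exp r
      rw [Real.exp_neg, ← div_eq_mul_inv, div_le_one (Real.exp_pos r)]; linarith
    have e4 : Real.exp (-r) ≤ 1 := Real.exp_le_one_iff.2 (by linarith)
    have n1 : ‖p₁ + r * e₁‖ ≤ (‖p₁‖ + ‖e₁‖) * (1 + r) := by
      refine (norm_add_le _ _).trans ?_
      rw [norm_mul, Complex.norm_real, Real.norm_of_nonneg hr]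
      nlinarith [norm_nonneg p₁, norm_nonneg e₁, mul_nonneg hr (norm_nonneg p₁)]
    have n2 : ‖e₀ + t * e₁‖ ≤ ‖e₀‖ + ‖e₁‖ := by
      refine (norm_add_le _ _).trans ?_
      rw [norm_mul, Complex.norm_real, Real.norm_of_nonneg ht.1]
      nlinarith [norm_nonneg e₁, ht.2]
    calc ‖Φ t r‖ ≤ ‖g' (P t r)‖ * ‖p₁ + r * e₁‖ * ‖e₀ + t * e₁‖ + ‖g (P t r)‖ * ‖e₁‖ := by
          refine (norm_add_le _ _).trans ?_
          rw [norm_mul, norm_mul, norm_mul]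
      _ ≤ (C * Real.exp (-(2 * r))) * ((‖p₁‖ + ‖e₁‖) * (1 + r)) * (‖e₀‖ + ‖e₁‖) +
          (C * Real.exp (-(2 * r))) * ‖e₁‖ := by
          gcongr
          · exact hb' t ht r hr
          · exact hb t ht r hr
      _ = C * Real.exp (-r) * ((‖p₁‖ + ‖e₁‖) * (‖e₀‖ + ‖e₁‖) * ((1 + r) * Real.exp (-r)) +
            ‖e₁‖ * Real.exp (-r)) := by rw [e2]; ring
      _ ≤ C * Real.exp (-r) * ((‖p₁‖ + ‖e₁‖) * (‖e₀‖ + ‖e₁‖) * 1 + ‖e₁‖ * 1) := by gcongr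
      _ = _ := by rw [hK]; ring
  have hΦt : ∀ t ∈ Icc (0 : ℝ) 1, ∀ r : ℝ, 0 ≤ r →
      HasDerivAt (fun s : ℝ => g (P s r) * (e₀ + s * e₁)) (Φ t r) t := by
    intro t ht r hr
    have h0 : HasDerivAt (fun s : ℝ => (s : ℂ)) 1 t := Complex.ofRealCLM.hasDerivAt
    have h1 := HasDerivAt.comp (h₂ := g) t (hg t ht r hr) (hPt t r)
    refine (h1.mul ((h0.mul_const e₁).const_add e₀)).congr_deriv ?_
    simp only [hΦ, Function.comp]; ring
  have hΦr : ∀ t ∈ Icc (0 : ℝ) 1, ∀ r : ℝ, 0 ≤ r →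
      HasDerivAt (fun s : ℝ => g (P t s) * (p₁ + s * e₁)) (Φ t r) r := by
    intro t ht r hr
    have h0 : HasDerivAt (fun s : ℝ => (s : ℂ)) 1 r := Complex.ofRealCLM.hasDerivAt
    have h1 := HasDerivAt.comp (h₂ := g) r (hg t ht r hr) (hPr t r)
    refine (h1.mul ((h0.mul_const e₁).const_add p₁)).congr_deriv ?_
    simp only [hΦ, Function.comp]; ring
  have hS : MeasurableSet ((Ioc (0 : ℝ) 1) ×ˢ (Ioi (0 : ℝ))) := measurableSet_Ioc.prod measurableSet_Ioi
  have hsub : (Ioc (0 : ℝ) 1) ×ˢ (Ioi (0 : ℝ)) ⊆ Icc 0 1 ×ˢ Ici 0 :=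
    prod_mono Ioc_subset_Icc_self Ioi_subset_Ici_self
  have hint : Integrable (Function.uncurry Φ)
      ((volume.restrict (Ioc (0 : ℝ) 1)).prod (volume.restrict (Ioi (0 : ℝ)))) := by
    have i1 : Integrable (fun _ : ℝ => (1 : ℝ)) (volume.restrict (Ioc (0 : ℝ) 1)) :=
      integrable_const 1
    have i2 := (i1.mul_prod integrableOn_exp_neg).const_mul (C * K)
    refine i2.mono' ?_ ?_
    · rw [Measure.prod_restrict]
      exact (hΦc.mono hsub).aestronglyMeasurable hS
    · rw [Measure.prod_restrict]
      refine (ae_restrict_iff' hS).2 (Eventually.of_forall fun z hz => ?_)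
      rw [one_mul]
      exact hΦb z.1 (Ioc_subset_Icc_self hz.1) z.2 (le_of_lt hz.2)
  have hswap := integral_integral_swap hint
  have hL : ∫ t in Ioc (0 : ℝ) 1, ∫ r in Ioi (0 : ℝ), Φ t r =
      -∫ t in (0 : ℝ)..1, g (p₀ + t * p₁) * p₁ := by
    rw [intervalIntegral.integral_of_le zero_le_one, ← integral_neg]
    refine setIntegral_congr_fun measurableSet_Ioc fun t ht => ?_
    have ht' := Ioc_subset_Icc_self ht
    have hlim : Tendsto (fun s : ℝ => g (P t s) * (p₁ + s * e₁)) atTop (𝓝 0) := by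
      have : Tendsto (fun s : ℝ => C * (‖p₁‖ + ‖e₁‖) * Real.exp (-s)) atTop (𝓝 0) := by
        simpa using (Real.tendsto_exp_neg_atTop_nhds_zero.const_mul (C * (‖p₁‖ + ‖e₁‖)))
      refine squeeze_zero_norm' ?_ this
      filter_upwards [eventually_ge_atTop 0] with r hr
      have e2 : Real.exp (-(2 * r)) = Real.exp (-r) * Real.exp (-r) := by
        rw [← Real.exp_add]; congr 1; ring
      have e3 : (1 + r) * Real.exp (-r) ≤ 1 := by
        have := Real.add_one_le_exp r
        rw [Real.exp_neg, ← div_eq_mul_inv, div_le_one (Real.exp_pos r)]; linarith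
      have n1 : ‖p₁ + r * e₁‖ ≤ (‖p₁‖ + ‖e₁‖) * (1 + r) := by
        refine (norm_add_le _ _).trans ?_
        rw [norm_mul, Complex.norm_real, Real.norm_of_nonneg hr]
        nlinarith [norm_nonneg p₁, norm_nonneg e₁, mul_nonneg hr (norm_nonneg p₁)]
      rw [norm_mul]
      calc _ ≤ (C * Real.exp (-(2 * r))) * ((‖p₁‖ + ‖e₁‖) * (1 + r)) := by
            gcongr
            exact hb t ht' r hr
        _ = C * (‖p₁‖ + ‖e₁‖) * Real.exp (-r) * ((1 + r) * Real.exp (-r)) := by rw [e2]; ring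
        _ ≤ C * (‖p₁‖ + ‖e₁‖) * Real.exp (-r) * 1 := by gcongr
        _ = _ := by ring
    rw [integral_Ioi_of_hasDerivAt_of_tendsto
      (hΦr t ht' 0 le_rfl).continuousAt.continuousWithinAt
      (fun r hr => hΦr t ht' r (le_of_lt hr)) ?_ hlim]
    · simp [hP]
    · refine (integrableOn_exp_neg.const_mul (C * K)).mono' ?_ ?_
      · refine ContinuousOn.aestronglyMeasurable ?_ measurableSet_Ioi
        exact hΦc.comp (f := fun r : ℝ => (t, r)) (by fun_prop) fun r hr => ⟨ht', Ioi_subset_Ici_self hr⟩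
      · exact (ae_restrict_iff' measurableSet_Ioi).2 (Eventually.of_forall fun r hr =>
          hΦb t ht' r (le_of_lt hr))
  have hR : ∫ r in Ioi (0 : ℝ), ∫ t in Ioc (0 : ℝ) 1, Φ t r =
      (∫ r in Ioi (0 : ℝ), g (p₀ + p₁ + r * (e₀ + e₁)) * (e₀ + e₁)) -
      ∫ r in Ioi (0 : ℝ), g (p₀ + r * e₀) * e₀ := by
    have hI : ∀ t ∈ Icc (0 : ℝ) 1,
        IntegrableOn (fun r : ℝ => g (P t r) * (e₀ + t * e₁)) (Ioi 0) := by
      intro t ht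
      refine Integrable.mul_const ?_ _
      refine (integrableOn_exp_neg.const_mul C).mono' ?_ ?_
      · refine ContinuousOn.aestronglyMeasurable ?_ measurableSet_Ioi
        exact hgc.comp (f := fun r : ℝ => (t, r)) (by fun_prop) fun r hr => ⟨ht, Ioi_subset_Ici_self hr⟩
      · refine (ae_restrict_iff' measurableSet_Ioi).2 (Eventually.of_forall fun r hr => ?_)
        have hr : 0 < r := hr
        refine (hb t ht r hr.le).trans ?_
        gcongr
        linarith
    have h1 := hI 1 (by simp)
    have h0 := hI 0 (by simp)
    simp only [hP, Complex.ofReal_one, one_mul, Complex.ofReal_zero, zero_mul, add_zero] at h0 h1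
    rw [← integral_sub h1 h0]
    refine setIntegral_congr_fun measurableSet_Ioi fun r hr => ?_
    have hr : 0 < r := hr
    rw [← intervalIntegral.integral_of_le zero_le_one,
      intervalIntegral.integral_eq_sub_of_hasDerivAt (f := fun s : ℝ => g (P s r) * (e₀ + s * e₁))]
    · simp [hP]
    · intro t ht
      rw [uIcc_of_le zero_le_one] at ht
      exact hΦt t ht r hr.le
    · apply ContinuousOn.intervalIntegrable
      rw [uIcc_of_le zero_le_one]
      exact hΦc.comp (f := fun t : ℝ => (t, r)) (by fun_prop) fun t ht => ⟨ht, hr.le⟩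
  rw [← hR, ← hswap, hL]

/-- A weight, holomorphic at the points of `S`, which, with its derivative, grows at most
exponentially on `S`. -/
def Tame (S : Set ℂ) (φ : ℂ → ℂ) : Prop :=
  ∃ (φ' : ℂ → ℂ) (B κ : ℝ), 0 ≤ B ∧ 0 ≤ κ ∧ ContinuousOn φ' S ∧ ∀ a ∈ S,
    HasDerivAt φ (φ' a) a ∧ ‖φ a‖ ≤ B * Real.exp (κ * ‖a‖) ∧ ‖φ' a‖ ≤ B * Real.exp (κ * ‖a‖)

theorem tame_const (S : Set ℂ) (c : ℂ) : Tame S (fun _ => c) :=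
  ⟨fun _ => 0, ‖c‖, 0, norm_nonneg c, le_rfl, continuousOn_const, fun a _ =>
    ⟨hasDerivAt_const a c, by simp, by simp⟩⟩

theorem tame_id (S : Set ℂ) : Tame S (fun a => Complex.I * a) := by
  refine ⟨fun _ => Complex.I, 1, 1, zero_le_one, zero_le_one, continuousOn_const, fun a _ =>
    ⟨by simpa using (hasDerivAt_id a).const_mul Complex.I, ?_, ?_⟩⟩
  · rw [norm_mul, Complex.norm_I]
    simp only [one_mul]
    linarith [Real.add_one_le_exp ‖a‖]
  · rw [Complex.norm_I, one_mul, one_mul]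
    exact Real.one_le_exp (norm_nonneg a)

theorem Tame.mul {S : Set ℂ} {φ ψ : ℂ → ℂ} (h : Tame S φ) (h' : Tame S ψ) :
    Tame S (fun a => φ a * ψ a) := by
  obtain ⟨φ', B, κ, hB, hκ, hc, h⟩ := h
  obtain ⟨ψ', B', κ', hB', hκ', hc', h'⟩ := h'
  have cφ : ContinuousOn φ S := fun a ha => (h a ha).1.continuousAt.continuousWithinAt
  have cψ : ContinuousOn ψ S := fun a ha => (h' a ha).1.continuousAt.continuousWithinAt
  refine ⟨fun a => φ' a * ψ a + φ a * ψ' a, 2 * (B * B'), κ + κ', by positivity, by positivity,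
    (hc.mul cψ).add (cφ.mul hc'), fun a ha => ⟨(h a ha).1.mul (h' a ha).1, ?_, ?_⟩⟩
  · rw [norm_mul, add_mul, Real.exp_add]
    have h1 := mul_le_mul (h a ha).2.1 (h' a ha).2.1 (norm_nonneg _) (by positivity)
    have h2 : 0 ≤ B * Real.exp (κ * ‖a‖) * (B' * Real.exp (κ' * ‖a‖)) := by positivity
    nlinarith
  · rw [add_mul, Real.exp_add]
    have h1 := mul_le_mul (h a ha).2.2 (h' a ha).2.1 (norm_nonneg _) (by positivity)
    have h2 := mul_le_mul (h a ha).2.1 (h' a ha).2.2 (norm_nonneg _) (by positivity)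
    refine (norm_add_le _ _).trans ?_
    rw [norm_mul, norm_mul]
    nlinarith

theorem Tame.pow {S : Set ℂ} {φ : ℂ → ℂ} (h : Tame S φ) (n : ℕ) : Tame S (fun a => φ a ^ n) := by
  induction n with
  | zero => simpa using tame_const S 1
  | succ n ih => simpa only [pow_succ] using ih.mul h

theorem Tame.prod {S : Set ℂ} {ι : Type*} (s : Finset ι) {φ : ι → ℂ → ℂ}
    (h : ∀ i ∈ s, Tame S (φ i)) : Tame S (fun a => ∏ i ∈ s, φ i a) := by
  classical
  induction s using Finset.induction_on with
  | empty => simpa using tame_const S 1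
  | insert i s hi ih =>
    simp only [Finset.prod_insert hi]
    exact (h i (Finset.mem_insert_self i s)).mul
      (ih fun j hj => h j (Finset.mem_insert_of_mem hj))

theorem tame_inv {S : Set ℂ} {w : ℂ} (hS : ∀ a ∈ S, 1 / 2 ≤ ‖w + Complex.I * a‖) :
    Tame S (fun a => 1 / (w + Complex.I * a)) := by
  have h0 : ∀ a ∈ S, w + Complex.I * a ≠ 0 := fun a ha h => by
    have := hS a ha
    rw [h, norm_zero] at this
    linarith
  have hinv : ∀ a ∈ S, ‖w + Complex.I * a‖⁻¹ ≤ 2 := fun a ha => by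
    rw [inv_le_comm₀ (by linarith [hS a ha]) two_pos]
    linarith [hS a ha]
  refine ⟨fun a => -(Complex.I * 1) / (w + Complex.I * a) ^ 2, 4, 0, by norm_num, le_rfl, ?_,
    fun a ha => ⟨?_, ?_, ?_⟩⟩
  · refine ContinuousOn.div (by fun_prop) (by fun_prop) fun a ha => pow_ne_zero 2 (h0 a ha)
  · simp only [one_div]
    exact (((hasDerivAt_id a).const_mul Complex.I).const_add w).inv (h0 a ha)
  · simp only [one_div, norm_inv, zero_mul, Real.exp_zero, mul_one]
    linarith [hinv a ha]
  · rw [norm_div, norm_neg, mul_one, Complex.norm_I, norm_pow, one_div, ← inv_pow]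
    simp only [zero_mul, Real.exp_zero, mul_one]
    have := hinv a ha
    have h2 : 0 ≤ ‖w + Complex.I * a‖⁻¹ := by positivity
    nlinarith

theorem hasDerivAt_phase (u a : ℂ) :
    HasDerivAt (phase u) (phase u a * (Complex.I * (u + a ^ 2))) a := by
  have h1 : HasDerivAt (fun a : ℂ => Complex.I * (u * a + a ^ 3 / 3))
      (Complex.I * (u * 1 + (3 : ℕ) * a ^ (3 - 1) / 3)) a :=
    (((hasDerivAt_id a).const_mul u).add ((hasDerivAt_pow 3 a).div_const 3)).const_mul Complex.I
  refine h1.cexp.congr_deriv ?_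
  simp only [phase]
  push_cast
  ring

theorem norm_phase_deriv_le (u a : ℂ) {φ φ' : ℂ → ℂ} {B κ : ℝ} (hB : 0 ≤ B)
    (h1 : ‖φ a‖ ≤ B * Real.exp (κ * ‖a‖)) (h2 : ‖φ' a‖ ≤ B * Real.exp (κ * ‖a‖)) :
    ‖phase u a * (Complex.I * (u + a ^ 2)) * φ a + phase u a * φ' a‖ ≤
      ‖phase u a‖ * ((‖u‖ + 3) * B * Real.exp ((κ + 1) * ‖a‖)) := by
  have e1 : 1 ≤ Real.exp ‖a‖ := Real.one_le_exp (norm_nonneg a)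
  have e2 : ‖a‖ ^ 2 ≤ 2 * Real.exp ‖a‖ := by
    have := Real.pow_div_factorial_le_exp ‖a‖ (norm_nonneg a) 2
    norm_num [Nat.factorial] at this
    linarith
  have n1 : ‖Complex.I * (u + a ^ 2)‖ ≤ ‖u‖ + ‖a‖ ^ 2 := by
    rw [norm_mul, Complex.norm_I, one_mul, ← norm_pow]
    exact norm_add_le _ _
  calc _ ≤ ‖phase u a‖ * ‖Complex.I * (u + a ^ 2)‖ * ‖φ a‖ + ‖phase u a‖ * ‖φ' a‖ := by
        refine (norm_add_le _ _).trans ?_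
        rw [norm_mul (phase u a * _), norm_mul (phase u a) (Complex.I * _), norm_mul (phase u a)]
    _ ≤ ‖phase u a‖ * (‖u‖ + ‖a‖ ^ 2) * (B * Real.exp (κ * ‖a‖)) +
        ‖phase u a‖ * (B * Real.exp (κ * ‖a‖)) := by gcongr
    _ = ‖phase u a‖ * (B * Real.exp (κ * ‖a‖)) * (‖u‖ * 1 + ‖a‖ ^ 2 + 1) := by ring
    _ ≤ ‖phase u a‖ * (B * Real.exp (κ * ‖a‖)) *
        (‖u‖ * Real.exp ‖a‖ + 2 * Real.exp ‖a‖ + Real.exp ‖a‖) := by gcongr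
    _ = _ := by rw [add_mul κ, Real.exp_add, one_mul]; ring

/-- The vertex of a wedge contour may be moved along the imaginary axis, as long as the weight is
holomorphic in between. -/
theorem airyWedge_shift {S : Set ℂ} {φ : ℂ → ℂ} (h : Tame S φ) {q q' : ℝ}
    (hS : ∀ t ∈ Icc (0 : ℝ) 1, ∀ e, IsRayDir e → ∀ r : ℝ, 0 ≤ r →
      ((q + t * (q' - q) : ℝ) : ℂ) * Complex.I + r * e ∈ S) (u : ℂ) :
    airyWedge q φ u = airyWedge q' φ u := by
  obtain ⟨φ', B, κ, hB, hκ, hc, hφ⟩ := h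
  set Q := |q| + |q'| with hQ
  have hqt : ∀ t ∈ Icc (0 : ℝ) 1, |q + t * (q' - q)| ≤ Q := by
    intro t ht
    have : q + t * (q' - q) = (1 - t) * q + t * q' := by ring
    rw [this]
    refine (abs_add_le _ _).trans ?_
    rw [abs_mul, abs_mul, abs_of_nonneg ht.1, abs_of_nonneg (by linarith [ht.2] : 0 ≤ 1 - t)]
    nlinarith [abs_nonneg q, abs_nonneg q', ht.1, ht.2]
  obtain ⟨D, hD, hb⟩ := norm_phase_ray_le Q (κ + 2) u.re |u.im|
  set A := D * Real.exp (Q * |u.re|) * ((‖u‖ + 3) * B * Real.exp ((κ + 1) * Q)) with hA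
  have key : ∀ e, IsRayDir e →
      (∫ r in Ioi (0 : ℝ), phase u (q' * Complex.I + r * e) * φ (q' * Complex.I + r * e) * e) -
      ∫ r in Ioi (0 : ℝ), phase u (q * Complex.I + r * e) * φ (q * Complex.I + r * e) * e =
      -∫ t in (0 : ℝ)..1, (phase u (q * Complex.I + t * ((q' - q) * Complex.I)) *
        φ (q * Complex.I + t * ((q' - q) * Complex.I))) * ((q' - q) * Complex.I) := by
    intro e he
    have hpt : ∀ t r : ℝ, (q : ℂ) * Complex.I + t * (((q' : ℂ) - q) * Complex.I) + r * (e + t * 0) =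
        ((q + t * (q' - q) : ℝ) : ℂ) * Complex.I + r * e := by
      intro t r; push_cast; ring
    have hbd : ∀ t ∈ Icc (0 : ℝ) 1, ∀ r : ℝ, 0 ≤ r →
        ‖phase u (((q + t * (q' - q) : ℝ) : ℂ) * Complex.I + r * e)‖ * ((‖u‖ + 3) * B *
          Real.exp ((κ + 1) * ‖((q + t * (q' - q) : ℝ) : ℂ) * Complex.I + r * e‖)) ≤
          A * Real.exp (-(2 * r)) := by
      intro t ht r hr
      have h1 := hb _ e u r (hqt t ht) he le_rfl le_rfl hr
      have h2 : ‖((q + t * (q' - q) : ℝ) : ℂ) * Complex.I + r * e‖ ≤ Q + r :=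
        (he.norm_point_le _ hr).trans (by linarith [hqt t ht])
      have h3 : Real.exp (-((q + t * (q' - q)) * u.re)) ≤ Real.exp (Q * |u.re|) := by
        apply Real.exp_le_exp.2
        refine (neg_le_abs _).trans ?_
        rw [abs_mul]
        gcongr
        exact hqt t ht
      have h4 : Real.exp ((κ + 1) * (Q + r)) = Real.exp ((κ + 1) * Q) *
          (Real.exp ((κ + 2) * r) * Real.exp (-r)) := by
        rw [← Real.exp_add, ← Real.exp_add]; congr 1; ring
      have h5 : Real.exp (-(2 * r)) = Real.exp (-r) * Real.exp (-r) := by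
        rw [← Real.exp_add]; congr 1; ring
      calc _ ≤ ‖phase u (((q + t * (q' - q) : ℝ) : ℂ) * Complex.I + r * e)‖ *
            ((‖u‖ + 3) * B * Real.exp ((κ + 1) * (Q + r))) := by gcongr
        _ = (‖phase u (((q + t * (q' - q) : ℝ) : ℂ) * Complex.I + r * e)‖ *
            Real.exp ((κ + 2) * r)) * ((‖u‖ + 3) * B * Real.exp ((κ + 1) * Q) * Real.exp (-r)) := by
            rw [h4]; ring
        _ ≤ (D * Real.exp (Q * |u.re|) * Real.exp (-r)) *
            ((‖u‖ + 3) * B * Real.exp ((κ + 1) * Q) * Real.exp (-r)) := by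
            refine mul_le_mul_of_nonneg_right (h1.trans ?_) (by positivity)
            gcongr
        _ = _ := by rw [hA, h5]; ring
    have := ray_homotopy (g := fun a => phase u a * φ a)
      (g' := fun a => phase u a * (Complex.I * (u + a ^ 2)) * φ a + phase u a * φ' a)
      (p₀ := q * Complex.I) (p₁ := (q' - q) * Complex.I) (e₀ := e) (e₁ := 0) (C := A) (by positivity)
      ?_ ?_ ?_ ?_
    · rw [← this]
      simp only [add_zero]
      rw [show (q : ℂ) * Complex.I + ((q' : ℂ) - q) * Complex.I = q' * Complex.I by ring]
    · intro t ht r hr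
      rw [hpt]
      exact (hasDerivAt_phase u _).mul (hφ _ (hS t ht e he r hr)).1
    · have hcont : Continuous fun z : ℝ × ℝ => (q : ℂ) * Complex.I +
          z.1 * (((q' : ℂ) - q) * Complex.I) + z.2 * (e + z.1 * 0) := by fun_prop
      have hmaps : MapsTo (fun z : ℝ × ℝ => (q : ℂ) * Complex.I +
          z.1 * (((q' : ℂ) - q) * Complex.I) + z.2 * (e + z.1 * 0)) (Icc 0 1 ×ˢ Ici 0) S := by
        intro z hz
        simp only [hpt]
        exact hS z.1 hz.1 e he z.2 hz.2
      have cφ : ContinuousOn φ S := fun a ha => (hφ a ha).1.continuousAt.continuousWithinAt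
      have cp : Continuous (phase u) := by unfold phase; fun_prop
      have : ContinuousOn (fun a => phase u a * (Complex.I * (u + a ^ 2)) * φ a + phase u a * φ' a) S :=
        ((cp.continuousOn.mul (by fun_prop)).mul cφ).add (cp.continuousOn.mul hc)
      exact this.comp hcont.continuousOn hmaps
    · intro t ht r hr
      rw [hpt]
      refine le_trans ?_ (hbd t ht r hr)
      rw [norm_mul]
      refine mul_le_mul_of_nonneg_left ?_ (norm_nonneg _)
      refine (hφ _ (hS t ht e he r hr)).2.1.trans ?_
      have : κ * ‖((q + t * (q' - q) : ℝ) : ℂ) * Complex.I + r * e‖ ≤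
        (κ + 1) * ‖((q + t * (q' - q) : ℝ) : ℂ) * Complex.I + r * e‖ := by gcongr; linarith
      have h3 : 1 * B ≤ (‖u‖ + 3) * B := by gcongr; linarith [norm_nonneg u]
      rw [one_mul] at h3
      gcongr
    · intro t ht r hr
      rw [hpt]
      have := hφ _ (hS t ht e he r hr)
      exact (norm_phase_deriv_le u _ hB this.2.1 this.2.2).trans (hbd t ht r hr)
  have hR := key _ isRayDir_dirR
  have hL := key _ isRayDir_dirL
  rw [airyWedge_eq, airyWedge_eq]
  rw [← hL] at hR
  congr 1
  linear_combination -hR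

theorem Tame.rayBound {S : Set ℂ} {φ : ℂ → ℂ} (h : Tame S φ) {q : ℝ}
    (hS : ∀ e, IsRayDir e → ∀ r : ℝ, 0 ≤ r → (q : ℂ) * Complex.I + r * e ∈ S) :
    ∃ κ B, 0 ≤ B ∧ RayBound q κ B φ := by
  obtain ⟨φ', B, κ, hB, hκ, hc, hφ⟩ := h
  refine ⟨κ, B * Real.exp (κ * |q|), by positivity, fun e he => ?_, fun e he r hr => ?_⟩
  · have cφ : ContinuousOn φ S := fun a ha => (hφ a ha).1.continuousAt.continuousWithinAt
    refine (cφ.comp (f := fun r : ℝ => (q : ℂ) * Complex.I + r * e) (by fun_prop)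
      fun r hr => ?_).aestronglyMeasurable measurableSet_Ioi
    exact hS e he r (le_of_lt hr)
  · refine (hφ _ (hS e he r hr.le)).2.1.trans ?_
    rw [mul_assoc, ← Real.exp_add]
    have := he.norm_point_le q hr.le
    gcongr
    nlinarith

/-! ### The Airy function and its derivatives -/

/-- The `n`-th derivative of the Airy function, on the complex plane. -/
def airyDerivC (n : ℕ) : ℂ → ℂ := airyWedge 1 (fun a => (Complex.I * a) ^ n)

/-- The `n`-th derivative of the Airy function, on the real line. -/
def airyDeriv (n : ℕ) (u : ℝ) : ℂ := airyDerivC n u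

theorem airyDeriv_zero : airyDeriv 0 = airy := by
  funext u
  simp only [airyDeriv, airyDerivC, airyWedge, airy, pow_zero, mul_one, phase, Complex.ofReal_one,
    one_mul]

/-- Since the weight is entire, the vertex is arbitrary. A vertex far up on the imaginary axis gives
exponential decay at any rate. -/
theorem airyDerivC_eq (q : ℝ) (n : ℕ) (u : ℂ) :
    airyDerivC n u = airyWedge q (fun a => (Complex.I * a) ^ n) u :=
  airyWedge_shift (S := univ) ((tame_id univ).pow n) (fun _ _ _ _ _ _ => mem_univ _) u

theorem rayBound_pow (q : ℝ) (n : ℕ) :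
    ∃ κ B, 0 ≤ B ∧ RayBound q κ B (fun a => (Complex.I * a) ^ n) :=
  ((tame_id univ).pow n).rayBound fun _ _ _ _ => mem_univ _

theorem hasDerivAt_airyDerivC (n : ℕ) (u : ℂ) :
    HasDerivAt (airyDerivC n) (airyDerivC (n + 1) u) u := by
  obtain ⟨κ, B, hB, h⟩ := rayBound_pow 1 n
  have := hasDerivAt_airyWedge hB h u
  simp only [← pow_succ'] at this
  exact this

theorem hasDerivAt_airyDeriv (n : ℕ) (u : ℝ) :
    HasDerivAt (airyDeriv n) (airyDeriv (n + 1) u) u :=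
  (hasDerivAt_airyDerivC n u).comp_ofReal

/-- `g(u) = O(e^{κu})`, uniformly on half-lines. -/
def ExpGrowth (κ : ℝ) (g : ℝ → ℂ) : Prop :=
  ∀ x₀ : ℝ, ∃ C : ℝ, 0 ≤ C ∧ ∀ u, x₀ ≤ u → ‖g u‖ ≤ C * Real.exp (κ * u)

theorem expGrowth_airyWedge {q κ B : ℝ} {φ : ℂ → ℂ} (hB : 0 ≤ B) (h : RayBound q κ B φ) :
    ExpGrowth (-q) (fun u => airyWedge q φ u) := by
  intro x₀
  obtain ⟨D, hD, hb⟩ := norm_airyWedge_le q κ x₀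
  refine ⟨D * B, by positivity, fun u hu => ?_⟩
  have := hb φ B hB h u hu
  rwa [← neg_mul] at this

theorem expGrowth_airyDeriv (κ : ℝ) (n : ℕ) : ExpGrowth κ (airyDeriv n) := by
  obtain ⟨κ', B, hB, h⟩ := rayBound_pow (-κ) n
  have e : airyDeriv n = fun u : ℝ => airyWedge (-κ) (fun a => (Complex.I * a) ^ n) u :=
    funext fun u => airyDerivC_eq (-κ) n u
  rw [e]
  simpa using expGrowth_airyWedge hB h

theorem ExpGrowth.add {κ : ℝ} {g h : ℝ → ℂ} (hg : ExpGrowth κ g) (hh : ExpGrowth κ h) :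
    ExpGrowth κ (fun u => g u + h u) := by
  intro x₀
  obtain ⟨C, hC, h1⟩ := hg x₀
  obtain ⟨C', hC', h2⟩ := hh x₀
  refine ⟨C + C', by positivity, fun u hu => (norm_add_le _ _).trans ?_⟩
  rw [add_mul]
  exact add_le_add (h1 u hu) (h2 u hu)

theorem ExpGrowth.const_mul {κ : ℝ} {g : ℝ → ℂ} (hg : ExpGrowth κ g) (c : ℂ) :
    ExpGrowth κ (fun u => c * g u) := by
  intro x₀
  obtain ⟨C, hC, h1⟩ := hg x₀
  refine ⟨‖c‖ * C, by positivity, fun u hu => ?_⟩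
  rw [norm_mul, mul_assoc]
  exact mul_le_mul_of_nonneg_left (h1 u hu) (norm_nonneg c)

theorem continuous_airyDeriv (n : ℕ) : Continuous (airyDeriv n) :=
  continuous_iff_continuousAt.2 fun u => (hasDerivAt_airyDeriv n u).continuousAt

theorem continuous_airy : Continuous airy := airyDeriv_zero ▸ continuous_airyDeriv 0

theorem expGrowth_airy (κ : ℝ) : ExpGrowth κ airy := airyDeriv_zero ▸ expGrowth_airyDeriv κ 0

/-! ### The functions with poles -/

/-- The weight `∏_j 1/(w_j + ia)` of `s^{(m)}`. -/
def poleWeight {m : ℕ} (w : Fin m → ℂ) (a : ℂ) : ℂ := ∏ j, 1 / (w j + Complex.I * a)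

/-- The poles `i w` with `1 + 2‖w‖ ≤ K` keep a distance `1/2` from the wedge contour with vertex
`-K i`. -/
theorem half_le_norm_add {w e : ℂ} {K r : ℝ} (hK : 1 + 2 * ‖w‖ ≤ K) (he : IsRayDir e) :
    1 / 2 ≤ ‖w + Complex.I * (((-K : ℝ) : ℂ) * Complex.I + r * e)‖ := by
  set z := w + Complex.I * (((-K : ℝ) : ℂ) * Complex.I + r * e) with hz
  have hre : z.re = w.re + K - r / 2 := by
    simp [hz, he.1]; ring
  have him : z.im = w.im + r * e.re := by
    simp [hz]
  have hc : |e.re| ≤ 1 := by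
    rw [← sq_le_one_iff_abs_le_one]; linarith [he.2]
  -- the component of `z` orthogonal to `i e`, which does not depend on `r`
  have h1 : 3 / 2 * z.re + e.re * z.im = 3 / 2 * w.re + 3 / 2 * K + e.re * w.im := by
    rw [hre, him]
    linear_combination r * he.2
  have h2 : |e.re * z.im| ≤ ‖z‖ := by
    rw [abs_mul]
    calc |e.re| * |z.im| ≤ 1 * ‖z‖ := by
          gcongr; exact Complex.abs_im_le_norm z
      _ = _ := one_mul _
  have h3 : |e.re * w.im| ≤ ‖w‖ := by
    rw [abs_mul]
    calc |e.re| * |w.im| ≤ 1 * ‖w‖ := by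
          gcongr; exact Complex.abs_im_le_norm w
      _ = _ := one_mul _
  have h4 := Complex.abs_re_le_norm z
  have h5 := Complex.abs_re_le_norm w
  have h6 := norm_nonneg w
  linarith [le_abs_self z.re, le_abs_self (e.re * z.im), neg_abs_le w.re, neg_abs_le (e.re * w.im)]

theorem rayBound_poleWeight {m : ℕ} {w : Fin m → ℂ} {K : ℝ} (hK : ∀ j, 1 + 2 * ‖w j‖ ≤ K) :
    ∃ κ B, 0 ≤ B ∧ RayBound (-K) κ B (poleWeight w) := by
  refine Tame.rayBound (S := {a | ∀ j, 1 / 2 ≤ ‖w j + Complex.I * a‖})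
    (Tame.prod _ fun j _ => tame_inv fun a ha => ha j) fun e he r _ j => ?_
  exact half_le_norm_add (hK j) he

theorem airyWedge_poleWeight {m : ℕ} {w : Fin m → ℂ} {K K' : ℝ} (hK : ∀ j, 1 + 2 * ‖w j‖ ≤ K)
    (hK' : ∀ j, 1 + 2 * ‖w j‖ ≤ K') (u : ℂ) :
    airyWedge (-K) (poleWeight w) u = airyWedge (-K') (poleWeight w) u := by
  refine airyWedge_shift (S := {a | ∀ j, 1 / 2 ≤ ‖w j + Complex.I * a‖})
    (Tame.prod _ fun j _ => tame_inv fun a ha => ha j) (fun t ht e he r _ j => ?_) u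
  have e1 : -K + t * (-K' - -K) = -((1 - t) * K + t * K') := by ring
  rw [e1]
  refine half_le_norm_add ?_ he
  nlinarith [ht.1, ht.2, mul_le_mul_of_nonneg_left (hK j) (sub_nonneg.2 ht.2),
    mul_le_mul_of_nonneg_left (hK' j) ht.1]

theorem one_add_two_mul_norm_le {m : ℕ} (w : Fin m → ℂ) (j : Fin m) :
    1 + 2 * ‖w j‖ ≤ 1 + 2 * ∑ i, ‖w i‖ := by
  have : ‖w j‖ ≤ ∑ i, ‖w i‖ :=
    Finset.single_le_sum (f := fun i => ‖w i‖) (fun i _ => norm_nonneg _) (Finset.mem_univ j)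
  linarith

theorem sFun_eq {m : ℕ} {w : Fin m → ℂ} {K : ℝ} (hK : ∀ j, 1 + 2 * ‖w j‖ ≤ K) (u : ℝ) :
    sFun w u = airyWedge (-K) (poleWeight w) u := by
  rw [airyWedge_poleWeight hK (one_add_two_mul_norm_le w)]
  simp only [sFun, airyWedge, vertex, poleWeight, phase]
  push_cast
  rw [neg_mul]

theorem cFun_eq_sFun (w : ℂ) : cFun w = sFun ![w] := by
  funext u
  simp [cFun, sFun]

theorem poleWeight_one (w a : ℂ) : poleWeight ![w] a = 1 / (w + Complex.I * a) := by
  simp [poleWeight]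

theorem cFun_eq {w : ℂ} {K : ℝ} (hK : 1 + 2 * ‖w‖ ≤ K) (u : ℝ) :
    cFun w u = airyWedge (-K) (fun a => 1 / (w + Complex.I * a)) u := by
  rw [cFun_eq_sFun, sFun_eq (K := K) (by simpa using hK)]
  congr 1
  funext a; exact poleWeight_one w a

theorem expGrowth_sFun {m : ℕ} {w : Fin m → ℂ} {K : ℝ} (hK : ∀ j, 1 + 2 * ‖w j‖ ≤ K) :
    ExpGrowth K (sFun w) := by
  obtain ⟨κ, B, hB, h⟩ := rayBound_poleWeight hK
  have := expGrowth_airyWedge hB h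
  rw [neg_neg] at this
  rwa [show sFun w = fun u : ℝ => airyWedge (-K) (poleWeight w) u from funext (sFun_eq hK)]

theorem expGrowth_cFun {w : ℂ} {K : ℝ} (hK : 1 + 2 * ‖w‖ ≤ K) : ExpGrowth K (cFun w) := by
  rw [cFun_eq_sFun]
  exact expGrowth_sFun (by simpa using hK)

theorem continuous_sFun {m : ℕ} (w : Fin m → ℂ) : Continuous (sFun w) := by
  have hK := one_add_two_mul_norm_le w
  obtain ⟨κ, B, hB, h⟩ := rayBound_poleWeight hK
  rw [show sFun w = fun u : ℝ => airyWedge _ (poleWeight w) u from funext (sFun_eq hK)]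
  exact continuous_iff_continuousAt.2 fun u =>
    (hasDerivAt_airyWedge hB h u).comp_ofReal.continuousAt

/-- The differential equation `(w + D) C_w = Ai`. -/
theorem hasDerivAt_cFun (w : ℂ) (u : ℝ) : HasDerivAt (cFun w) (airy u - w * cFun w u) u := by
  set K := 1 + 2 * ‖w‖
  have hK : ∀ j, 1 + 2 * ‖(![w] : Fin 1 → ℂ) j‖ ≤ K := by simp [K]
  obtain ⟨κ, B, hB, h⟩ := rayBound_poleWeight hK
  have e0 : poleWeight ![w] = fun a => 1 / (w + Complex.I * a) := funext (poleWeight_one w)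
  rw [e0] at h
  have hd := (hasDerivAt_airyWedge hB h (u : ℂ)).comp_ofReal
  rw [show cFun w = fun u : ℝ => airyWedge (-K) (fun a => 1 / (w + Complex.I * a)) u from
    funext (cFun_eq le_rfl)]
  refine hd.congr_deriv ?_
  have e1 : airyWedge (-K) (fun a => Complex.I * a * (1 / (w + Complex.I * a))) u =
      airyWedge (-K) (fun a => 1 + (-w) * (1 / (w + Complex.I * a))) u := by
    refine airyWedge_congr (fun e he r hr => ?_) u
    have := half_le_norm_add (r := r) (le_refl (1 + 2 * ‖w‖)) he
    have h0 : w + Complex.I * (((-K : ℝ) : ℂ) * Complex.I + r * e) ≠ 0 := fun h => by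
      rw [h, norm_zero] at this
      linarith
    have h2 := mul_one_div_cancel h0
    linear_combination h2
  have e2 : airy u = airyWedge (-K) (fun _ => 1) u := by
    rw [← airyDeriv_zero, airyDeriv, airyDerivC_eq (-K)]
    simp only [pow_zero]
  have hw : RayBound (-K) (0 + κ) (‖-w‖ * B) (fun a => (-w) * (1 / (w + Complex.I * a))) :=
    (RayBound.const (-K) (-w)).mul (norm_nonneg _) h
  rw [e1, airyWedge_add (norm_nonneg _) (by positivity) (RayBound.const (-K) 1) hw,
    airyWedge_const_mul, e2]
  ring

/-! ### Polynomial weights -/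

open Polynomial in
theorem airyWedge_poly (q : ℝ) (P : ℂ[X]) {N : ℕ} (hN : P.natDegree < N) (u : ℝ) :
    airyWedge q (fun a => P.eval (Complex.I * a)) u =
      ∑ k ∈ Finset.range N, P.coeff k * airyDeriv k u := by
  have key : ∀ M : ℕ, (∃ κ B, 0 ≤ B ∧ RayBound q κ B
      (fun a => ∑ k ∈ Finset.range M, P.coeff k * (Complex.I * a) ^ k)) ∧
      airyWedge q (fun a => ∑ k ∈ Finset.range M, P.coeff k * (Complex.I * a) ^ k) u =
      ∑ k ∈ Finset.range M, P.coeff k * airyDeriv k u := by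
    intro M
    induction M with
    | zero =>
      refine ⟨⟨0, 0, le_rfl, by simpa using RayBound.const q 0⟩, ?_⟩
      simpa using airyWedge_const_mul q 0 (fun _ => 0) u
    | succ M ih =>
      obtain ⟨⟨κ, B, hB, h⟩, h2⟩ := ih
      obtain ⟨κ', B', hB', h'⟩ := rayBound_pow q M
      have h'' : RayBound q (0 + κ') (‖P.coeff M‖ * B') (fun a => P.coeff M * (Complex.I * a) ^ M) :=
        (RayBound.const q _).mul (norm_nonneg _) h'
      have mono : ∀ {κ₁ κ₂ B : ℝ} {φ : ℂ → ℂ}, 0 ≤ B → κ₁ ≤ κ₂ → RayBound q κ₁ B φ →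
          RayBound q κ₂ B φ := fun hB hκ h => ⟨h.meas, fun e he r hr =>
            (h.bound e he r hr).trans (by gcongr)⟩
      simp only [Finset.sum_range_succ]
      refine ⟨⟨max κ (0 + κ'), B + ‖P.coeff M‖ * B', by positivity, ?_⟩, ?_⟩
      · exact (mono hB (le_max_left _ _) h).add (mono (by positivity) (le_max_right _ _) h'')
      · rw [airyWedge_add hB (by positivity) h h'', h2, airyWedge_const_mul, airyDeriv,
          airyDerivC_eq q]
  rw [← (key N).2]
  congr 1
  funext a
  rw [Polynomial.eval_eq_sum_range' hN]

open Polynomial in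
/-- The polynomial `∏_j (w_j - X)` of `t^{(n)}`. -/
def nodePoly {n : ℕ} (w : Fin n → ℂ) : ℂ[X] := ∏ j, (C (w j) - X)

theorem natDegree_nodePoly_le {n : ℕ} (w : Fin n → ℂ) : (nodePoly w).natDegree ≤ n := by
  refine (Polynomial.natDegree_prod_le _ _).trans ?_
  refine (Finset.sum_le_card_nsmul _ _ 1 fun j _ => ?_).trans (by simp)
  refine (Polynomial.natDegree_sub_le _ _).trans ?_
  simp

theorem eval_nodePoly {n : ℕ} (w : Fin n → ℂ) (z : ℂ) :
    (nodePoly w).eval z = ∏ j, (w j - z) := by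
  simp [nodePoly, Polynomial.eval_prod]

theorem tFun_eq {n N : ℕ} (w : Fin n → ℂ) (hN : n < N) (v : ℝ) :
    tFun w v = ∑ k ∈ Finset.range N, (nodePoly w).coeff k * airyDeriv k v := by
  rw [← airyWedge_poly 1 (nodePoly w) ((natDegree_nodePoly_le w).trans_lt hN)]
  simp only [eval_nodePoly, tFun, airyWedge, phase, Complex.ofReal_one, one_mul]

open Polynomial in
theorem continuous_coeff_nodePoly (n k : ℕ) :
    Continuous fun w : Fin n → ℂ => (nodePoly w).coeff k := by
  have key : ∀ (s : Finset (Fin n)) (k : ℕ),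
      Continuous fun w : Fin n → ℂ => (∏ j ∈ s, (C (w j) - X)).coeff k := by
    intro s
    induction s using Finset.induction_on with
    | empty => intro k; simpa using continuous_const
    | insert i s hi ih =>
      intro k
      simp only [Finset.prod_insert hi, sub_mul, coeff_sub, coeff_C_mul]
      refine ((continuous_apply i).mul (ih k)).sub ?_
      cases k with
      | zero => simpa using continuous_const
      | succ k => simpa only [coeff_X_mul] using ih k
  exact key Finset.univ k

theorem expGrowth_sum {κ : ℝ} {ι : Type*} (s : Finset ι) (c : ι → ℂ) (g : ι → ℝ → ℂ)
    (hg : ∀ i, ExpGrowth κ (g i)) : ExpGrowth κ (fun u => ∑ i ∈ s, c i * g i u) := by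
  classical
  induction s using Finset.induction_on with
  | empty => intro x₀; exact ⟨0, le_rfl, fun u _ => by simp⟩
  | insert i s hi ih =>
    simp only [Finset.sum_insert hi]
    exact ((hg i).const_mul (c i)).add ih

theorem expGrowth_tFun (κ : ℝ) {n : ℕ} (w : Fin n → ℂ) : ExpGrowth κ (tFun w) := by
  rw [show tFun w = fun v => ∑ k ∈ Finset.range (n + 1), (nodePoly w).coeff k * airyDeriv k v from
    funext (tFun_eq w (Nat.lt_succ_self n))]
  exact expGrowth_sum _ _ _ (expGrowth_airyDeriv κ)

theorem continuous_tFun {n : ℕ} (w : Fin n → ℂ) : Continuous (tFun w) := by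
  rw [show tFun w = fun v => ∑ k ∈ Finset.range (n + 1), (nodePoly w).coeff k * airyDeriv k v from
    funext (tFun_eq w (Nat.lt_succ_self n))]
  exact continuous_finsetSum _ fun k _ => continuous_const.mul (continuous_airyDeriv k)

/-! ### Continuity in the poles -/

theorem norm_prod_sub_prod_le {ι : Type*} (s : Finset ι) (x y : ι → ℂ) {R δ : ℝ} (hR : 1 ≤ R)
    (hx : ∀ i, ‖x i‖ ≤ R) (hy : ∀ i, ‖y i‖ ≤ R) (hd : ∀ i, ‖x i - y i‖ ≤ δ) (hδ : 0 ≤ δ) :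
    ‖∏ i ∈ s, x i - ∏ i ∈ s, y i‖ ≤ s.card * R ^ s.card * δ := by
  classical
  induction s using Finset.induction_on with
  | empty => simp
  | insert i s hi ih =>
    rw [Finset.prod_insert hi, Finset.prod_insert hi, Finset.card_insert_of_notMem hi]
    have e : x i * ∏ j ∈ s, x j - y i * ∏ j ∈ s, y j =
      x i * (∏ j ∈ s, x j - ∏ j ∈ s, y j) + (x i - y i) * ∏ j ∈ s, y j := by ring
    have h2 : ‖∏ j ∈ s, y j‖ ≤ R ^ s.card := by
      rw [norm_prod]
      exact (Finset.prod_le_prod (fun _ _ => norm_nonneg _) fun j _ => hy j).trans (by simp)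
    rw [e]
    refine (norm_add_le _ _).trans ?_
    rw [norm_mul, norm_mul]
    calc _ ≤ R * (s.card * R ^ s.card * δ) + δ * R ^ s.card := by
          gcongr
          · exact hx i
          · exact hd i
      _ ≤ R * (s.card * R ^ s.card * δ) + δ * R ^ s.card * R := by
          have : 0 ≤ δ * R ^ s.card := by positivity
          nlinarith
      _ = _ := by push_cast; ring

/-- `s^{(m)}` depends continuously on the poles, in the norm weighted by `e^{-Ku}`. -/
theorem sFun_sub_le {m : ℕ} {K : ℝ} (x₀ : ℝ) : ∃ C : ℝ, 0 ≤ C ∧ ∀ w w' : Fin m → ℂ,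
    (∀ j, 1 + 2 * ‖w j‖ ≤ K) → (∀ j, 1 + 2 * ‖w' j‖ ≤ K) → ∀ u, x₀ ≤ u →
    ‖sFun w u - sFun w' u‖ ≤ C * ‖w - w'‖ * Real.exp (K * u) := by
  obtain ⟨D, hD, hb⟩ := norm_airyWedge_le (-K) 0 x₀
  refine ⟨D * (m * 2 ^ m * 4), by positivity, fun w w' hw hw' u hu => ?_⟩
  obtain ⟨κ, B, hB, h⟩ := rayBound_poleWeight hw
  obtain ⟨κ', B', hB', h'⟩ := rayBound_poleWeight hw'
  have h'' : RayBound (-K) (0 + κ') (‖(-1 : ℂ)‖ * B') (fun a => (-1) * poleWeight w' a) :=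
    (RayBound.const (-K) (-1)).mul (norm_nonneg _) h'
  have e1 : sFun w u - sFun w' u =
      airyWedge (-K) (fun a => poleWeight w a + (-1) * poleWeight w' a) u := by
    rw [airyWedge_add hB (by positivity) h h'', airyWedge_const_mul, sFun_eq hw, sFun_eq hw']
    ring
  have hbd : RayBound (-K) 0 (m * 2 ^ m * (4 * ‖w - w'‖))
      (fun a => poleWeight w a + (-1) * poleWeight w' a) := by
    refine ⟨fun e he => (h.meas e he).add (h''.meas e he), fun e he r hr => ?_⟩
    set a := ((-K : ℝ) : ℂ) * Complex.I + r * e with ha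
    have hinv : ∀ v : ℂ, 1 + 2 * ‖v‖ ≤ K → v + Complex.I * a ≠ 0 ∧ ‖1 / (v + Complex.I * a)‖ ≤ 2 := by
      intro v hv
      have h1 := half_le_norm_add (r := r) hv he
      refine ⟨fun h => ?_, ?_⟩
      · rw [← ha, h, norm_zero] at h1
        linarith
      · rw [one_div, norm_inv, inv_le_comm₀ (by linarith) two_pos]
        linarith
    have := norm_prod_sub_prod_le Finset.univ (fun j => 1 / (w j + Complex.I * a))
      (fun j => 1 / (w' j + Complex.I * a)) (R := 2) (δ := 4 * ‖w - w'‖) one_le_two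
      (fun j => (hinv _ (hw j)).2) (fun j => (hinv _ (hw' j)).2) (fun j => ?_) (by positivity)
    · simpa [poleWeight, sub_eq_add_neg] using this
    · have a1 := hinv _ (hw j)
      have a2 := hinv _ (hw' j)
      have e3 : 1 / (w j + Complex.I * a) - 1 / (w' j + Complex.I * a) =
          (1 / (w j + Complex.I * a)) * (1 / (w' j + Complex.I * a)) * (w' j - w j) := by
        have := a1.1
        have := a2.1
        field_simp
        ring
      have e4 : ‖w' j - w j‖ ≤ ‖w - w'‖ := by
        rw [norm_sub_rev]; exact norm_le_pi_norm (w - w') j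
      rw [e3, norm_mul, norm_mul]
      calc _ ≤ 2 * 2 * ‖w - w'‖ := by gcongr; exacts [a1.2, a2.2]
        _ = _ := by ring
  rw [e1]
  have := hb _ _ (by positivity) hbd u hu
  rw [neg_mul, neg_neg] at this
  linarith

/-! ### The Airy function as an integral over a horizontal line -/

/-- Gaussian decay of the phase while a ray with vertex `ε i` is rotated to the real direction: then
`|Re a| ≥ 3r/4`, and `19/48 = 9/16 - 1/6` remains after the contribution of `(Im a)³/3`. -/
theorem norm_phase_tilted_le {ε : ℝ} (hε : 0 < ε) (u : ℝ) : ∃ D : ℝ, 0 ≤ D ∧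
    ∀ (r s : ℝ) (a : ℂ), 0 ≤ r → 0 ≤ s → s ≤ 1 / 2 → a.im = ε + r * s → 9 / 16 * r ^ 2 ≤ a.re ^ 2 →
      ‖phase u a‖ ≤ D * Real.exp (-(4 * r)) := by
  set A := 19 / 48 * ε with hA
  have hA0 : 0 < A := by positivity
  set b := ε ^ 2 / 3 + |u| / 2 + 4 with hb
  refine ⟨Real.exp (2 / 3 * ε ^ 3 + |u| * ε + b ^ 2 / (4 * A)), (Real.exp_pos _).le,
    fun r s a hr hs hs' him hre => ?_⟩
  have h1 : -(A * r ^ 2) + b * r ≤ b ^ 2 / (4 * A) := by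
    rw [le_div_iff₀ (by positivity)]
    nlinarith [sq_nonneg (2 * A * r - b)]
  rw [norm_phase, ← Real.exp_add, Real.exp_le_exp, Complex.ofReal_re, Complex.ofReal_im, zero_mul,
    add_zero, him]
  set Y := ε + r * s with hY
  have hY0 : ε ≤ Y := by rw [hY]; nlinarith [mul_nonneg hr hs]
  have hY1 : Y ≤ ε + r / 2 := by rw [hY]; nlinarith
  have hY2 : Y ^ 2 ≤ 2 * ε ^ 2 + r ^ 2 / 2 := by
    have : Y ^ 2 ≤ (ε + r / 2) ^ 2 := by gcongr
    nlinarith [sq_nonneg (ε - r / 2)]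
  have h2 : -(u * Y) ≤ |u| * (ε + r / 2) := by
    calc -(u * Y) ≤ |u * Y| := neg_le_abs _
      _ = |u| * Y := by rw [abs_mul, abs_of_nonneg (hε.le.trans hY0)]
      _ ≤ _ := by gcongr
  have h3 : -a.re ^ 2 * Y ≤ -(9 / 16 * r ^ 2) * Y := by
    have : 0 ≤ Y := hε.le.trans hY0
    nlinarith
  have h4 : Y ^ 3 / 3 ≤ Y * (2 * ε ^ 2 + r ^ 2 / 2) / 3 := by
    have : 0 ≤ Y := hε.le.trans hY0
    nlinarith
  have h5 : ε * r ^ 2 ≤ Y * r ^ 2 := by gcongr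
  have h6 : Y * ε ^ 2 ≤ (ε + r / 2) * ε ^ 2 := by gcongr
  rw [hA, hb] at h1
  nlinarith

/-- A ray of the wedge with vertex `ε i` may be rotated to the horizontal direction `σ = ±1`. -/
theorem ray_rotate {ε : ℝ} (hε : 0 < ε) (u : ℝ) {e : ℂ} (he : IsRayDir e) {σ : ℝ} (hσ : σ ^ 2 = 1)
    (hσe : 0 ≤ σ * e.re) :
    (∫ r in Ioi (0 : ℝ), phase u (ε * Complex.I + r * e) * e) =
      ∫ r in Ioi (0 : ℝ), phase u (ε * Complex.I + r * σ) * σ := by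
  obtain ⟨D, hD, hb⟩ := norm_phase_tilted_le hε u
  have hσ1 : |σ| = 1 := by
    have : |σ| ^ 2 = 1 := by rw [sq_abs, hσ]
    nlinarith [abs_nonneg σ]
  have hpt : ∀ t ∈ Icc (0 : ℝ) 1, ∀ r : ℝ, 0 ≤ r →
      ‖phase u ((ε : ℂ) * Complex.I + t * 0 + r * (e + t * (σ - e)))‖ ≤ D * Real.exp (-(4 * r)) := by
    intro t ht r hr
    refine hb r ((1 - t) / 2) _ hr (by linarith [ht.2]) (by linarith [ht.1]) ?_ ?_
    · simp [he.1]; left; ring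
    · have : ((ε : ℂ) * Complex.I + t * 0 + r * (e + t * (σ - e))).re =
        r * (e.re + t * (σ - e.re)) := by simp
      rw [this, mul_pow, mul_comm]
      refine mul_le_mul_of_nonneg_left ?_ (sq_nonneg r)
      set c := σ * e.re with hc
      have hc2 : c ^ 2 = 3 / 4 := by rw [hc, mul_pow, hσ, he.2, one_mul]
      have hc3 : 3 / 4 ≤ c := by nlinarith
      have : (e.re + t * (σ - e.re)) ^ 2 = ((1 - t) * c + t) ^ 2 := by
        have : (1 - t) * c + t = σ * (e.re + t * (σ - e.re)) := by
          rw [hc]; linear_combination (-t) * hσ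
        rw [this, mul_pow, hσ, one_mul]
      rw [this]
      have h1 : 3 / 4 ≤ (1 - t) * c + t := by nlinarith [ht.1, ht.2]
      nlinarith
  have hnorm : ∀ t ∈ Icc (0 : ℝ) 1, ∀ r : ℝ, 0 ≤ r →
      ‖(ε : ℂ) * Complex.I + t * 0 + r * (e + t * (σ - e))‖ ≤ ε + 2 * r := by
    intro t ht r hr
    have : (e + t * (σ - e) : ℂ) = ((1 - t : ℝ) : ℂ) * e + ((t * σ : ℝ) : ℂ) := by push_cast; ring
    rw [mul_zero, add_zero, this]
    refine (norm_add_le _ _).trans ?_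
    rw [norm_mul, norm_mul, Complex.norm_I, mul_one, Complex.norm_real, Complex.norm_real,
      Real.norm_of_nonneg hε.le, Real.norm_of_nonneg hr]
    have : ‖((1 - t : ℝ) : ℂ) * e + ((t * σ : ℝ) : ℂ)‖ ≤ 2 := by
      refine (norm_add_le _ _).trans ?_
      rw [norm_mul, Complex.norm_real, Complex.norm_real, he.norm_eq,
        Real.norm_of_nonneg (by linarith [ht.2]), Real.norm_eq_abs, abs_mul, hσ1,
        abs_of_nonneg ht.1]
      linarith
    nlinarith
  set C := D * ((|u| + 3) * Real.exp ε) with hC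
  have := ray_homotopy (g := phase u) (g' := fun a => phase u a * (Complex.I * (u + a ^ 2)))
    (p₀ := ε * Complex.I) (p₁ := 0) (e₀ := e) (e₁ := σ - e) (C := C) (by positivity)
    (fun t _ r _ => hasDerivAt_phase _ _) ?_ ?_ ?_
  · simp only [mul_zero, intervalIntegral.integral_zero, neg_zero, add_zero] at this
    rw [sub_eq_zero] at this
    rw [← this]
    simp
  · apply Continuous.continuousOn
    unfold phase; fun_prop
  · intro t ht r hr
    refine (hpt t ht r hr).trans ?_
    rw [hC, mul_assoc]
    refine mul_le_mul_of_nonneg_left ?_ hD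
    have h1 : Real.exp (-(4 * r)) ≤ Real.exp (-(2 * r)) := by gcongr; linarith
    have h2 : 1 ≤ Real.exp ε := Real.one_le_exp hε.le
    have h3 : 1 ≤ (|u| + 3) * Real.exp ε := by nlinarith [abs_nonneg u]
    nlinarith [Real.exp_pos (-(2 * r))]
  · intro t ht r hr
    have h1 := norm_phase_deriv_le u ((ε : ℂ) * Complex.I + t * 0 + r * (e + t * (σ - e)))
      (φ := fun _ => 1) (φ' := fun _ => 0) (B := 1) (κ := 0) zero_le_one (by simp) (by simp)
    simp only [mul_one, mul_zero, add_zero, zero_add, one_mul] at h1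
    have h2 := hpt t ht r hr
    have h3 := hnorm t ht r hr
    simp only [mul_zero, add_zero] at h2 h3 ⊢
    refine h1.trans ?_
    rw [Complex.norm_real, Real.norm_eq_abs]
    calc _ ≤ (D * Real.exp (-(4 * r))) * ((|u| + 3) * Real.exp (ε + 2 * r)) := by gcongr
      _ = D * (|u| + 3) * (Real.exp (-(4 * r)) * Real.exp (ε + 2 * r)) := by ring
      _ = D * (|u| + 3) * (Real.exp ε * Real.exp (-(2 * r))) := by
          rw [← Real.exp_add, ← Real.exp_add]; congr 2; ring
      _ = _ := by rw [hC]; ring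

theorem norm_phase_line (ε t σ : ℝ) : ‖phase t (ε * Complex.I - 2 * Real.pi * σ)‖ =
    Real.exp (-(t * ε) + ε ^ 3 / 3) * Real.exp (-((4 * Real.pi ^ 2 * ε) * σ ^ 2)) := by
  have h1 : ((ε : ℂ) * Complex.I - 2 * Real.pi * σ).re = -(2 * Real.pi * σ) := by simp
  have h2 : ((ε : ℂ) * Complex.I - 2 * Real.pi * σ).im = ε := by simp
  rw [norm_phase, h1, h2, Complex.ofReal_re, Complex.ofReal_im, ← Real.exp_add]
  congr 1
  ring

theorem integrable_phase_line {ε : ℝ} (hε : 0 < ε) (t : ℝ) :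
    Integrable fun σ : ℝ => phase t (ε * Complex.I - 2 * Real.pi * σ) := by
  refine ((integrable_exp_neg_mul_sq (b := 4 * Real.pi ^ 2 * ε) (by positivity)).const_mul
    (Real.exp (-(t * ε) + ε ^ 3 / 3))).mono' ?_ ?_
  · apply Continuous.aestronglyMeasurable
    unfold phase; fun_prop
  · refine Eventually.of_forall fun σ => ?_
    rw [norm_phase_line, neg_mul]

theorem dirR_re_nonneg : 0 ≤ dirR.re := by
  rw [dirR, Complex.exp_ofReal_mul_I_re, Real.cos_pi_div_six]; positivity

theorem dirL_re_nonpos : dirL.re ≤ 0 := by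
  have : 5 * Real.pi / 6 = Real.pi - Real.pi / 6 := by ring
  rw [dirL, Complex.exp_ofReal_mul_I_re, this, Real.cos_pi_sub, Real.cos_pi_div_six]
  have : 0 ≤ √3 := Real.sqrt_nonneg 3
  linarith

theorem airy_eq_line {ε : ℝ} (hε : 0 < ε) (t : ℝ) :
    airy t = ∫ σ : ℝ, phase t (ε * Complex.I - 2 * Real.pi * σ) := by
  have h0 : airy t = airyWedge ε (fun _ => 1) t := by
    rw [← airyDeriv_zero, airyDeriv, airyDerivC_eq ε]
    simp only [pow_zero]
  have hR := ray_rotate hε t isRayDir_dirR (σ := 1) (by norm_num) (by simpa using dirR_re_nonneg)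
  have hL := ray_rotate hε t isRayDir_dirL (σ := -1) (by norm_num) (by simpa using dirL_re_nonpos)
  rw [h0, airyWedge_eq]
  simp only [mul_one]
  rw [hR, hL]
  set F : ℝ → ℂ := fun s => phase t (ε * Complex.I - s) with hF
  have hpi : (0 : ℝ) < 2 * Real.pi := by positivity
  have e1 : (fun σ : ℝ => phase t (ε * Complex.I - 2 * Real.pi * σ)) =
      fun σ : ℝ => F ((2 * Real.pi) * σ) := by
    funext σ; simp only [hF]; push_cast; rfl
  have hFi : Integrable F := by
    have := integrable_phase_line hε t
    rw [e1] at this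
    exact (integrable_comp_mul_left_iff F hpi.ne').1 this
  rw [e1, Measure.integral_comp_mul_left F]
  have e2 : ∫ r in Ioi (0 : ℝ), phase t (ε * Complex.I + r * (1 : ℝ)) * (1 : ℝ) =
      ∫ s in Iic (0 : ℝ), F s := by
    have := integral_comp_neg_Ioi (0 : ℝ) F
    rw [neg_zero] at this
    rw [← this]
    refine setIntegral_congr_fun measurableSet_Ioi fun r _ => ?_
    simp [hF]
  have e3 : ∫ r in Ioi (0 : ℝ), phase t (ε * Complex.I + r * (-1 : ℝ)) * (-1 : ℝ) =
      -∫ s in Ioi (0 : ℝ), F s := by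
    rw [← integral_neg]
    refine setIntegral_congr_fun measurableSet_Ioi fun r _ => ?_
    simp [hF, sub_eq_add_neg]
  have e4 := intervalIntegral.integral_Iic_add_Ioi (b := (0 : ℝ)) hFi.integrableOn hFi.integrableOn
  rw [e2, e3, sub_neg_eq_add, e4, abs_of_pos (inv_pos.2 hpi), Complex.real_smul]
  push_cast
  rw [one_div]

/-! ### Plancherel's theorem for integrable functions -/

open scoped FourierTransform in
/-- For `F` in `L¹ ∩ L²` the Fourier integral agrees with the Fourier transform in `L²`, because
both define the same tempered distribution. -/
theorem eLpNorm_fourier {F : ℝ → ℂ} (h1 : Integrable F) (h2 : MemLp F 2) :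
    eLpNorm (𝓕 F) 2 = eLpNorm F 2 := by
  have hcont : Continuous (𝓕 F) :=
    VectorFourier.fourierIntegral_continuous Real.continuous_fourierChar
      (innerSL ℝ).continuous₂ h1
  set f : Lp ℂ 2 (volume : Measure ℝ) := h2.toLp F with hf
  have hae : 𝓕 F =ᵐ[volume] (𝓕 f : Lp ℂ 2 (volume : Measure ℝ)) := by
    refine ae_eq_of_integral_contDiff_smul_eq hcont.locallyIntegrable
      ((Lp.memLp _).locallyIntegrable one_le_two) fun g g_smooth g_cpt => ?_
    have hg₁ : HasCompactSupport (Complex.ofRealCLM ∘ g) := g_cpt.comp_left rfl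
    have hg₂ : ContDiff ℝ ∞ (Complex.ofRealCLM ∘ g) := by fun_prop
    set G := hg₁.toSchwartzMap hg₂ with hG
    have e1 := congrArg (fun T => T G) (Lp.fourier_toTemperedDistribution_eq f)
    simp only [TemperedDistribution.fourier_apply, Lp.toTemperedDistribution_apply] at e1
    have e2 : ∫ x, (𝓕 G) x • f x = ∫ x, (𝓕 G) x • F x :=
      integral_congr_ae (h2.coeFn_toLp.mono fun x hx => by simp only [hf, hx])
    have e3 : ∫ x, (𝓕 (G : ℝ → ℂ)) x • F x = ∫ x, G x • 𝓕 F x := by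
      simpa using! (VectorFourier.integral_fourierIntegral_smul_eq_flip (L := innerₗ ℝ)
        Real.continuous_fourierChar continuous_inner (μ := volume) (ν := volume)
        (f := (G : ℝ → ℂ)) (g := F) G.integrable h1)
    have e4 : ∀ x, G x = (g x : ℂ) := fun x => rfl
    rw [e2] at e1
    rw [SchwartzMap.fourier_coe, e3] at e1
    simp only [e4] at e1
    simpa [Complex.real_smul] using e1
  rw [eLpNorm_congr_ae hae]
  have := Lp.norm_fourier_eq f
  rw [Lp.norm_def, Lp.norm_def, ENNReal.toReal_eq_toReal_iff' (Lp.eLpNorm_ne_top _)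
    (Lp.eLpNorm_ne_top _)] at this
  rw [this, eLpNorm_congr_ae h2.coeFn_toLp]

/-! ### The Airy transform is a contraction -/

/-- The Airy transform `z ↦ ∫_x^∞ Ai(u + z) h(u) du` of a function on `(x, ∞)`. -/
def airyTransform (x : ℝ) (h : ℝ → ℂ) (z : ℝ) : ℂ := ∫ u in Ioi x, airy (u + z) * h u

theorem memLp_exp_mul {x δ : ℝ} (hδ : 0 < δ) :
    MemLp (fun v : ℝ => Real.exp (-(δ * v))) 2 (halfLine x) := by
  rw [memLp_two_iff_integrable_sq (by fun_prop)]
  have : (fun v : ℝ => Real.exp (-(δ * v)) ^ 2) = fun v => Real.exp (-(2 * δ) * v) := by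
    funext v; rw [← Real.exp_nat_mul]; congr 1; push_cast; ring
  rw [this]
  exact integrableOn_exp_mul_Ioi (by linarith) x

theorem integrable_exp_mul {x δ : ℝ} (hδ : 0 < δ) {h : ℝ → ℂ} (hh : MemLp h 2 (halfLine x)) :
    Integrable (fun u => Real.exp (-(δ * u)) * ‖h u‖) (halfLine x) :=
  (memLp_exp_mul hδ).integrable_mul hh.norm

/-- The function `e^{-εu} h(u)` on `(x, ∞)`, extended by zero. -/
def dampedExt (x ε : ℝ) (h : ℝ → ℂ) : ℝ → ℂ :=
  (Ioi x).indicator fun u => (Real.exp (-(ε * u)) : ℂ) * h u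

theorem eLpNorm_dampedExt_le {x ε : ℝ} (hε : 0 < ε) (h : ℝ → ℂ) :
    eLpNorm (dampedExt x ε h) 2 ≤ ENNReal.ofReal (Real.exp (-(ε * x))) * eLpNorm h 2 (halfLine x) := by
  rw [dampedExt, eLpNorm_indicator_eq_eLpNorm_restrict measurableSet_Ioi]
  refine eLpNorm_le_mul_eLpNorm_of_ae_le_mul ?_ 2
  refine (ae_restrict_iff' measurableSet_Ioi).2 (Eventually.of_forall fun u hu => ?_)
  have hu : x < u := hu
  rw [norm_mul, Complex.norm_real, Real.norm_of_nonneg (Real.exp_pos _).le]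
  gcongr

theorem aestronglyMeasurable_dampedExt {x ε : ℝ} {h : ℝ → ℂ} (hh : MemLp h 2 (halfLine x)) :
    AEStronglyMeasurable (dampedExt x ε h) := by
  refine (aestronglyMeasurable_indicator_iff measurableSet_Ioi).2 (AEStronglyMeasurable.mul ?_ hh.1)
  apply Continuous.aestronglyMeasurable
  fun_prop

theorem integrable_dampedExt {x ε : ℝ} (hε : 0 < ε) {h : ℝ → ℂ} (hh : MemLp h 2 (halfLine x)) :
    Integrable (dampedExt x ε h) := by
  refine (integrable_indicator_iff measurableSet_Ioi).2 ?_
  refine (integrable_exp_mul hε hh).mono' (AEStronglyMeasurable.mul ?_ hh.1) ?_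
  · apply Continuous.aestronglyMeasurable
    fun_prop
  · refine Eventually.of_forall fun u => ?_
    rw [norm_mul, Complex.norm_real, Real.norm_of_nonneg (Real.exp_pos _).le]

theorem memLp_dampedExt {x ε : ℝ} (hε : 0 < ε) {h : ℝ → ℂ} (hh : MemLp h 2 (halfLine x)) :
    MemLp (dampedExt x ε h) 2 :=
  ⟨aestronglyMeasurable_dampedExt hh, (eLpNorm_dampedExt_le hε h).trans_lt
    (ENNReal.mul_lt_top ENNReal.ofReal_lt_top hh.2)⟩

theorem phase_line_shift (ε t σ : ℝ) : phase t (ε * Complex.I - 2 * Real.pi * σ) =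
    (Real.exp (-(ε * t)) : ℂ) * (Complex.exp (((-2 * Real.pi * σ * t : ℝ) : ℂ) * Complex.I) *
      phase 0 (ε * Complex.I - 2 * Real.pi * σ)) := by
  rw [phase, phase, Complex.ofReal_exp, ← Complex.exp_add, ← Complex.exp_add]
  congr 1
  push_cast
  linear_combination (ε * t : ℂ) * Complex.I_sq

open scoped FourierTransform in
/-- With an exponential weight, the Airy transform is the Fourier transform of the Fourier
transform, multiplied by a function of modulus at most `e^{ε³/3}`. -/
theorem exp_mul_airyTransform {x ε : ℝ} (hε : 0 < ε) {h : ℝ → ℂ} (hh : MemLp h 2 (halfLine x))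
    (z : ℝ) : (Real.exp (ε * z) : ℂ) * airyTransform x h z =
      𝓕 (fun σ : ℝ => phase 0 (ε * Complex.I - 2 * Real.pi * σ) * 𝓕 (dampedExt x ε h) σ) z := by
  set m : ℝ → ℂ := fun σ => phase 0 (ε * Complex.I - 2 * Real.pi * σ) with hm
  have hmi : Integrable m := by simpa using integrable_phase_line hε 0
  have hdi := integrable_dampedExt hε hh
  set Φ : ℝ → ℝ → ℂ := fun u σ => dampedExt x ε h u *
    (Complex.exp (((-2 * Real.pi * σ * (u + z) : ℝ) : ℂ) * Complex.I) * m σ) with hΦ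
  have hint : Integrable (Function.uncurry Φ) (volume.prod volume) := by
    refine (hdi.norm.mul_prod hmi.norm).mono' ?_ ?_
    · refine (hdi.aestronglyMeasurable.comp_fst).mul (AEStronglyMeasurable.mul ?_
        hmi.aestronglyMeasurable.comp_snd)
      apply Continuous.aestronglyMeasurable
      fun_prop
    · refine Eventually.of_forall fun p => ?_
      simp only [Function.uncurry, hΦ]
      rw [norm_mul, norm_mul, Complex.norm_exp_ofReal_mul_I, one_mul]
  have hL : (Real.exp (ε * z) : ℂ) * airyTransform x h z = ∫ u, ∫ σ, Φ u σ := by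
    rw [airyTransform, ← integral_const_mul, ← integral_indicator measurableSet_Ioi]
    congr 1
    funext u
    by_cases hu : u ∈ Ioi x
    · simp only [hΦ, dampedExt, indicator_of_mem hu]
      rw [airy_eq_line hε, integral_const_mul]
      simp only [hm]
      have e1 : ∀ σ : ℝ, phase ((u + z : ℝ) : ℂ) (ε * Complex.I - 2 * Real.pi * σ) =
        (Real.exp (-(ε * (u + z))) : ℂ) * (Complex.exp (((-2 * Real.pi * σ * (u + z) : ℝ) : ℂ) *
          Complex.I) * phase 0 (ε * Complex.I - 2 * Real.pi * σ)) := fun σ =>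
            phase_line_shift ε (u + z) σ
      simp only [e1]
      rw [integral_const_mul]
      have e2 : (Real.exp (ε * z) : ℂ) * (Real.exp (-(ε * (u + z))) : ℂ) =
          (Real.exp (-(ε * u)) : ℂ) := by
        rw [← Complex.ofReal_mul, ← Real.exp_add]; congr 2; ring
      rw [← e2]
      ring
    · simp only [hΦ, dampedExt, indicator_of_notMem hu, zero_mul, integral_zero]
  rw [hL, integral_integral_swap hint, Real.fourier_real_eq_integral_exp_smul]
  congr 1
  funext σ
  rw [Real.fourier_real_eq_integral_exp_smul]
  simp only [smul_eq_mul, hΦ]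
  rw [← mul_assoc, ← integral_const_mul]
  congr 1
  funext u
  have : Complex.exp (((-2 * Real.pi * σ * (u + z) : ℝ) : ℂ) * Complex.I) =
      Complex.exp (((-2 * Real.pi * σ * z : ℝ) : ℂ) * Complex.I) *
      Complex.exp (((-2 * Real.pi * u * σ : ℝ) : ℂ) * Complex.I) := by
    rw [← Complex.exp_add]; congr 1; push_cast; ring
  rw [this]
  ring

open scoped FourierTransform in
theorem eLpNorm_exp_mul_airyTransform_le {x ε : ℝ} (hε : 0 < ε) {h : ℝ → ℂ}
    (hh : MemLp h 2 (halfLine x)) :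
    eLpNorm (fun z => (Real.exp (ε * z) : ℂ) * airyTransform x h z) 2 ≤
      ENNReal.ofReal (Real.exp (ε ^ 3 / 3)) * (ENNReal.ofReal (Real.exp (-(ε * x))) *
        eLpNorm h 2 (halfLine x)) := by
  have hdi := integrable_dampedExt hε hh
  have hd2 := memLp_dampedExt hε hh
  set k := 𝓕 (dampedExt x ε h) with hk
  have hkc : Continuous k := VectorFourier.fourierIntegral_continuous Real.continuous_fourierChar
      (innerSL ℝ).continuous₂ hdi
  have hk2 : eLpNorm k 2 = eLpNorm (dampedExt x ε h) 2 := eLpNorm_fourier hdi hd2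
  set m : ℝ → ℂ := fun σ => phase 0 (ε * Complex.I - 2 * Real.pi * σ) with hm
  have hmi : Integrable m := by simpa using integrable_phase_line hε 0
  have hmb : ∀ σ, ‖m σ‖ ≤ Real.exp (ε ^ 3 / 3) := by
    intro σ
    have := norm_phase_line ε 0 σ
    simp only [Complex.ofReal_zero, zero_mul, neg_zero, zero_add] at this
    rw [hm, this]
    refine mul_le_of_le_one_right (Real.exp_pos _).le (Real.exp_le_one_iff.2 ?_)
    rw [neg_nonpos]; positivity
  have hFb : eLpNorm (fun σ => m σ * k σ) 2 ≤
      ENNReal.ofReal (Real.exp (ε ^ 3 / 3)) * eLpNorm k 2 := by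
    refine eLpNorm_le_mul_eLpNorm_of_ae_le_mul (Eventually.of_forall fun σ => ?_) 2
    rw [norm_mul]
    gcongr
    exact hmb σ
  have hF1 : Integrable fun σ => m σ * k σ := by
    refine hmi.mul_bdd (c := ∫ u, ‖dampedExt x ε h u‖) hkc.aestronglyMeasurable
      (Eventually.of_forall fun σ => ?_)
    exact VectorFourier.norm_fourierIntegral_le_integral_norm _ _ _ _ σ
  have hF2 : MemLp (fun σ => m σ * k σ) 2 := by
    refine ⟨hF1.aestronglyMeasurable, hFb.trans_lt (ENNReal.mul_lt_top ENNReal.ofReal_lt_top ?_)⟩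
    rw [hk2]; exact hd2.2
  have e1 : (fun z => (Real.exp (ε * z) : ℂ) * airyTransform x h z) = 𝓕 (fun σ => m σ * k σ) :=
    funext fun z => exp_mul_airyTransform hε hh z
  rw [e1, eLpNorm_fourier hF1 hF2]
  refine hFb.trans ?_
  rw [hk2]
  gcongr
  exact eLpNorm_dampedExt_le hε h

/-- The Airy transform is a contraction from `L²((x, ∞))` to `L²((c, ∞))` for all `x` and `c`. -/
theorem eLpNorm_airyTransform_le {x : ℝ} (c : ℝ) {h : ℝ → ℂ} (hh : MemLp h 2 (halfLine x)) :
    eLpNorm (airyTransform x h) 2 (halfLine c) ≤ eLpNorm h 2 (halfLine x) := by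
  have key : ∀ ε : ℝ, 0 < ε → eLpNorm (airyTransform x h) 2 (halfLine c) ≤
      ENNReal.ofReal (Real.exp (-(ε * c) + ε ^ 3 / 3 - ε * x)) * eLpNorm h 2 (halfLine x) := by
    intro ε hε
    have h1 : eLpNorm (airyTransform x h) 2 (halfLine c) ≤ ENNReal.ofReal (Real.exp (-(ε * c))) *
        eLpNorm (fun z => (Real.exp (ε * z) : ℂ) * airyTransform x h z) 2 (halfLine c) := by
      refine eLpNorm_le_mul_eLpNorm_of_ae_le_mul ?_ 2
      refine (ae_restrict_iff' measurableSet_Ioi).2 (Eventually.of_forall fun z hz => ?_)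
      have hz : c < z := hz
      rw [norm_mul, Complex.norm_real, Real.norm_of_nonneg (Real.exp_pos _).le, ← mul_assoc,
        ← Real.exp_add]
      refine le_mul_of_one_le_left (norm_nonneg _) (Real.one_le_exp ?_)
      nlinarith
    have h2 := (eLpNorm_mono_measure (fun z => (Real.exp (ε * z) : ℂ) * airyTransform x h z)
      (p := 2) (Measure.restrict_le_self (μ := volume) (s := Ioi c))).trans
      (eLpNorm_exp_mul_airyTransform_le hε hh)
    refine h1.trans ((mul_le_mul_right h2 _).trans (le_of_eq ?_))
    rw [← mul_assoc, ← mul_assoc, ← ENNReal.ofReal_mul (Real.exp_pos _).le,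
      ← ENNReal.ofReal_mul (by positivity), ← Real.exp_add, ← Real.exp_add]
    congr 3
  -- all exponential factors tend to `1` as the contour approaches the real line
  have hlim : Tendsto (fun ε : ℝ => ENNReal.ofReal (Real.exp (-(ε * c) + ε ^ 3 / 3 - ε * x)) *
      eLpNorm h 2 (halfLine x)) (𝓝[>] 0) (𝓝 (1 * eLpNorm h 2 (halfLine x))) := by
    refine ENNReal.Tendsto.mul_const ?_ (Or.inl one_ne_zero)
    have hc : Continuous fun ε : ℝ => ENNReal.ofReal (Real.exp (-(ε * c) + ε ^ 3 / 3 - ε * x)) :=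
      ENNReal.continuous_ofReal.comp (by fun_prop)
    have := hc.tendsto 0
    simp only [zero_mul, neg_zero, ne_eq, OfNat.ofNat_ne_zero, not_false_eq_true, zero_pow,
      zero_div, add_zero, sub_zero, Real.exp_zero, ENNReal.ofReal_one] at this
    exact this.mono_left nhdsWithin_le_nhds
  rw [one_mul] at hlim
  refine ge_of_tendsto hlim ?_
  filter_upwards [self_mem_nhdsWithin] with ε hε
  exact key ε hε

/-! ### The Airy transform is analytic -/

/-- The Fourier–Laplace transform `a ↦ ∫_x^∞ e^{iua} h(u) du`. -/
def laplaceWeight (x : ℝ) (h : ℝ → ℂ) (a : ℂ) : ℂ :=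
  ∫ u in Ioi x, Complex.exp (Complex.I * (u * a)) * h u

theorem norm_exp_ray_le {x u r : ℝ} {e : ℂ} (he : IsRayDir e) (hu : x < u) (hr : 0 ≤ r) :
    ‖Complex.exp (Complex.I * (u * ((1 : ℝ) * Complex.I + r * e)))‖ ≤
      Real.exp (-(1 * u)) * Real.exp (|x| / 2 * r) := by
  have him : ((1 : ℝ) * Complex.I + r * e : ℂ).im = 1 + r / 2 := by simp [he.1]; ring
  rw [Complex.norm_exp, ← Real.exp_add, Real.exp_le_exp, Complex.mul_re, Complex.I_re, Complex.I_im,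
    Complex.im_ofReal_mul, him]
  have : -u * r ≤ |x| * r := mul_le_mul_of_nonneg_right (by linarith [neg_abs_le x]) hr
  linarith

theorem rayBound_laplaceWeight {x : ℝ} {h : ℝ → ℂ} (hh : MemLp h 2 (halfLine x)) :
    RayBound 1 (|x| / 2) (∫ u in Ioi x, Real.exp (-(1 * u)) * ‖h u‖) (laplaceWeight x h) where
  meas e he := by
    set h' := hh.1.mk h
    have e1 : (fun r : ℝ => laplaceWeight x h ((1 : ℝ) * Complex.I + r * e)) = fun r : ℝ =>
        ∫ u in Ioi x, Complex.exp (Complex.I * (u * ((1 : ℝ) * Complex.I + r * e))) * h' u := by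
      funext r
      exact integral_congr_ae (hh.1.ae_eq_mk.mono fun u hu => by simp only [hu, h'])
    rw [e1]
    refine (StronglyMeasurable.integral_prod_right (f := fun r u : ℝ =>
      Complex.exp (Complex.I * (u * ((1 : ℝ) * Complex.I + r * e))) * h' u) ?_).aestronglyMeasurable
    refine StronglyMeasurable.mul ?_ (hh.1.stronglyMeasurable_mk.comp_measurable measurable_snd)
    apply Continuous.stronglyMeasurable
    fun_prop
  bound e he r hr := by
    rw [← integral_mul_const]
    refine norm_integral_le_of_norm_le ((integrable_exp_mul one_pos hh).mul_const _) ?_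
    refine (ae_restrict_iff' measurableSet_Ioi).2 (Eventually.of_forall fun u hu => ?_)
    rw [norm_mul]
    have := norm_exp_ray_le he hu hr.le
    calc _ ≤ Real.exp (-(1 * u)) * Real.exp (|x| / 2 * r) * ‖h u‖ := by gcongr
      _ = _ := by ring

/-- Fubini's theorem: the Airy transform is a contour integral with the Airy phase whose weight is a
Fourier–Laplace transform. -/
theorem airyTransform_eq_airyWedge {x : ℝ} {h : ℝ → ℂ} (hh : MemLp h 2 (halfLine x)) (z : ℝ) :
    airyTransform x h z = airyWedge 1 (laplaceWeight x h) z := by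
  have hA : ∀ e, IsRayDir e → Integrable (fun p : ℝ × ℝ =>
      (phase ((p.1 + z : ℝ) : ℂ) ((1 : ℝ) * Complex.I + p.2 * e) * e) * h p.1)
      ((halfLine x).prod (volume.restrict (Ioi 0))) := by
    intro e he
    obtain ⟨D, hD, hb⟩ := norm_phase_ray_le 1 (|x| / 2) z 0
    refine (((integrable_exp_mul one_pos hh).mul_prod (integrableOn_exp_neg.const_mul
      (D * Real.exp (-(1 * z)))))).mono' ?_ ?_
    · refine AEStronglyMeasurable.mul ?_ hh.1.comp_fst
      apply Continuous.aestronglyMeasurable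
      unfold phase; fun_prop
    · rw [Measure.prod_restrict]
      refine (ae_restrict_iff' (measurableSet_Ioi.prod measurableSet_Ioi)).2
        (Eventually.of_forall fun p hp => ?_)
      have h1 : x < p.1 := hp.1
      have h2 : 0 < p.2 := hp.2
      have h3 := hb 1 e z p.2 (by simp) he le_rfl (by simp) h2.le
      have h4 := norm_exp_ray_le he h1 h2.le
      have e1 : phase ((p.1 + z : ℝ) : ℂ) ((1 : ℝ) * Complex.I + p.2 * e) =
          Complex.exp (Complex.I * (p.1 * ((1 : ℝ) * Complex.I + p.2 * e))) *
          phase z ((1 : ℝ) * Complex.I + p.2 * e) := by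
        rw [phase, phase, ← Complex.exp_add]; congr 1; push_cast; ring
      rw [norm_mul, norm_mul, he.norm_eq, mul_one, e1, norm_mul]
      rw [Complex.ofReal_re] at h3
      calc _ ≤ (Real.exp (-(1 * p.1)) * Real.exp (|x| / 2 * p.2)) *
            ‖phase z ((1 : ℝ) * Complex.I + p.2 * e)‖ * ‖h p.1‖ := by gcongr
        _ = Real.exp (-(1 * p.1)) * ‖h p.1‖ * (‖phase z ((1 : ℝ) * Complex.I + p.2 * e)‖ *
            Real.exp (|x| / 2 * p.2)) := by ring
        _ ≤ _ := by gcongr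
  have hswap : ∀ e, IsRayDir e → ∫ u in Ioi x, (∫ r in Ioi (0 : ℝ),
      phase ((u + z : ℝ) : ℂ) ((1 : ℝ) * Complex.I + r * e) * e) * h u =
      ∫ r in Ioi (0 : ℝ), phase z ((1 : ℝ) * Complex.I + r * e) *
        laplaceWeight x h ((1 : ℝ) * Complex.I + r * e) * e := by
    intro e he
    simp only [← integral_mul_const]
    rw [integral_integral_swap (hA e he)]
    congr 1
    funext r
    rw [laplaceWeight, ← integral_const_mul, ← integral_mul_const]
    congr 1
    funext u
    have e1 : phase ((u + z : ℝ) : ℂ) ((1 : ℝ) * Complex.I + r * e) =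
        Complex.exp (Complex.I * (u * ((1 : ℝ) * Complex.I + r * e))) *
        phase z ((1 : ℝ) * Complex.I + r * e) := by
      rw [phase, phase, ← Complex.exp_add]; congr 1; push_cast; ring
    rw [e1]; ring
  have hI : ∀ e, IsRayDir e → Integrable (fun u => (∫ r in Ioi (0 : ℝ),
      phase ((u + z : ℝ) : ℂ) ((1 : ℝ) * Complex.I + r * e) * e) * h u) (halfLine x) := by
    intro e he
    have := (hA e he).integral_prod_left
    simpa only [integral_mul_const] using this
  rw [airyTransform, airyWedge_eq, ← hswap _ isRayDir_dirR, ← hswap _ isRayDir_dirL,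
    ← integral_sub (hI _ isRayDir_dirR) (hI _ isRayDir_dirL), ← integral_const_mul]
  congr 1
  funext u
  have e0 : airy (u + z) = airyWedge 1 (fun _ => 1) ((u + z : ℝ) : ℂ) := by
    rw [← airyDeriv_zero, airyDeriv, airyDerivC]
    simp only [pow_zero]
  rw [e0, airyWedge_eq]
  simp only [mul_one]
  ring

/-- The Airy transform of a square integrable function on a half-line extends to an entire function.
In particular it vanishes if it vanishes on an interval. -/
theorem airyTransform_eq_zero {x c d : ℝ} (hcd : c < d) {h : ℝ → ℂ} (hh : MemLp h 2 (halfLine x))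
    (h0 : ∀ᵐ z ∂(volume.restrict (Ioo c d)), airyTransform x h z = 0) (z : ℝ) :
    airyTransform x h z = 0 := by
  have hB : 0 ≤ ∫ u in Ioi x, Real.exp (-(1 * u)) * ‖h u‖ :=
    integral_nonneg fun u => by positivity
  have hdiff : Differentiable ℂ (airyWedge 1 (laplaceWeight x h)) := fun u =>
    (hasDerivAt_airyWedge hB (rayBound_laplaceWeight hh) u).differentiableAt
  have hcont : Continuous fun z : ℝ => airyWedge 1 (laplaceWeight x h) (z : ℂ) :=
    hdiff.continuous.comp Complex.continuous_ofReal
  simp only [airyTransform_eq_airyWedge hh] at h0 ⊢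
  have h1 : EqOn (fun z : ℝ => airyWedge 1 (laplaceWeight x h) (z : ℂ)) (fun _ => 0) (Ioo c d) :=
    Measure.eqOn_Ioo_of_ae_eq volume h0 hcont.continuousOn continuousOn_const
  obtain ⟨z₀, hz₀⟩ := exists_between hcd
  have hfreq : ∃ᶠ ζ in 𝓝[≠] (z₀ : ℂ), airyWedge 1 (laplaceWeight x h) ζ = (fun _ => 0) ζ := by
    have ht : Tendsto (fun s : ℝ => (s : ℂ)) (𝓝[≠] z₀) (𝓝[≠] (z₀ : ℂ)) :=
      tendsto_nhdsWithin_iff.2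
        ⟨(Complex.continuous_ofReal.tendsto z₀).mono_left nhdsWithin_le_nhds,
        eventually_nhdsWithin_of_forall fun s hs => by simpa using hs⟩
    refine ht.frequently (Eventually.frequently ?_)
    exact (eventually_nhdsWithin_of_eventually_nhds (Ioo_mem_nhds hz₀.1 hz₀.2)).mono
      fun s hs => h1 hs
  have han : AnalyticOnNhd ℂ (airyWedge 1 (laplaceWeight x h)) univ :=
    (Complex.analyticOnNhd_univ_iff_differentiable).2 hdiff
  have := han.eq_of_frequently_eq analyticOnNhd_const hfreq
  exact congrFun this z

/-! ### The operator `1 - A_x` is injective -/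

/-- The Airy operator is the product of two Airy transforms. -/
theorem airyApply_eq_airyTransform {x u : ℝ} {h : ℝ → ℂ} (hh : MemLp h 2 (halfLine x)) :
    airyApply x h u = airyTransform 0 (airyTransform x h) u := by
  have hint : Integrable (fun p : ℝ × ℝ => airy (u + p.2) * airy (p.2 + p.1) * h p.1)
      ((halfLine x).prod (volume.restrict (Ioi 0))) := by
    obtain ⟨C, hC, h1⟩ := expGrowth_airy (-1) u
    obtain ⟨C', hC', h2⟩ := expGrowth_airy (-1) x
    refine ((integrable_exp_mul one_pos hh).mul_prod (integrableOn_exp_neg.const_mul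
      (C * Real.exp (-u) * C'))).mono' ?_ ?_
    · refine AEStronglyMeasurable.mul ?_ hh.1.comp_fst
      apply Continuous.aestronglyMeasurable
      have := continuous_airy
      fun_prop
    · rw [Measure.prod_restrict]
      refine (ae_restrict_iff' (measurableSet_Ioi.prod measurableSet_Ioi)).2
        (Eventually.of_forall fun p hp => ?_)
      have p1 : x < p.1 := hp.1
      have p2 : 0 < p.2 := hp.2
      have a1 : ‖airy (u + p.2)‖ ≤ C * Real.exp (-u) := by
        refine (h1 (u + p.2) (by linarith)).trans ?_
        gcongr
        linarith
      have a2 := h2 (p.2 + p.1) (by linarith)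
      have e : Real.exp (-1 * (p.2 + p.1)) = Real.exp (-p.2) * Real.exp (-(1 * p.1)) := by
        rw [← Real.exp_add]; congr 1; ring
      rw [norm_mul, norm_mul]
      calc _ ≤ (C * Real.exp (-u)) * (C' * Real.exp (-1 * (p.2 + p.1))) * ‖h p.1‖ := by gcongr
        _ = _ := by rw [e]; ring
  rw [airyApply, airyTransform]
  simp only [airyKernel, airyTransform, ← integral_mul_const, ← integral_const_mul]
  rw [integral_integral_swap hint]
  congr 1; funext z; congr 1; funext v
  rw [add_comm v z, add_comm z u]; ring

/-- A fixed point of `A_x` vanishes: both Airy transforms in `A_x` are contractions, so the Airy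
transform of a fixed point vanishes on the negative half-line, hence everywhere. -/
theorem airyOp_fixed_eq_zero (x : ℝ) (φ : Lp ℂ 2 (halfLine x)) (h : airyOp x φ = φ) : φ = 0 := by
  have hφ := Lp.memLp φ
  have hfix : airyTransform 0 (airyTransform x φ) =ᵐ[halfLine x] φ := by
    have h1 := coeFn_airyOp x φ
    rw [h] at h1
    refine (h1.trans (Eventually.of_forall fun u => ?_)).symm
    exact airyApply_eq_airyTransform hφ
  have hmeas : AEStronglyMeasurable (airyTransform x φ) volume := by
    have : Continuous (airyTransform x φ) := by
      rw [show airyTransform x φ = fun z : ℝ => airyWedge 1 (laplaceWeight x φ) z from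
        funext (airyTransform_eq_airyWedge hφ)]
      have hB : 0 ≤ ∫ u in Ioi x, Real.exp (-(1 * u)) * ‖φ u‖ :=
        integral_nonneg fun u => by positivity
      exact continuous_iff_continuousAt.2 fun u =>
        (hasDerivAt_airyWedge hB (rayBound_laplaceWeight hφ) u).comp_ofReal.continuousAt
    exact this.aestronglyMeasurable
  have hG : ∀ c, MemLp (airyTransform x φ) 2 (halfLine c) := fun c =>
    ⟨hmeas.restrict, (eLpNorm_airyTransform_le c hφ).trans_lt hφ.2⟩
  have hle : eLpNorm φ 2 (halfLine x) ≤ eLpNorm (airyTransform x φ) 2 (halfLine 0) := by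
    rw [← eLpNorm_congr_ae hfix]
    exact eLpNorm_airyTransform_le x (hG 0)
  -- the mass on `(-1, ∞)` is at most `‖φ‖²`, which is at most the mass on `(0, ∞)`
  have heq : eLpNorm (airyTransform x φ) 2 (halfLine (-1)) ≤
      eLpNorm (airyTransform x φ) 2 (halfLine 0) := (eLpNorm_airyTransform_le (-1) hφ).trans hle
  have hzero : ∀ᵐ z ∂(volume.restrict (Ioc (-1 : ℝ) 0)), airyTransform x φ z = 0 := by
    have hsq : ∀ c, ∫⁻ z in Ioi c, ‖airyTransform x φ z‖ₑ ^ 2 =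
        eLpNorm (airyTransform x φ) 2 (halfLine c) ^ 2 := fun c => by
      have := eLpNorm_nnreal_pow_eq_lintegral (μ := halfLine c) (f := airyTransform x φ)
        (p := 2) two_ne_zero
      norm_num at this
      exact this.symm
    have hfin : ∫⁻ z in Ioi (0 : ℝ), ‖airyTransform x φ z‖ₑ ^ 2 ≠ ⊤ := by
      rw [hsq]; exact ENNReal.pow_ne_top (hG 0).2.ne
    have hunion : Ioi (-1 : ℝ) = Ioc (-1) 0 ∪ Ioi 0 := (Ioc_union_Ioi_eq_Ioi (by norm_num)).symm
    have hsum : (∫⁻ z in Ioc (-1 : ℝ) 0, ‖airyTransform x φ z‖ₑ ^ 2) +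
        ∫⁻ z in Ioi (0 : ℝ), ‖airyTransform x φ z‖ₑ ^ 2 ≤
        ∫⁻ z in Ioi (0 : ℝ), ‖airyTransform x φ z‖ₑ ^ 2 := by
      rw [← lintegral_union measurableSet_Ioi
        (Set.disjoint_left.2 fun z hz hz' => not_lt.2 hz.2 hz'), ← hunion, hsq, hsq]
      exact pow_le_pow_left₀ (by positivity) heq 2
    have h0 : ∫⁻ z in Ioc (-1 : ℝ) 0, ‖airyTransform x φ z‖ₑ ^ 2 = 0 := by
      have := ENNReal.le_sub_of_add_le_right hfin hsum
      simpa using this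
    rw [lintegral_eq_zero_iff' (by fun_prop)] at h0
    filter_upwards [h0] with z hz
    simpa using hz
  have hall := airyTransform_eq_zero (c := -1) (d := 0) (by norm_num) hφ
    (ae_restrict_of_ae_restrict_of_subset Ioo_subset_Ioc_self hzero)
  rw [Lp.eq_zero_iff_ae_eq_zero]
  refine hfix.symm.trans (Eventually.of_forall fun u => ?_)
  rw [airyTransform]
  simp only [hall, mul_zero, integral_zero, Pi.zero_apply]

/-! ### Translates of a function as a curve in a weighted `L²` space -/

open Classical in
/-- The function `u ↦ e^{-Mu} g(y + u)` as an element of `L²((b, ∞))` (zero if it is not in this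
space). -/
def curve (b M : ℝ) (g : ℝ → ℂ) (y : ℝ) : Lp ℂ 2 (halfLine b) :=
  if h : MemLp (fun u => (Real.exp (-(M * u)) : ℂ) * g (y + u)) 2 (halfLine b) then h.toLp else 0

theorem memLp_of_norm_le {b δ c : ℝ} (hδ : 0 < δ) {h : ℝ → ℂ}
    (hm : AEStronglyMeasurable h (halfLine b)) (hh : ∀ u, b < u → ‖h u‖ ≤ c * Real.exp (-(δ * u))) :
    MemLp h 2 (halfLine b) := by
  refine MemLp.of_le_mul (c := c) (memLp_exp_mul hδ) hm ?_
  refine (ae_restrict_iff' measurableSet_Ioi).2 (Eventually.of_forall fun u hu => ?_)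
  rw [Real.norm_of_nonneg (Real.exp_pos _).le]
  exact hh u hu

theorem norm_le_of_ae_le {b δ c : ℝ} (hδ : 0 < δ) {F : Lp ℂ 2 (halfLine b)} {h : ℝ → ℂ}
    (hF : F =ᵐ[halfLine b] h) (hh : ∀ u, b < u → ‖h u‖ ≤ c * Real.exp (-(δ * u))) :
    ‖F‖ ≤ c * ‖(memLp_exp_mul (x := b) hδ).toLp‖ := by
  refine Lp.norm_le_mul_norm_of_ae_le_mul ?_
  have hpos : ∀ᵐ u ∂(halfLine b), u ∈ Ioi b := ae_restrict_mem measurableSet_Ioi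
  filter_upwards [hF, (memLp_exp_mul (x := b) hδ).coeFn_toLp, hpos] with u e1 e2 hu
  rw [e1, e2, Real.norm_of_nonneg (Real.exp_pos _).le]
  exact hh u hu

theorem continuous_weighted (M y : ℝ) {g : ℝ → ℂ} (hc : Continuous g) :
    Continuous fun u : ℝ => (Real.exp (-(M * u)) : ℂ) * g (y + u) := by
  fun_prop

/-- Pointwise bound for `u ↦ e^{-Mu} g(y + u)`, uniform for `y ≥ y₀`. -/
theorem ExpGrowth.weighted_le {κ : ℝ} {g : ℝ → ℂ} (hg : ExpGrowth κ g) (b M y₀ : ℝ) :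
    ∃ C : ℝ, 0 ≤ C ∧ ∀ y, y₀ ≤ y → ∀ u, b < u →
      ‖(Real.exp (-(M * u)) : ℂ) * g (y + u)‖ ≤ C * Real.exp (κ * y) * Real.exp (-((M - κ) * u)) := by
  obtain ⟨C, hC, h⟩ := hg (y₀ + b)
  refine ⟨C, hC, fun y hy u hu => ?_⟩
  rw [norm_mul, Complex.norm_real, Real.norm_of_nonneg (Real.exp_pos _).le]
  calc _ ≤ Real.exp (-(M * u)) * (C * Real.exp (κ * (y + u))) := by
        gcongr
        exact h _ (by linarith)
    _ = C * (Real.exp (-(M * u)) * Real.exp (κ * (y + u))) := by ring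
    _ = C * (Real.exp (κ * y) * Real.exp (-((M - κ) * u))) := by
        rw [← Real.exp_add, ← Real.exp_add]; congr 2; ring
    _ = _ := by ring

theorem memLp_weighted {κ M : ℝ} {g : ℝ → ℂ} (hg : ExpGrowth κ g) (hc : Continuous g) (hκ : κ < M)
    (b y : ℝ) : MemLp (fun u => (Real.exp (-(M * u)) : ℂ) * g (y + u)) 2 (halfLine b) := by
  obtain ⟨C, hC, h⟩ := hg.weighted_le b M y
  exact memLp_of_norm_le (sub_pos.2 hκ) (continuous_weighted M y hc).aestronglyMeasurable
    (h y le_rfl)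

theorem coeFn_curve {κ M : ℝ} {g : ℝ → ℂ} (hg : ExpGrowth κ g) (hc : Continuous g) (hκ : κ < M)
    (b y : ℝ) : curve b M g y =ᵐ[halfLine b] fun u => (Real.exp (-(M * u)) : ℂ) * g (y + u) := by
  rw [curve, dif_pos (memLp_weighted hg hc hκ b y)]
  exact MemLp.coeFn_toLp _

theorem norm_curve_le {κ M : ℝ} {g : ℝ → ℂ} (hg : ExpGrowth κ g) (hc : Continuous g) (hκ : κ < M)
    (b y₀ : ℝ) : ∃ C : ℝ, 0 ≤ C ∧ ∀ y, y₀ ≤ y → ‖curve b M g y‖ ≤ C * Real.exp (κ * y) := by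
  obtain ⟨C, hC, h⟩ := hg.weighted_le b M y₀
  refine ⟨C * ‖(memLp_exp_mul (x := b) (sub_pos.2 hκ)).toLp‖, by positivity, fun y hy => ?_⟩
  refine (norm_le_of_ae_le (sub_pos.2 hκ) (coeFn_curve hg hc hκ b y) (h y hy)).trans
    (le_of_eq (by ring))

/-- Taylor's formula of order one, with a crude constant. -/
theorem norm_taylor_le {g g' g'' : ℝ → ℂ} {s t C : ℝ} (h1 : ∀ u, HasDerivAt g (g' u) u)
    (h2 : ∀ u, HasDerivAt g' (g'' u) u) (hC : ∀ u ∈ uIcc s t, ‖g'' u‖ ≤ C) :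
    ‖g t - g s - (t - s) * g' s‖ ≤ C * ‖t - s‖ ^ 2 := by
  have hC0 : 0 ≤ C := (norm_nonneg _).trans (hC s left_mem_uIcc)
  have a1 : ∀ u ∈ uIcc s t, ‖g' u - g' s‖ ≤ C * ‖t - s‖ := by
    intro u hu
    refine (Convex.norm_image_sub_le_of_norm_hasDerivWithin_le
      (fun v _ => (h2 v).hasDerivWithinAt) hC (convex_uIcc s t) left_mem_uIcc hu).trans ?_
    gcongr 1
    exact abs_sub_left_of_mem_uIcc hu
  have h3 : ∀ u, HasDerivAt (fun u : ℝ => g u - (u : ℂ) * g' s) (g' u - g' s) u := by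
    intro u
    have h0 : HasDerivAt (fun s : ℝ => (s : ℂ)) 1 u := Complex.ofRealCLM.hasDerivAt
    refine ((h1 u).sub (h0.mul_const (g' s))).congr_deriv ?_
    ring
  have := Convex.norm_image_sub_le_of_norm_hasDerivWithin_le
      (fun v _ => (h3 v).hasDerivWithinAt) a1 (convex_uIcc s t) left_mem_uIcc right_mem_uIcc
  calc _ = ‖(g t - (t : ℂ) * g' s) - (g s - (s : ℂ) * g' s)‖ := by congr 1; ring
    _ ≤ _ := this
    _ = _ := by ring

/-- Translation is differentiable: the derivative of the curve of translates of `g` is the curve of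
translates of `g'`. -/
theorem hasDerivAt_curve {κ M : ℝ} {g g' g'' : ℝ → ℂ} (hκ : κ < M) (hg : ExpGrowth κ g)
    (hg' : ExpGrowth κ g') (hg'' : ExpGrowth κ g'') (h1 : ∀ u, HasDerivAt g (g' u) u)
    (h2 : ∀ u, HasDerivAt g' (g'' u) u) (b y : ℝ) :
    HasDerivAt (curve b M g) (curve b M g' y) y := by
  have hc : Continuous g := continuous_iff_continuousAt.2 fun u => (h1 u).continuousAt
  have hc' : Continuous g' := continuous_iff_continuousAt.2 fun u => (h2 u).continuousAt
  obtain ⟨C, hC, hb⟩ := hg'' (y - 1 + b)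
  have hδ := sub_pos.2 hκ
  set N := ‖(memLp_exp_mul (x := b) hδ).toLp‖
  -- Taylor's formula, pointwise in `u`, with a remainder bounded by a multiple of `e^{-(M - κ)u}`
  have key : ∀ t, |t - y| ≤ 1 → ‖curve b M g t - curve b M g y - (t - y) • curve b M g' y‖ ≤
      C * Real.exp (κ * y + |κ|) * N * ‖t - y‖ ^ 2 := by
    intro t ht
    have hae : (curve b M g t - curve b M g y - (t - y) • curve b M g' y : Lp ℂ 2 (halfLine b))
        =ᵐ[halfLine b] fun u => (Real.exp (-(M * u)) : ℂ) *
          (g (t + u) - g (y + u) - ((t + u : ℝ) - (y + u : ℝ)) * g' (y + u)) := by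
      filter_upwards [Lp.coeFn_sub (curve b M g t - curve b M g y) ((t - y) • curve b M g' y),
        Lp.coeFn_sub (curve b M g t) (curve b M g y), Lp.coeFn_smul (t - y) (curve b M g' y),
        coeFn_curve hg hc hκ b t, coeFn_curve hg hc hκ b y, coeFn_curve hg' hc' hκ b y]
        with u e1 e2 e3 e4 e5 e6
      rw [e1, Pi.sub_apply, e2, Pi.sub_apply, e3, Pi.smul_apply, e4, e5, e6, Complex.real_smul]
      push_cast
      ring
    refine (norm_le_of_ae_le hδ hae (c := C * Real.exp (κ * y + |κ|) * ‖t - y‖ ^ 2)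
      fun u hu => ?_).trans (le_of_eq (by ring))
    have ht' := abs_le.1 ht
    have := norm_taylor_le (s := y + u) (t := t + u) (C := C * (Real.exp (κ * y + |κ|) *
      Real.exp (κ * u))) h1 h2 fun v hv => ?_
    · rw [norm_mul, Complex.norm_real, Real.norm_of_nonneg (Real.exp_pos _).le]
      calc _ ≤ Real.exp (-(M * u)) * (C * (Real.exp (κ * y + |κ|) * Real.exp (κ * u)) *
            ‖(t + u) - (y + u)‖ ^ 2) := by gcongr
        _ = C * Real.exp (κ * y + |κ|) * ‖t - y‖ ^ 2 * (Real.exp (-(M * u)) * Real.exp (κ * u)) := by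
            rw [add_sub_add_right_eq_sub]; ring
        _ = _ := by rw [← Real.exp_add]; congr 2; ring
    · have hv1 : |v - (y + u)| ≤ 1 := by
        refine (abs_sub_left_of_mem_uIcc hv).trans ?_
        rwa [add_sub_add_right_eq_sub]
      have hv2 := abs_le.1 hv1
      refine (hb v (by linarith)).trans ?_
      rw [← Real.exp_add]
      gcongr
      have : κ * (v - (y + u)) ≤ |κ| * 1 := by
        calc _ ≤ |κ * (v - (y + u))| := le_abs_self _
          _ = |κ| * |v - (y + u)| := abs_mul _ _
          _ ≤ _ := by gcongr
      nlinarith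
  rw [hasDerivAt_iff_isLittleO]
  refine Asymptotics.IsBigO.trans_isLittleO ?_ (Asymptotics.isLittleO_pow_sub_sub y one_lt_two)
  refine Asymptotics.IsBigO.of_bound (C * Real.exp (κ * y + |κ|) * N) ?_
  filter_upwards [Metric.closedBall_mem_nhds y one_pos] with t ht
  rw [Metric.mem_closedBall, Real.dist_eq] at ht
  simpa using key t ht

/-! ### The Airy operator as an integral of operators of rank one -/

/-- The bilinear pairing `∫ f g` on `L²((b, ∞))`. -/
def pair (b : ℝ) : Lp ℂ 2 (halfLine b) →L[ℂ] Lp ℂ 2 (halfLine b) →L[ℂ] ℂ :=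
  ContinuousLinearMap.lpPairing (halfLine b) 2 2 (ContinuousLinearMap.mul ℂ ℂ)

theorem pair_apply (b : ℝ) (f g : Lp ℂ 2 (halfLine b)) :
    pair b f g = ∫ u in Ioi b, f u * g u := by
  rw [pair, ContinuousLinearMap.lpPairing_eq_integral]
  rfl

/-- The operator of rank one `h ↦ ⟨e^{Mu} Ai(y + u), h⟩ e^{-Mu} Ai(y + u)`. -/
def airyRankOne (b M y : ℝ) : Lp ℂ 2 (halfLine b) →L[ℂ] Lp ℂ 2 (halfLine b) :=
  (pair b (curve b (-M) airy y)).smulRight (curve b M airy y)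

/-- The operator with kernel `e^{-Mu} (∫_{y₀}^∞ Ai(y + u) Ai(y + v) dy) e^{Mv}` on `L²((b, ∞))`,
defined as an integral of operators of rank one. -/
def airyWeightedOp (b M y₀ : ℝ) : Lp ℂ 2 (halfLine b) →L[ℂ] Lp ℂ 2 (halfLine b) :=
  ∫ y in Ioi y₀, airyRankOne b M y

theorem hasDerivAt_curve_airyDeriv (b M : ℝ) (n : ℕ) (y : ℝ) :
    HasDerivAt (curve b M (airyDeriv n)) (curve b M (airyDeriv (n + 1)) y) y :=
  hasDerivAt_curve (sub_one_lt M) (expGrowth_airyDeriv _ n) (expGrowth_airyDeriv _ (n + 1))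
    (expGrowth_airyDeriv _ (n + 2)) (hasDerivAt_airyDeriv n) (hasDerivAt_airyDeriv (n + 1)) b y

theorem continuous_curve_airy (b M : ℝ) : Continuous (curve b M airy) := by
  rw [← airyDeriv_zero]
  exact continuous_iff_continuousAt.2 fun y => (hasDerivAt_curve_airyDeriv b M 0 y).continuousAt

theorem continuous_airyRankOne (b M : ℝ) : Continuous (airyRankOne b M) := by
  have h1 := (pair b).continuous.comp (continuous_curve_airy b (-M))
  exact (((ContinuousLinearMap.smulRightL ℂ (Lp ℂ 2 (halfLine b))
    (Lp ℂ 2 (halfLine b))).continuous.comp h1).clm_apply (continuous_curve_airy b M))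

theorem norm_curve_airy_le (b M y₀ : ℝ) :
    ∃ C : ℝ, 0 ≤ C ∧ ∀ y, y₀ ≤ y → ‖curve b M airy y‖ ≤ C * Real.exp (-y) := by
  have hκ : min (-1) (M - 1) < M := (min_le_right _ _).trans_lt (sub_one_lt M)
  obtain ⟨C, hC, h⟩ := norm_curve_le (expGrowth_airy (min (-1) (M - 1))) continuous_airy hκ b y₀
  set κ := min (-1) (M - 1) with hκd
  have hκ1 : κ ≤ -1 := min_le_left _ _
  refine ⟨C * Real.exp ((κ + 1) * y₀), by positivity, fun y hy => (h y hy).trans ?_⟩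
  rw [mul_assoc, ← Real.exp_add]
  gcongr
  nlinarith

theorem norm_airyRankOne_le (b M y₀ : ℝ) :
    ∃ C : ℝ, 0 ≤ C ∧ ∀ y, y₀ ≤ y → ‖airyRankOne b M y‖ ≤ C * Real.exp (-y) := by
  obtain ⟨C, hC, h⟩ := norm_curve_airy_le b M y₀
  obtain ⟨C', hC', h'⟩ := norm_curve_airy_le b (-M) y₀
  refine ⟨‖pair b‖ * (C' * Real.exp (-y₀)) * C, by positivity, fun y hy => ?_⟩
  rw [airyRankOne, ContinuousLinearMap.norm_smulRight_apply]
  calc _ ≤ (‖pair b‖ * (C' * Real.exp (-y₀))) * (C * Real.exp (-y)) := by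
        gcongr
        · refine ((pair b).le_opNorm _).trans ?_
          gcongr
          exact (h' y hy).trans (by gcongr)
        · exact h y hy
    _ = _ := by ring

theorem integrableOn_airyRankOne (b M y₀ : ℝ) : IntegrableOn (airyRankOne b M) (Ioi y₀) := by
  obtain ⟨C, hC, h⟩ := norm_airyRankOne_le b M y₀
  refine ((integrableOn_exp_neg_Ioi y₀).const_mul C).mono'
    (continuous_airyRankOne b M).aestronglyMeasurable ?_
  exact (ae_restrict_iff' measurableSet_Ioi).2 (Eventually.of_forall fun y hy => h y (le_of_lt hy))

/-- `∂_x A(x + u, x + v) = -Ai(x + u) Ai(x + v)`, in operator norm. -/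
theorem hasDerivAt_airyWeightedOp (b M y : ℝ) :
    HasDerivAt (airyWeightedOp b M) (-airyRankOne b M y) y := by
  have e : airyWeightedOp b M = fun t => airyWeightedOp b M y - ∫ s in y..t, airyRankOne b M s := by
    funext t
    rw [airyWeightedOp, airyWeightedOp, ← intervalIntegral.integral_Ioi_sub_Ioi'
      (integrableOn_airyRankOne b M y) (integrableOn_airyRankOne b M t), sub_sub_cancel]
  rw [e]
  have hc := continuous_airyRankOne b M
  have := intervalIntegral.integral_hasDerivAt_right (a := y) (b := y)
    (hc.intervalIntegrable y y) (hc.stronglyMeasurableAtFilter _ _) hc.continuousAt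
  exact this.const_sub _

theorem isCompactOperator_airyRankOne (b M y : ℝ) : IsCompactOperator (airyRankOne b M y) := by
  have h : IsCompactOperator
      (ContinuousLinearMap.toSpanSingleton ℂ (curve b M airy y) : ℂ →L[ℂ] Lp ℂ 2 (halfLine b)) :=
    isCompactOperator_of_locallyCompactSpace_rng _
  exact h.comp_clm (pair b (curve b (-M) airy y))

theorem integral_mem_of_isClosed {E : Type*} [NormedAddCommGroup E] [NormedSpace ℂ E]
    [CompleteSpace E] (S : Submodule ℂ E) (hS : IsClosed (S : Set E)) {α : Type*}
    [MeasurableSpace α] {μ : Measure α} {F : α → E} (hF : ∀ a, F a ∈ S) (hi : Integrable F μ) :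
    ∫ a, F a ∂μ ∈ S := by
  have : IsClosed (S : Set E) := hS
  have h := S.mkQL.integral_comp_comm hi
  have h0 : ∀ a, S.mkQL (F a) = 0 := fun a => (Submodule.Quotient.mk_eq_zero S).2 (hF a)
  simp only [h0, integral_zero] at h
  exact (Submodule.Quotient.mk_eq_zero S).1 h.symm

theorem isCompactOperator_airyWeightedOp (b M y₀ : ℝ) :
    IsCompactOperator (airyWeightedOp b M y₀) := by
  have := integral_mem_of_isClosed
    (compactOperator (RingHom.id ℂ) (Lp ℂ 2 (halfLine b)) (Lp ℂ 2 (halfLine b)))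
    isClosed_setOfPred_isCompactOperator
    (fun y => isCompactOperator_airyRankOne b M y) (integrableOn_airyRankOne b M y₀)
  exact this

/-- The Fredholm alternative. -/
theorem isUnit_one_sub_of_isCompactOperator {E : Type*} [NormedAddCommGroup E] [NormedSpace ℂ E]
    [CompleteSpace E] {T : E →L[ℂ] E} (hT : IsCompactOperator T) (h : ∀ v, T v = v → v = 0) :
    IsUnit (1 - T) := by
  rcases hT.hasEigenvalue_or_mem_resolventSet (one_ne_zero (α := ℂ)) with h1 | h1
  · obtain ⟨v, hv⟩ := h1.exists_hasEigenvector
    exact absurd (h v (by simpa using hv.apply_eq_smul)) hv.2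
  · simpa [resolventSet] using h1

/-! ### The kernel of the weighted operator -/

theorem integrableOn_exp_mul_neg {κ : ℝ} (hκ : κ ≤ -1) (y₀ : ℝ) :
    IntegrableOn (fun y : ℝ => Real.exp (κ * y)) (Ioi y₀) :=
  integrableOn_exp_mul_Ioi (by linarith) y₀

/-- A Bochner integral of translates of `Ai` in the weighted `L²` space may be computed
pointwise. -/
theorem integral_smul_curve (b M y₀ : ℝ) {c : ℝ → ℂ} {B : ℝ} (hc : Continuous c)
    (hB : ∀ y, y₀ < y → ‖c y‖ ≤ B) :
    (∫ y in Ioi y₀, c y • curve b M airy y : Lp ℂ 2 (halfLine b)) =ᵐ[halfLine b]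
      fun u => (Real.exp (-(M * u)) : ℂ) * ∫ y in Ioi y₀, c y * airy (y + u) := by
  have hB0 : 0 ≤ B := (norm_nonneg _).trans (hB (y₀ + 1) (by linarith))
  set κ := min (-1) (M - 1) with hκd
  have hκM : κ < M := (min_le_right _ _).trans_lt (sub_one_lt M)
  have hκ1 : κ ≤ -1 := min_le_left _ _
  have hδ := sub_pos.2 hκM
  obtain ⟨C, hC, hw⟩ := (expGrowth_airy κ).weighted_le b M y₀
  set R : ℝ → ℂ := fun u => (Real.exp (-(M * u)) : ℂ) * ∫ y in Ioi y₀, c y * airy (y + u) with hR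
  have hpt : ∀ y, y₀ < y → ∀ u, b < u → ‖c y * ((Real.exp (-(M * u)) : ℂ) * airy (y + u))‖ ≤
      (B * C * Real.exp (κ * y)) * Real.exp (-((M - κ) * u)) := by
    intro y hy u hu
    rw [norm_mul]
    calc _ ≤ B * (C * Real.exp (κ * y) * Real.exp (-((M - κ) * u))) := by
          gcongr
          · exact hB y hy
          · exact hw y hy.le u hu
      _ = _ := by ring
  have hRb : ∀ u, b < u → ‖R u‖ ≤
      (∫ y in Ioi y₀, B * C * Real.exp (κ * y)) * Real.exp (-((M - κ) * u)) := by
    intro u hu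
    simp only [hR]
    rw [← integral_const_mul, ← integral_mul_const]
    refine norm_integral_le_of_norm_le
      (((integrableOn_exp_mul_neg hκ1 y₀).const_mul (B * C)).mul_const _) ?_
    refine (ae_restrict_iff' measurableSet_Ioi).2 (Eventually.of_forall fun y hy => ?_)
    rw [mul_left_comm]
    exact hpt y hy u hu
  have hRm : AEStronglyMeasurable R (halfLine b) := by
    refine AEStronglyMeasurable.mul ?_ ?_
    · apply Continuous.aestronglyMeasurable; fun_prop
    · refine (StronglyMeasurable.integral_prod_right (f := fun u y : ℝ =>
        c y * airy (y + u)) ?_).aestronglyMeasurable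
      apply Continuous.stronglyMeasurable
      have := continuous_airy
      unfold Function.uncurry
      fun_prop
  have hR2 : MemLp R 2 (halfLine b) := memLp_of_norm_le hδ hRm hRb
  have hint : Integrable (fun y => c y • curve b M airy y) (volume.restrict (Ioi y₀)) := by
    obtain ⟨C', hC', h'⟩ := norm_curve_airy_le b M y₀
    refine ((integrableOn_exp_neg_Ioi y₀).const_mul (B * C')).mono'
      (hc.smul (continuous_curve_airy b M)).aestronglyMeasurable ?_
    refine (ae_restrict_iff' measurableSet_Ioi).2 (Eventually.of_forall fun y hy => ?_)
    rw [norm_smul, mul_assoc]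
    have hy : y₀ < y := hy
    gcongr
    · exact hB y hy
    · exact h' y hy.le
  suffices h : (∫ y in Ioi y₀, c y • curve b M airy y) = hR2.toLp R by
    rw [h]; exact hR2.coeFn_toLp
  -- both sides have the same inner product with every `g`, by Fubini's theorem
  refine ext_inner_left ℂ fun g => ?_
  have hg := Lp.memLp g
  rw [← integral_inner hint, L2.inner_def]
  have e1 : ∀ y, inner ℂ g (c y • curve b M airy y) = ∫ u in Ioi b,
      c y * ((Real.exp (-(M * u)) : ℂ) * airy (y + u)) * star (g u) := by
    intro y
    rw [inner_smul_right, L2.inner_def, ← integral_const_mul]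
    refine integral_congr_ae ?_
    filter_upwards [coeFn_curve (expGrowth_airy κ) continuous_airy hκM b y] with u hu
    rw [hu, RCLike.inner_apply]
    simp only [starRingEnd_apply]
    ring
  have e2 : ∫ u in Ioi b, inner ℂ (g u) ((hR2.toLp R : Lp ℂ 2 (halfLine b)) u) =
      ∫ u in Ioi b, ∫ y in Ioi y₀,
        c y * ((Real.exp (-(M * u)) : ℂ) * airy (y + u)) * star (g u) := by
    refine integral_congr_ae ?_
    filter_upwards [hR2.coeFn_toLp] with u hu
    rw [hu, RCLike.inner_apply, integral_mul_const]
    simp only [hR, starRingEnd_apply]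
    rw [← integral_const_mul]
    congr 2
    funext y
    ring
  rw [e2]
  simp only [e1]
  refine integral_integral_swap ?_
  refine (((integrableOn_exp_mul_neg hκ1 y₀).const_mul (B * C)).mul_prod
    (integrable_exp_mul hδ hg)).mono' ?_ ?_
  · refine AEStronglyMeasurable.mul ?_ (continuous_star.comp_aestronglyMeasurable hg.1.comp_snd)
    apply Continuous.aestronglyMeasurable
    have := continuous_airy
    fun_prop
  · rw [Measure.prod_restrict]
    refine (ae_restrict_iff' (measurableSet_Ioi.prod measurableSet_Ioi)).2
      (Eventually.of_forall fun p hp => ?_)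
    simp only [Function.uncurry]
    rw [norm_mul, norm_star]
    refine (mul_le_mul_of_nonneg_right (hpt p.1 hp.1 p.2 hp.2) (norm_nonneg _)).trans
      (le_of_eq (mul_assoc _ _ _))

/-- The integral kernel of the weighted operator. -/
theorem airyWeightedOp_apply (b M y₀ : ℝ) (h : Lp ℂ 2 (halfLine b)) :
    airyWeightedOp b M y₀ h =ᵐ[halfLine b] fun u => (Real.exp (-(M * u)) : ℂ) *
      ∫ v in Ioi b, (∫ y in Ioi y₀, airy (y + u) * airy (y + v)) * ((Real.exp (M * v) : ℂ) * h v) := by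
  have hh := Lp.memLp h
  set c : ℝ → ℂ := fun y => pair b (curve b (-M) airy y) h with hcd
  have hc : Continuous c :=
    (((pair b).continuous.comp (continuous_curve_airy b (-M))).clm_apply continuous_const)
  obtain ⟨C', hC', h'⟩ := norm_curve_airy_le b (-M) y₀
  have hB : ∀ y, y₀ < y → ‖c y‖ ≤ ‖pair b‖ * (C' * Real.exp (-y₀)) * ‖h‖ := by
    intro y hy
    refine ((pair b).le_opNorm₂ _ _).trans ?_
    gcongr
    exact (h' y hy.le).trans (by gcongr)
  have e0 : airyWeightedOp b M y₀ h = ∫ y in Ioi y₀, c y • curve b M airy y := by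
    rw [airyWeightedOp, ContinuousLinearMap.integral_apply (integrableOn_airyRankOne b M y₀)]
    rfl
  rw [e0]
  set κ := min (-1) (-M - 1) with hκd
  have hκM : κ < -M := (min_le_right _ _).trans_lt (sub_one_lt (-M))
  have hκ1 : κ ≤ -1 := min_le_left _ _
  have hδ := sub_pos.2 hκM
  have ec : ∀ y, c y = ∫ v in Ioi b, (Real.exp (M * v) : ℂ) * airy (y + v) * h v := by
    intro y
    simp only [hcd]
    rw [pair_apply]
    refine integral_congr_ae ?_
    filter_upwards [coeFn_curve (expGrowth_airy κ) continuous_airy hκM b y] with v hv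
    rw [hv, neg_mul, neg_neg]
  refine (integral_smul_curve b M y₀ hc hB).trans ?_
  refine (ae_restrict_iff' measurableSet_Ioi).2 (Eventually.of_forall fun u hu => ?_)
  have hu : b < u := hu
  dsimp only
  congr 1
  have e2 : ∫ y in Ioi y₀, c y * airy (y + u) = ∫ y in Ioi y₀, ∫ v in Ioi b,
      (Real.exp (M * v) : ℂ) * airy (y + v) * h v * airy (y + u) := by
    congr 1; funext y
    rw [ec, ← integral_mul_const]
  rw [e2, integral_integral_swap]
  · congr 1; funext v
    rw [← integral_mul_const]
    congr 1; funext y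
    ring
  · obtain ⟨C, hC, hw⟩ := (expGrowth_airy κ).weighted_le b (-M) y₀
    obtain ⟨A, hA, ha⟩ := expGrowth_airy 0 (y₀ + b)
    refine (((integrableOn_exp_mul_neg hκ1 y₀).const_mul (C * A)).mul_prod
      (integrable_exp_mul hδ hh)).mono' ?_ ?_
    · refine AEStronglyMeasurable.mul (AEStronglyMeasurable.mul ?_ hh.1.comp_snd) ?_
      · apply Continuous.aestronglyMeasurable
        have := continuous_airy
        fun_prop
      · apply Continuous.aestronglyMeasurable
        have := continuous_airy
        fun_prop
    · rw [Measure.prod_restrict]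
      refine (ae_restrict_iff' (measurableSet_Ioi.prod measurableSet_Ioi)).2
        (Eventually.of_forall fun p hp => ?_)
      have p1 : y₀ < p.1 := hp.1
      have p2 : b < p.2 := hp.2
      have a1 := hw p.1 p1.le p.2 p2
      have a2 := ha (p.1 + u) (by linarith)
      rw [zero_mul, Real.exp_zero, mul_one] at a2
      rw [neg_mul, neg_neg] at a1
      simp only [Function.uncurry]
      rw [norm_mul, norm_mul]
      calc _ ≤ (C * Real.exp (κ * p.1) * Real.exp (-((-M - κ) * p.2))) * ‖h p.2‖ * A := by gcongr
        _ = _ := by ring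

theorem airyWeightedOp_eq_airyOp (x : ℝ) : airyWeightedOp x 0 0 = airyOp x := by
  ext1 h
  refine Lp.ext ((airyWeightedOp_apply x 0 0 h).trans ((coeFn_airyOp x h).trans ?_).symm)
  refine Eventually.of_forall fun u => ?_
  simp only [zero_mul, neg_zero, Real.exp_zero, Complex.ofReal_one, one_mul, airyApply, airyKernel]
  congr 1; funext v; congr 2; funext z
  rw [add_comm u z]

/-- `1 - A_x` is invertible. -/
theorem isUnit_one_sub_airyOp (x : ℝ) : IsUnit (1 - airyOp x) :=
  isUnit_one_sub_of_isCompactOperator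
    (airyWeightedOp_eq_airyOp x ▸ isCompactOperator_airyWeightedOp x 0 0) (airyOp_fixed_eq_zero x)

/-! ### The Airy operator on functions of exponential growth -/

/-- On half-lines `A(u, v) = O(e^{κu + κ'v})`. The condition on the rates makes `e^{(κ + κ')z}`
integrable over `(0, ∞)`. -/
theorem norm_airyKernel_le' (x κ κ' : ℝ) (hκ : κ + κ' ≤ -1) : ∃ C : ℝ, 0 ≤ C ∧ ∀ u v, x ≤ u → x ≤ v →
    ‖airyKernel u v‖ ≤ C * (Real.exp (κ * u) * Real.exp (κ' * v)) := by
  obtain ⟨C, hC, h⟩ := expGrowth_airy κ x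
  obtain ⟨C', hC', h'⟩ := expGrowth_airy κ' x
  refine ⟨C * C', by positivity, fun u v hu hv => ?_⟩
  calc _ ≤ ∫ z in Ioi (0 : ℝ), C * C' * (Real.exp (κ * u) * Real.exp (κ' * v)) * Real.exp (-z) := by
        refine norm_integral_le_of_norm_le (integrableOn_exp_neg.const_mul _) ?_
        refine (ae_restrict_iff' measurableSet_Ioi).2 (Eventually.of_forall fun z hz => ?_)
        have hz : 0 < z := hz
        have e1 := h (u + z) (by linarith)
        have e2 := h' (z + v) (by linarith)
        rw [norm_mul]
        calc _ ≤ (C * Real.exp (κ * (u + z))) * (C' * Real.exp (κ' * (z + v))) := by gcongr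
          _ = C * C' * (Real.exp (κ * (u + z)) * Real.exp (κ' * (z + v))) := by ring
          _ = C * C' * (Real.exp (κ * u) * Real.exp (κ' * v) * Real.exp ((κ + κ') * z)) := by
              rw [← Real.exp_add, ← Real.exp_add, ← Real.exp_add]; congr 2; ring
          _ ≤ C * C' * (Real.exp (κ * u) * Real.exp (κ' * v) * Real.exp (-z)) := by
              gcongr; nlinarith
          _ = _ := by ring
    _ = _ := by rw [integral_const_mul, integral_exp_neg_Ioi_zero, mul_one]

/-- `e^{-κu} h(u)` is integrable over `(x, ∞)`. -/
def ExpIntegrable (x κ : ℝ) (h : ℝ → ℂ) : Prop :=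
  Integrable (fun u => (Real.exp (-(κ * u)) : ℂ) * h u) (halfLine x)

theorem ExpIntegrable.aestronglyMeasurable {x κ : ℝ} {h : ℝ → ℂ} (hh : ExpIntegrable x κ h) :
    AEStronglyMeasurable h (halfLine x) := by
  have e : h = fun u => (Real.exp (κ * u) : ℂ) * ((Real.exp (-(κ * u)) : ℂ) * h u) := by
    funext u
    rw [← mul_assoc, ← Complex.ofReal_mul, ← Real.exp_add, add_neg_cancel, Real.exp_zero,
      Complex.ofReal_one, one_mul]
  rw [e]
  refine AEStronglyMeasurable.mul ?_ hh.1
  apply Continuous.aestronglyMeasurable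
  fun_prop

theorem ExpGrowth.expIntegrable {κ κ' : ℝ} {g : ℝ → ℂ} (hg : ExpGrowth κ g) (hc : Continuous g)
    (hκ : κ < κ') (x : ℝ) : ExpIntegrable x κ' g := by
  obtain ⟨C, hC, h⟩ := hg x
  refine ((integrableOn_exp_mul_Ioi (a := κ - κ') (by linarith) x).const_mul C).mono' ?_ ?_
  · apply Continuous.aestronglyMeasurable
    fun_prop
  · refine (ae_restrict_iff' measurableSet_Ioi).2 (Eventually.of_forall fun u hu => ?_)
    rw [norm_mul, Complex.norm_real, Real.norm_of_nonneg (Real.exp_pos _).le]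
    calc _ ≤ Real.exp (-(κ' * u)) * (C * Real.exp (κ * u)) := by
          gcongr
          exact h u (le_of_lt hu)
      _ = C * (Real.exp (-(κ' * u)) * Real.exp (κ * u)) := by ring
      _ = _ := by rw [← Real.exp_add]; congr 2; ring

theorem expIntegrable_of_memLp {x : ℝ} {h : ℝ → ℂ} (hh : MemLp h 2 (halfLine x)) :
    ExpIntegrable x 1 h := by
  refine (integrable_exp_mul one_pos hh).mono' (AEStronglyMeasurable.mul ?_ hh.1) ?_
  · apply Continuous.aestronglyMeasurable
    fun_prop
  · refine Eventually.of_forall fun u => ?_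
    rw [norm_mul, Complex.norm_real, Real.norm_of_nonneg (Real.exp_pos _).le]

theorem ExpIntegrable.airyKernel_mul {x κ : ℝ} {h : ℝ → ℂ} (hh : ExpIntegrable x κ h) {u : ℝ}
    (hu : x ≤ u) : Integrable (fun v => airyKernel u v * h v) (halfLine x) := by
  obtain ⟨C, hC, hk⟩ := norm_airyKernel_le' x (κ - 1) (-κ) (by linarith)
  refine (hh.norm.const_mul (C * Real.exp ((κ - 1) * u))).mono' ?_ ?_
  · exact (stronglyMeasurable_airyKernel.comp_measurable (g := fun v => (u, v))
      (by fun_prop)).aestronglyMeasurable.mul hh.aestronglyMeasurable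
  · refine (ae_restrict_iff' measurableSet_Ioi).2 (Eventually.of_forall fun v hv => ?_)
    have := hk u v hu (le_of_lt hv)
    rw [norm_mul, norm_mul, Complex.norm_real, Real.norm_of_nonneg (Real.exp_pos _).le, ← neg_mul]
    calc _ ≤ C * (Real.exp ((κ - 1) * u) * Real.exp (-κ * v)) * ‖h v‖ := by gcongr
      _ = _ := by ring

theorem ExpIntegrable.memLp_airyApply {x κ : ℝ} {h : ℝ → ℂ} (hh : ExpIntegrable x κ h) :
    MemLp (airyApply x h) 2 (halfLine x) := by
  obtain ⟨C, hC, hk⟩ := norm_airyKernel_le' x (-1 - |κ|) (-κ) (by linarith [neg_abs_le κ])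
  have hδ : 0 < 1 + |κ| := by positivity
  refine memLp_of_norm_le (c := C * ∫ v in Ioi x, ‖(Real.exp (-(κ * v)) : ℂ) * h v‖) hδ
    (aestronglyMeasurable_airyApply x hh.aestronglyMeasurable) fun u hu => ?_
  have : C * (∫ v in Ioi x, ‖(Real.exp (-(κ * v)) : ℂ) * h v‖) * Real.exp (-((1 + |κ|) * u)) =
      ∫ v in Ioi x, (C * Real.exp (-((1 + |κ|) * u))) * ‖(Real.exp (-(κ * v)) : ℂ) * h v‖ := by
    rw [integral_const_mul]; ring
  rw [this]
  refine norm_integral_le_of_norm_le (hh.norm.const_mul _) ?_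
  refine (ae_restrict_iff' measurableSet_Ioi).2 (Eventually.of_forall fun v hv => ?_)
  have h1 := hk u v (le_of_lt hu) (le_of_lt hv)
  rw [norm_mul, norm_mul, Complex.norm_real, Real.norm_of_nonneg (Real.exp_pos _).le, ← neg_mul]
  have e : (-1 - |κ|) * u = -((1 + |κ|) * u) := by ring
  rw [e] at h1
  calc _ ≤ C * (Real.exp (-((1 + |κ|) * u)) * Real.exp (-κ * v)) * ‖h v‖ := by gcongr
    _ = _ := by ring_nf

theorem pairingConverges_of_growth {x κ : ℝ} {s t : ℝ → ℂ} (hs : ExpGrowth κ s) (hsc : Continuous s)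
    (ht : ∀ κ', ExpGrowth κ' t) (htc : Continuous t) : PairingConverges x s t := by
  have hsi := hs.expIntegrable hsc (lt_add_one κ) x
  refine ⟨fun u hu => hsi.airyKernel_mul hu.le, hsi.memLp_airyApply, ?_⟩
  simp only [airyResolvent, dif_pos hsi.memLp_airyApply, add_mul]
  refine Integrable.add ?_ ?_
  · obtain ⟨C, hC, h⟩ := ht (-(κ + 1)) x
    refine (hsi.norm.const_mul C).mono' (hsc.mul htc).aestronglyMeasurable ?_
    refine (ae_restrict_iff' measurableSet_Ioi).2 (Eventually.of_forall fun u hu => ?_)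
    have := h u (le_of_lt hu)
    rw [norm_mul, norm_mul, Complex.norm_real, Real.norm_of_nonneg (Real.exp_pos _).le, ← neg_mul]
    calc _ ≤ ‖s u‖ * (C * Real.exp (-(κ + 1) * u)) := by gcongr
      _ = _ := by ring
  · have ht2 : MemLp t 2 (halfLine x) := by
      obtain ⟨C, hC, h⟩ := ht (-1) x
      refine memLp_of_norm_le (c := C) one_pos htc.aestronglyMeasurable fun u hu => ?_
      rw [← neg_mul]
      exact h u hu.le
    exact (Lp.memLp _).integrable_mul ht2

/-! ### Translation to the half-line `(0, ∞)` -/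

theorem measurePreserving_shift (x : ℝ) :
    MeasurePreserving (fun v : ℝ => v + x) (halfLine 0) (halfLine x) := by
  have h := (measurePreserving_add_right volume x).restrict_preimage (s := Ioi x) measurableSet_Ioi
  have e : (fun v : ℝ => v + x) ⁻¹' Ioi x = Ioi 0 := by
    ext v; simp
  rwa [e] at h

theorem integral_shift (x : ℝ) (F : ℝ → ℂ) : ∫ v in Ioi x, F v = ∫ v in Ioi (0 : ℝ), F (v + x) :=
  ((measurePreserving_shift x).integral_comp (measurableEmbedding_addRight x) F).symm

theorem kernel_shift (x u v : ℝ) :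
    ∫ y in Ioi x, airy (y + u) * airy (y + v) = airyKernel (u + x) (v + x) := by
  rw [integral_shift x fun y => airy (y + u) * airy (y + v), airyKernel]
  congr 1; funext z; congr 2 <;> ring_nf

/-- The function on `(x, ∞)` which corresponds to `χ` in the weighted space over `(0, ∞)`. -/
def unweight (x M : ℝ) (χ : ℝ → ℂ) (v : ℝ) : ℂ := (Real.exp (M * (v - x)) : ℂ) * χ (v - x)

theorem unweight_add (x M : ℝ) (χ : ℝ → ℂ) (v : ℝ) :
    unweight x M χ (v + x) = (Real.exp (M * v) : ℂ) * χ v := by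
  simp [unweight]

theorem ae_shift {x : ℝ} {p : ℝ → Prop} (h : ∀ᵐ v ∂(halfLine 0), p (v + x)) :
    ∀ᵐ u ∂(halfLine x), p u := by
  rw [← (measurePreserving_shift x).map_eq, (measurableEmbedding_addRight x).ae_map_iff]
  exact h

theorem expIntegrable_unweight (x M : ℝ) (χ : Lp ℂ 2 (halfLine 0)) :
    ExpIntegrable x (M + 1) (unweight x M χ) := by
  rw [ExpIntegrable, ← (measurePreserving_shift x).integrable_comp_emb (measurableEmbedding_addRight x)]
  refine ((expIntegrable_of_memLp (Lp.memLp χ)).const_mul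
    (Real.exp (-((M + 1) * x)) : ℂ)).congr (Eventually.of_forall fun v => ?_)
  simp only [Function.comp, unweight_add]
  rw [← mul_assoc, ← mul_assoc, ← Complex.ofReal_mul, ← Complex.ofReal_mul, ← Real.exp_add,
    ← Real.exp_add]
  congr 3
  ring

theorem airyWeightedOp_apply' (x M : ℝ) (χ : Lp ℂ 2 (halfLine 0)) :
    airyWeightedOp 0 M x χ =ᵐ[halfLine 0] fun u => (Real.exp (-(M * u)) : ℂ) *
      airyApply x (unweight x M χ) (u + x) := by
  refine (airyWeightedOp_apply 0 M x χ).trans (Eventually.of_forall fun u => ?_)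
  dsimp only
  congr 1
  rw [airyApply, integral_shift x fun v => airyKernel (u + x) v * unweight x M χ v]
  simp only [unweight_add, kernel_shift]

/-- A solution `χ` of `χ = s̃ + Ã χ` in the weighted space over `(0, ∞)`, where `s̃` and `Ã` correspond
to `s` and `A_x`, corresponds to the function `(1 - A_x)⁻¹ s`. -/
theorem unweight_eq {x κ M : ℝ} {s : ℝ → ℂ} (hs : ExpGrowth κ s) (hsc : Continuous s) (hκ : κ < M)
    {χ : Lp ℂ 2 (halfLine 0)} (hχ : χ = curve 0 M s x + airyWeightedOp 0 M x χ) :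
    unweight x M χ =ᵐ[halfLine x] airyResolvent x s := by
  set η := unweight x M χ with hη
  have hηi := expIntegrable_unweight x M χ
  have hsi := hs.expIntegrable hsc hκ x
  set ψ := airyApply x η with hψ
  have hψ2 : MemLp ψ 2 (halfLine x) := hηi.memLp_airyApply
  have h1 : η =ᵐ[halfLine x] fun u => s u + ψ u := by
    refine ae_shift ?_
    have h0 := Lp.coeFn_add (curve 0 M s x) (airyWeightedOp 0 M x χ)
    rw [← hχ] at h0
    filter_upwards [h0, coeFn_curve hs hsc hκ 0 x, airyWeightedOp_apply' x M χ] with v e1 e2 e3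
    rw [hη, unweight_add, e1, Pi.add_apply, e2, e3, ← mul_add, ← mul_assoc, ← Complex.ofReal_mul,
      ← Real.exp_add, add_neg_cancel, Real.exp_zero, Complex.ofReal_one, one_mul, add_comm x v]
  have h2 : ∀ u, x < u → ψ u = airyApply x s u + airyApply x ψ u := by
    intro u hu
    rw [hψ, airyApply_congr x u h1]
    simp only [airyApply, mul_add]
    exact integral_add (hsi.airyKernel_mul hu.le)
      ((expIntegrable_of_memLp hψ2).airyKernel_mul hu.le)
  have h3 : hψ2.toLp ψ = hsi.memLp_airyApply.toLp _ + airyOp x (hψ2.toLp ψ) := by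
    refine Lp.ext ?_
    have hpos : ∀ᵐ u ∂(halfLine x), u ∈ Ioi x := ae_restrict_mem measurableSet_Ioi
    filter_upwards [hψ2.coeFn_toLp, hsi.memLp_airyApply.coeFn_toLp, coeFn_airyOp x (hψ2.toLp ψ),
      Lp.coeFn_add (hsi.memLp_airyApply.toLp _) (airyOp x (hψ2.toLp ψ)), hpos] with u e1 e2 e3 e4 hu
    rw [e1, e4, Pi.add_apply, e2, e3, airyApply_congr x u hψ2.coeFn_toLp]
    exact h2 u hu
  have h4 : Ring.inverse (1 - airyOp x) (hsi.memLp_airyApply.toLp _) = hψ2.toLp ψ := by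
    have e1 : hsi.memLp_airyApply.toLp _ = (1 - airyOp x) (hψ2.toLp ψ) := by
      rw [sub_apply, one_apply_eq_self]
      exact eq_sub_of_add_eq h3.symm
    rw [e1, ← mul_apply_eq_comp, Ring.inverse_mul_cancel _ (isUnit_one_sub_airyOp x),
      one_apply_eq_self]
  filter_upwards [h1, hψ2.coeFn_toLp] with u e1 e2
  rw [e1, airyResolvent, dif_pos hsi.memLp_airyApply, h4, e2]

theorem airyResolvent_zero (x : ℝ) : airyResolvent x (fun _ => 0) =ᵐ[halfLine x] fun _ => 0 := by
  have h0 : MemLp (fun _ : ℝ => (0 : ℂ)) 2 (halfLine x) := MemLp.zero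
  refine (airyResolvent_of_memLp x (isUnit_one_sub_airyOp x) h0).trans ?_
  have : h0.toLp (fun _ => 0) = 0 := MemLp.toLp_zero _
  rw [this, map_zero]
  exact Lp.coeFn_zero ℂ 2 (halfLine x)

theorem isUnit_one_sub_airyWeightedOp (x M : ℝ) : IsUnit (1 - airyWeightedOp 0 M x) := by
  refine isUnit_one_sub_of_isCompactOperator (isCompactOperator_airyWeightedOp 0 M x)
    fun χ hχ => ?_
  have hg : ExpGrowth (M - 1) (fun _ => 0) := fun _ => ⟨0, le_rfl, fun _ _ => by simp⟩
  have hc0 : curve 0 M (fun _ => 0) x = 0 := by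
    rw [Lp.eq_zero_iff_ae_eq_zero]
    refine (coeFn_curve hg continuous_const (sub_one_lt M) 0 x).trans
      (Eventually.of_forall fun u => by simp)
  have h1 := (unweight_eq hg continuous_const (sub_one_lt M) (χ := χ) (x := x)
    (by rw [hc0, hχ, zero_add])).trans (airyResolvent_zero x)
  have h2 := (measurePreserving_shift x).quasiMeasurePreserving.ae h1
  rw [Lp.eq_zero_iff_ae_eq_zero]
  filter_upwards [h2] with v hv
  rw [unweight_add] at hv
  simpa using hv

/-- The inverse of `1 - A_x` in the space of functions `h` on `(x, ∞)` with
`u ↦ e^{-Mu} h(x + u)` in `L²((0, ∞))`. -/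
def weightedResolvent (M x : ℝ) : Lp ℂ 2 (halfLine 0) →L[ℂ] Lp ℂ 2 (halfLine 0) :=
  Ring.inverse (1 - airyWeightedOp 0 M x)

/-- The pairings of the theorem, in the fixed space `L²((0, ∞))`. -/
theorem pairing_eq {x κ M : ℝ} {s t : ℝ → ℂ} (hs : ExpGrowth κ s) (hsc : Continuous s) (hκ : κ < M)
    (ht : ∀ κ', ExpGrowth κ' t) (htc : Continuous t) : pairing x s t =
      pair 0 (curve 0 (-M) t x) (weightedResolvent M x (curve 0 M s x)) := by
  set χ := weightedResolvent M x (curve 0 M s x) with hχd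
  have hχ : χ = curve 0 M s x + airyWeightedOp 0 M x χ := by
    have : (1 - airyWeightedOp 0 M x) χ = curve 0 M s x := by
      rw [hχd, weightedResolvent, ← mul_apply_eq_comp,
        Ring.mul_inverse_cancel _ (isUnit_one_sub_airyWeightedOp x M), one_apply_eq_self]
    rw [← this, sub_apply, one_apply_eq_self, sub_add_cancel]
  have h1 := unweight_eq hs hsc hκ hχ
  have e1 : pairing x s t = ∫ u in Ioi x, unweight x M χ u * t u :=
    integral_congr_ae (h1.mono fun u hu => by simp only [hu])
  rw [e1, integral_shift x fun u => unweight x M χ u * t u, pair_apply]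
  refine integral_congr_ae ?_
  filter_upwards [coeFn_curve (ht (-M - 1)) htc (sub_one_lt (-M)) 0 x] with u hu
  rw [hu, unweight_add, neg_mul, neg_neg, add_comm x u]
  ring

/-! ### The Fredholm series -/

open scoped ComplexOrder in
/-- A form of Hadamard's inequality: it follows from `λ ≤ e^{λ - 1}` for the eigenvalues `λ` of a
multiple of `Mᴴ M`. -/
theorem norm_det_sq_le {n : ℕ} (M : Matrix (Fin n) (Fin n) ℂ) {C : ℝ} (hC : 0 < C)
    (hM : ∀ i j, ‖M i j‖ ≤ C) : ‖M.det‖ ^ 2 ≤ (C ^ 2 * n) ^ n := by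
  rcases Nat.eq_zero_or_pos n with rfl | hn
  · simp
  have hP := Matrix.posSemidef_conjTranspose_mul_self M
  set lam := hP.isHermitian.eigenvalues with hlam
  have hn' : (0 : ℝ) < n := by exact_mod_cast hn
  set c : ℝ := C ^ 2 * n with hc
  have hc0 : 0 < c := by positivity
  have hdet : ‖M.det‖ ^ 2 = ∏ i, lam i := by
    have h1 := hP.isHermitian.det_eq_prod_eigenvalues
    rw [Matrix.det_mul, Matrix.det_conjTranspose] at h1
    have h2 : (star M.det * M.det : ℂ) = ((‖M.det‖ ^ 2 : ℝ) : ℂ) := by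
      rw [Complex.star_def, mul_comm, Complex.mul_conj, Complex.normSq_eq_norm_sq]
    rw [h2] at h1
    have h3 : ((∏ i, lam i : ℝ) : ℂ) = ∏ i, (lam i : ℂ) := by push_cast; rfl
    have h4 : ((‖M.det‖ ^ 2 : ℝ) : ℂ) = ((∏ i, lam i : ℝ) : ℂ) := by rw [h1, h3]; rfl
    exact_mod_cast h4
  have htr : ∑ i, lam i ≤ n * c := by
    have h1 := hP.isHermitian.trace_eq_sum_eigenvalues
    have h2 : (M.conjTranspose * M).trace = ((∑ i, ∑ j, ‖M j i‖ ^ 2 : ℝ) : ℂ) := by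
      simp only [Matrix.trace, Matrix.diag_apply, Matrix.mul_apply, Matrix.conjTranspose_apply]
      push_cast
      refine Finset.sum_congr rfl fun i _ => Finset.sum_congr rfl fun j _ => ?_
      rw [Complex.star_def, mul_comm, Complex.mul_conj, Complex.normSq_eq_norm_sq]
      push_cast; rfl
    have h3 : ((∑ i, lam i : ℝ) : ℂ) = ∑ i, (lam i : ℂ) := by push_cast; rfl
    have h4 : ((∑ i, ∑ j, ‖M j i‖ ^ 2 : ℝ) : ℂ) = ((∑ i, lam i : ℝ) : ℂ) := by
      rw [← h2, h1, h3]; rfl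
    have h5 : ∑ i, ∑ j, ‖M j i‖ ^ 2 = ∑ i, lam i := by exact_mod_cast h4
    rw [← h5]
    calc ∑ i, ∑ j, ‖M j i‖ ^ 2 ≤ ∑ i : Fin n, ∑ j : Fin n, C ^ 2 := by
          gcongr with i _ j _
          exact hM j i
      _ = n * c := by
          simp only [Finset.sum_const, Finset.card_univ, Fintype.card_fin, nsmul_eq_mul, hc]
          ring
  rw [hdet]
  calc ∏ i, lam i = c ^ n * ∏ i, (lam i / c) := by
        rw [Finset.prod_div_distrib, Finset.prod_const, Finset.card_univ, Fintype.card_fin,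
          mul_div_cancel₀ _ (by positivity)]
    _ ≤ c ^ n * ∏ i, Real.exp (lam i / c - 1) := by
        gcongr with i _
        · intro i _
          exact div_nonneg (hP.eigenvalues_nonneg i) hc0.le
        · linarith [Real.add_one_le_exp (lam i / c - 1)]
    _ = c ^ n * Real.exp (∑ i, lam i / c - n) := by
        rw [← Real.exp_sum, Finset.sum_sub_distrib]; simp
    _ ≤ c ^ n * 1 := by
        gcongr
        rw [Real.exp_le_one_iff, ← Finset.sum_div, sub_nonpos, div_le_iff₀ hc0]
        exact htr
    _ = c ^ n := mul_one _

/-- Hadamard's inequality for `(e^{u_i} A(u_i, u_j) e^{u_j})`, whose entries are bounded. -/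
theorem norm_det_airyKernel_le (x : ℝ) : ∃ C : ℝ, 0 < C ∧ ∀ (n : ℕ) (u : Fin n → ℝ),
    (∀ i, x ≤ u i) → ‖(Matrix.of fun i j => airyKernel (u i) (u j)).det‖ ≤
      √((C ^ 2 * n) ^ n) * ∏ i, Real.exp (-2 * u i) := by
  obtain ⟨C, hC, hk⟩ := norm_airyKernel_le x
  refine ⟨C + 1, by positivity, fun n u hu => ?_⟩
  set B : Matrix (Fin n) (Fin n) ℂ := Matrix.of fun i j =>
    (Real.exp (u i) : ℂ) * (Real.exp (u j) : ℂ) * airyKernel (u i) (u j) with hB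
  have hBb : ∀ i j, ‖B i j‖ ≤ C + 1 := by
    intro i j
    simp only [hB, Matrix.of_apply]
    rw [norm_mul, norm_mul, Complex.norm_real, Complex.norm_real,
      Real.norm_of_nonneg (Real.exp_pos _).le, Real.norm_of_nonneg (Real.exp_pos _).le]
    calc _ ≤ Real.exp (u i) * Real.exp (u j) * (C * (Real.exp (-u i) * Real.exp (-u j))) := by
          gcongr
          exact hk _ _ (hu i) (hu j)
      _ = C * (Real.exp (u i) * Real.exp (-u i)) * (Real.exp (u j) * Real.exp (-u j)) := by ring
      _ = C := by
          rw [← Real.exp_add, ← Real.exp_add, add_neg_cancel, add_neg_cancel, Real.exp_zero]; ring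
      _ ≤ C + 1 := by linarith
  have hdet : (Matrix.of fun i j => airyKernel (u i) (u j)).det =
      (∏ i, (Real.exp (-u i) : ℂ)) * ((∏ i, (Real.exp (-u i) : ℂ)) * B.det) := by
    rw [← Matrix.det_mul_row, ← Matrix.det_mul_column]
    congr 1
    ext i j
    simp only [Matrix.of_apply, hB]
    have : ∀ t : ℝ, (Real.exp (-t) : ℂ) * (Real.exp t : ℂ) = 1 := fun t => by
      rw [← Complex.ofReal_mul, ← Real.exp_add, neg_add_cancel, Real.exp_zero, Complex.ofReal_one]
    calc airyKernel (u i) (u j) = ((Real.exp (-u i) : ℂ) * (Real.exp (u i) : ℂ)) *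
          ((Real.exp (-u j) : ℂ) * (Real.exp (u j) : ℂ)) * airyKernel (u i) (u j) := by
          rw [this, this, one_mul, one_mul]
      _ = _ := by ring
  have hp : ‖∏ i, (Real.exp (-u i) : ℂ)‖ = ∏ i, Real.exp (-u i) := by
    rw [norm_prod]
    refine Finset.prod_congr rfl fun i _ => ?_
    rw [Complex.norm_real, Real.norm_of_nonneg (Real.exp_pos _).le]
  have he : ∏ i, Real.exp (-2 * u i) = (∏ i, Real.exp (-u i)) * ∏ i, Real.exp (-u i) := by
    rw [← Finset.prod_mul_distrib]
    refine Finset.prod_congr rfl fun i _ => ?_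
    rw [← Real.exp_add]; congr 1; ring
  have hd : ‖B.det‖ ≤ √(((C + 1) ^ 2 * n) ^ n) :=
    Real.le_sqrt_of_sq_le (norm_det_sq_le B (by positivity) hBb)
  rw [hdet, norm_mul, norm_mul, hp, he]
  have h0 : 0 ≤ ∏ i, Real.exp (-u i) := Finset.prod_nonneg fun i _ => (Real.exp_pos _).le
  calc _ ≤ (∏ i, Real.exp (-u i)) * ((∏ i, Real.exp (-u i)) * √(((C + 1) ^ 2 * n) ^ n)) := by gcongr
    _ = _ := by ring

theorem ae_mem_pi (x : ℝ) (n : ℕ) : ∀ᵐ u : Fin n → ℝ ∂(Measure.pi fun _ => halfLine x),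
    ∀ i, x ≤ u i := by
  rw [ae_all_iff]
  intro i
  have h : ∀ᵐ v ∂(halfLine x), x ≤ v :=
    (ae_restrict_iff' measurableSet_Ioi).2 (Eventually.of_forall fun v hv => le_of_lt hv)
  exact (Measure.quasiMeasurePreserving_eval (μ := fun _ : Fin n => halfLine x) i).ae h

theorem integrable_prod_exp (x : ℝ) (n : ℕ) : Integrable (fun u : Fin n → ℝ =>
    ∏ i, Real.exp (-2 * u i)) (Measure.pi fun _ => halfLine x) :=
  Integrable.fintype_prod (f := fun (_ : Fin n) (v : ℝ) => Real.exp (-2 * v))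
    fun _ => integrableOn_exp_mul_Ioi (by norm_num) x

theorem integrable_det_airyKernel (x : ℝ) (n : ℕ) : Integrable (fun u : Fin n → ℝ =>
    (Matrix.of fun i j => airyKernel (u i) (u j)).det) (Measure.pi fun _ => halfLine x) := by
  obtain ⟨C, hC, h⟩ := norm_det_airyKernel_le x
  refine ((integrable_prod_exp x n).const_mul (√((C ^ 2 * n) ^ n))).mono' ?_ ?_
  · simp only [Matrix.det_apply]
    refine Finset.aestronglyMeasurable_fun_sum _ fun σ _ => AEStronglyMeasurable.const_smul ?_ _
    refine Finset.aestronglyMeasurable_fun_prod _ fun i _ => ?_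
    refine (stronglyMeasurable_airyKernel.comp_measurable
      (g := fun u : Fin n → ℝ => (u (σ i), u i)) ?_).aestronglyMeasurable
    fun_prop
  · filter_upwards [ae_mem_pi x n] with u hu
    exact h n u hu

theorem summable_fredholm (x : ℝ) :
    Summable fun n : ℕ => (-1) ^ n / (n.factorial : ℂ) * fredholmTerm x n := by
  obtain ⟨C, hC, h⟩ := norm_det_airyKernel_le x
  set I := ∫ v in Ioi x, Real.exp (-2 * v) with hI
  have hI0 : 0 ≤ I := integral_nonneg fun v => (Real.exp_pos _).le
  have hft : ∀ n, ‖fredholmTerm x n‖ ≤ √((C ^ 2 * n) ^ n) * I ^ n := by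
    intro n
    have e : ∫ u : Fin n → ℝ, ∏ i, Real.exp (-2 * u i) ∂(Measure.pi fun _ => halfLine x) = I ^ n := by
      rw [integral_fintype_prod_eq_prod (f := fun (_ : Fin n) (v : ℝ) => Real.exp (-2 * v))]
      simp [hI]
    rw [← e, ← integral_const_mul]
    refine norm_integral_le_of_norm_le ((integrable_prod_exp x n).const_mul _) ?_
    filter_upwards [ae_mem_pi x n] with u hu
    exact h n u hu
  set A := C ^ 2 * I ^ 2 * Real.exp 1 with hA
  have hbound : ∀ n : ℕ, ‖(-1) ^ n / (n.factorial : ℂ) * fredholmTerm x n‖ ≤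
      (1 / 2) ^ n + (2 * A) ^ n / n.factorial := by
    intro n
    set t := ‖(-1) ^ n / (n.factorial : ℂ) * fredholmTerm x n‖ with ht
    have hf : (0 : ℝ) < n.factorial := by exact_mod_cast n.factorial_pos
    have h1 : t = ‖fredholmTerm x n‖ / n.factorial := by
      rw [ht, norm_mul, norm_div, norm_pow, norm_neg, norm_one, one_pow, Complex.norm_natCast]
      ring
    have h2 : ‖fredholmTerm x n‖ ^ 2 ≤ (C ^ 2 * n) ^ n * (I ^ n) ^ 2 := by
      calc _ ≤ (√((C ^ 2 * n) ^ n) * I ^ n) ^ 2 := by gcongr; exact hft n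
        _ = _ := by rw [mul_pow, Real.sq_sqrt (by positivity)]
    have h3 : (n : ℝ) ^ n ≤ Real.exp 1 ^ n * n.factorial := by
      have := Real.pow_div_factorial_le_exp (n : ℝ) (Nat.cast_nonneg n) n
      rw [div_le_iff₀ hf] at this
      rwa [← Real.exp_nat_mul, mul_one]
    have h4 : t ^ 2 ≤ A ^ n / n.factorial := by
      rw [h1, div_pow, div_le_div_iff₀ (by positivity) hf]
      calc ‖fredholmTerm x n‖ ^ 2 * n.factorial ≤
            ((C ^ 2 * n) ^ n * (I ^ n) ^ 2) * n.factorial := by gcongr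
        _ = (C ^ 2 * I ^ 2) ^ n * (n : ℝ) ^ n * n.factorial := by
            rw [mul_pow, mul_pow (C ^ 2) (I ^ 2), ← pow_mul I, ← pow_mul I, mul_comm n 2]; ring
        _ ≤ (C ^ 2 * I ^ 2) ^ n * (Real.exp 1 ^ n * n.factorial) * n.factorial := by gcongr
        _ = _ := by rw [hA, mul_pow (C ^ 2 * I ^ 2)]; ring
    have ht0 : 0 ≤ t := norm_nonneg _
    -- `t²` decays factorially, and `2 (2^n t) ≤ 1 + (2^n t)²` turns this into a bound for `t`
    have h5 : 2 * (2 ^ n * t) ≤ 1 + (2 ^ n * t) ^ 2 := by nlinarith [sq_nonneg (2 ^ n * t - 1)]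
    have h6 : (2 ^ n * t) ^ 2 ≤ (4 * A) ^ n / n.factorial := by
      rw [mul_pow, ← pow_mul, mul_comm n 2, pow_mul, mul_pow, mul_div_assoc]
      norm_num
      exact h4
    have h7 : t = (1 / 2) ^ n * (2 ^ n * t) := by
      rw [← mul_assoc, ← mul_pow]; norm_num
    have h8 : (1 / 2 : ℝ) ^ n * ((4 * A) ^ n / n.factorial) = (2 * A) ^ n / n.factorial := by
      rw [← mul_div_assoc, ← mul_pow]; congr 2; ring
    have h9 : 0 ≤ (4 * A) ^ n / n.factorial := by positivity
    calc t = (1 / 2) ^ n * (2 ^ n * t) := h7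
      _ ≤ (1 / 2) ^ n * (1 + (4 * A) ^ n / n.factorial) := by gcongr; linarith
      _ = _ := by rw [mul_add, h8, mul_one]
  refine Summable.of_norm_bounded ?_ hbound
  exact (summable_geometric_of_lt_one (by norm_num) (by norm_num)).add
    (Real.summable_pow_div_factorial _)

/-! ### Differentiation of the resolvent -/

section Resolvent

variable {E : Type*} [NormedAddCommGroup E] [NormedSpace ℂ E]

theorem contDiff_of_hasDerivAt_succ {F : Type*} [NormedAddCommGroup F] [NormedSpace ℝ F]
    {g : ℕ → ℝ → F} (h : ∀ n y, HasDerivAt (g n) (g (n + 1) y) y) (n : ℕ) : ContDiff ℝ ∞ (g n) := by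
  refine contDiff_infty.2 fun N => ?_
  induction N generalizing n with
  | zero =>
    exact contDiff_zero.2 (continuous_iff_continuousAt.2 fun y => (h n y).continuousAt)
  | succ N ih =>
    push_cast
    refine contDiff_succ_iff_deriv.2 ⟨fun y => (h n y).differentiableAt, by simp, ?_⟩
    rw [show deriv (g n) = g (n + 1) from funext fun y => (h n y).deriv]
    exact ih (n + 1)

/-- A solution of `c' = α - w c` is as smooth as `α`. -/
theorem contDiff_of_hasDerivAt_sub_smul {α c : ℝ → E} {w : ℂ} (hα : ContDiff ℝ ∞ α)
    (hc : ∀ y, HasDerivAt c (α y - w • c y) y) : ContDiff ℝ ∞ c := by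
  refine contDiff_infty.2 fun N => ?_
  induction N with
  | zero =>
    exact contDiff_zero.2 (continuous_iff_continuousAt.2 fun y => (hc y).continuousAt)
  | succ N ih =>
    push_cast
    refine contDiff_succ_iff_deriv.2 ⟨fun y => (hc y).differentiableAt, by simp, ?_⟩
    rw [show deriv c = fun y => α y - w • c y from funext fun y => (hc y).deriv]
    exact (hα.of_le (by exact_mod_cast le_top)).sub (ih.const_smul w)

theorem hasDerivAt_inverse_one_sub [CompleteSpace E] {A : ℝ → E →L[ℂ] E} {A' : E →L[ℂ] E} {y : ℝ}
    (hA : HasDerivAt A A' y) (hu : IsUnit (1 - A y)) :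
    HasDerivAt (fun t => Ring.inverse (1 - A t))
      (Ring.inverse (1 - A y) * A' * Ring.inverse (1 - A y)) y := by
  obtain ⟨U, hU⟩ := hu
  have h1 := (hasFDerivAt_ringInverse (𝕜 := ℂ) U).restrictScalars ℝ
  rw [hU] at h1
  have h2 : HasDerivAt (fun t => 1 - A t) (-A') y := hA.const_sub 1
  refine (h1.comp_hasDerivAt y h2).congr_deriv ?_
  rw [← hU, Ring.inverse_unit]
  simp

theorem contDiff_inverse_one_sub [CompleteSpace E] {A : ℝ → E →L[ℂ] E} (hA : ContDiff ℝ ∞ A)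
    (hu : ∀ y, IsUnit (1 - A y)) : ContDiff ℝ ∞ fun t => Ring.inverse (1 - A t) := by
  refine contDiff_iff_contDiffAt.2 fun y => ?_
  obtain ⟨U, hU⟩ := hu y
  have h1 := (contDiffAt_ringInverse ℂ U (n := ∞)).restrict_scalars ℝ
  rw [hU] at h1
  exact h1.comp y (contDiff_const.sub hA).contDiffAt

/-- Data with the differential equations of the Airy operator: `A' = -α ⊗ β₀`, where
`β_n' = β_{n+1}`, and `1 - A` is invertible. -/
structure RankOneFlow (A : ℝ → E →L[ℂ] E) (α : ℝ → E) (β : ℕ → ℝ → E →L[ℂ] ℂ) : Prop where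
  hasDerivAt_op : ∀ y, HasDerivAt A (-(β 0 y).smulRight (α y)) y
  hasDerivAt_functional : ∀ n y, HasDerivAt (β n) (β (n + 1) y) y
  contDiff_vector : ContDiff ℝ ∞ α
  isUnit_one_sub : ∀ y, IsUnit (1 - A y)

variable {A : ℝ → E →L[ℂ] E} {α : ℝ → E} {β : ℕ → ℝ → E →L[ℂ] ℂ}

theorem contDiff_clm_apply_complex {F : Type*} [NormedAddCommGroup F] [NormedSpace ℂ F]
    {L : ℝ → E →L[ℂ] F} {v : ℝ → E} (hL : ContDiff ℝ ∞ L) (hv : ContDiff ℝ ∞ v) :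
    ContDiff ℝ ∞ fun y => L y (v y) :=
  (isBoundedBilinearMap_apply (𝕜 := ℂ) (E := E) (F := F)).contDiff.restrict_scalars ℝ |>.comp
    (hL.prodMk hv)

theorem hasDerivAt_clm_apply_complex {F : Type*} [NormedAddCommGroup F] [NormedSpace ℂ F]
    {L : ℝ → E →L[ℂ] F} {L' : E →L[ℂ] F} {v : ℝ → E} {v' : E} {y : ℝ} (hL : HasDerivAt L L' y)
    (hv : HasDerivAt v v' y) : HasDerivAt (fun t => L t (v t)) (L' (v y) + L y v') y := by
  have h := ((isBoundedBilinearMap_apply (𝕜 := ℂ) (E := E) (F := F)).hasFDerivAt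
    (L y, v y)).restrictScalars ℝ
  refine (h.comp_hasDerivAt y (hL.prodMk hv)).congr_deriv ?_
  simp [IsBoundedBilinearMap.deriv, add_comm]

namespace RankOneFlow

theorem contDiff_functional (h : RankOneFlow A α β) (n : ℕ) : ContDiff ℝ ∞ (β n) :=
  contDiff_of_hasDerivAt_succ h.hasDerivAt_functional n

theorem contDiff_op (h : RankOneFlow A α β) : ContDiff ℝ ∞ A := by
  refine contDiff_infty_iff_deriv.2 ⟨fun y => (h.hasDerivAt_op y).differentiableAt, ?_⟩
  rw [show deriv A = fun y => -(β 0 y).smulRight (α y) from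
    funext fun y => (h.hasDerivAt_op y).deriv]
  refine ContDiff.neg ?_
  exact contDiff_clm_apply_complex
    (((ContinuousLinearMap.smulRightL ℂ E E).contDiff.restrict_scalars ℝ).comp
      (h.contDiff_functional 0)) h.contDiff_vector

theorem contDiff_pairing [CompleteSpace E] (h : RankOneFlow A α β) (n : ℕ) {c : ℝ → E} (hc : ContDiff ℝ ∞ c) :
    ContDiff ℝ ∞ fun y => β n y (Ring.inverse (1 - A y) (c y)) :=
  contDiff_clm_apply_complex (h.contDiff_functional n)
    (contDiff_clm_apply_complex (contDiff_inverse_one_sub h.contDiff_op h.isUnit_one_sub) hc)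

/-- `(w + D)⟨(1 - A)⁻¹ c, β_n⟩ = ⟨(1 - A)⁻¹ c, β_{n+1}⟩ + ⟨(1 - A)⁻¹ α, β_n⟩ (1 - ⟨(1 - A)⁻¹ c, β_0⟩)`
for a solution `c` of `(w + D) c = α`. -/
theorem hasDerivAt_pairing [CompleteSpace E] (h : RankOneFlow A α β) (n : ℕ) {c : ℝ → E} {w : ℂ}
    (hc : ∀ y, HasDerivAt c (α y - w • c y) y) (y : ℝ) :
    HasDerivAt (fun t => β n t (Ring.inverse (1 - A t) (c t)))
      (β (n + 1) y (Ring.inverse (1 - A y) (c y)) + β n y (Ring.inverse (1 - A y) (α y)) *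
        (1 - β 0 y (Ring.inverse (1 - A y) (c y))) - w * β n y (Ring.inverse (1 - A y) (c y))) y := by
  refine (hasDerivAt_clm_apply_complex (h.hasDerivAt_functional n y) (hasDerivAt_clm_apply_complex
    (hasDerivAt_inverse_one_sub (h.hasDerivAt_op y) (h.isUnit_one_sub y)) (hc y))).congr_deriv ?_
  simp only [mul_apply_eq_comp, neg_apply, ContinuousLinearMap.smulRight_apply,
    map_add, map_sub, map_neg, map_smul, smul_eq_mul]
  ring

/-- The functions `(w + D)^n (1 - ⟨(1 - A)⁻¹ c, β_0⟩)` are, up to a unipotent triangular matrix with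
entries independent of `w` and `c`, the functions `w^n - ⟨(1 - A)⁻¹ c, β_n⟩`. -/
theorem exists_triangular [CompleteSpace E] (h : RankOneFlow A α β) (n : ℕ) : ∃ κ : ℕ → ℝ → ℂ,
    (∀ j, ContDiff ℝ ∞ (κ j)) ∧ ∀ (w : ℂ) (c : ℝ → E), (∀ y, HasDerivAt c (α y - w • c y) y) →
      ∀ y, (shiftedDeriv w)^[n] (fun t => 1 - β 0 t (Ring.inverse (1 - A t) (c t))) y =
        w ^ n - β n y (Ring.inverse (1 - A y) (c y)) + ∑ j ∈ Finset.range n, κ j y *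
          (shiftedDeriv w)^[j] (fun t => 1 - β 0 t (Ring.inverse (1 - A t) (c t))) y := by
  induction n with
  | zero => exact ⟨fun _ _ => 0, fun _ => contDiff_const, fun w c hc y => by simp⟩
  | succ n ih =>
    obtain ⟨κ, hκ, ih⟩ := ih
    set p : ℝ → ℂ := fun y => β n y (Ring.inverse (1 - A y) (α y)) with hp
    have hps : ContDiff ℝ ∞ p := h.contDiff_pairing n h.contDiff_vector
    have hκ' : ∀ j, ContDiff ℝ ∞ (deriv (κ j)) := fun j => (contDiff_infty_iff_deriv.1 (hκ j)).2
    obtain ⟨κ₁, hκ0, hκs⟩ : ∃ κ₁ : ℕ → ℝ → ℂ, κ₁ 0 = (fun y => -p y) ∧ ∀ i, κ₁ (i + 1) = κ i :=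
      ⟨fun j => Nat.casesOn j (fun y => -p y) κ, rfl, fun _ => rfl⟩
    -- `w + D` maps `κ_j φ_j` to `κ_j' φ_j + κ_j φ_{j+1}`, where `φ_j = (w + D)^j φ`, and the
    -- pairing contributes `-p φ_0`
    refine ⟨fun j y => κ₁ j y + if j < n then deriv (κ j) y else 0,
      fun j => ContDiff.add ?_ ?_, fun w c hc y => ?_⟩
    · cases j with
      | zero => exact hκ0 ▸ hps.neg
      | succ i => exact hκs i ▸ hκ i
    · split_ifs with hj
      · exact hκ' j
      · exact contDiff_const
    set φ : ℝ → ℂ := fun t => 1 - β 0 t (Ring.inverse (1 - A t) (c t)) with hφ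
    have hφs : ContDiff ℝ ∞ φ :=
      contDiff_const.sub (h.contDiff_pairing 0 (contDiff_of_hasDerivAt_sub_smul h.contDiff_vector hc))
    have hiter : ∀ j, ContDiff ℝ ∞ ((shiftedDeriv w)^[j] φ) := by
      intro j
      induction j with
      | zero => exact hφs
      | succ j ihj =>
        rw [Function.iterate_succ_apply']
        exact (contDiff_const.mul ihj).add (contDiff_infty_iff_deriv.1 ihj).2
    have hd : ∀ j, HasDerivAt ((shiftedDeriv w)^[j] φ)
        ((shiftedDeriv w)^[j + 1] φ y - w * (shiftedDeriv w)^[j] φ y) y := by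
      intro j
      have h1 := ((hiter j).differentiable (by simp) y).hasDerivAt
      refine h1.congr_deriv ?_
      rw [Function.iterate_succ_apply', shiftedDeriv]
      ring
    have hdκ : ∀ j, HasDerivAt (κ j) (deriv (κ j) y) y := fun j =>
      ((hκ j).differentiable (by simp) y).hasDerivAt
    have hsum : HasDerivAt (fun t => ∑ j ∈ Finset.range n, κ j t * (shiftedDeriv w)^[j] φ t)
        (∑ j ∈ Finset.range n, (deriv (κ j) y * (shiftedDeriv w)^[j] φ y + κ j y *
          ((shiftedDeriv w)^[j + 1] φ y - w * (shiftedDeriv w)^[j] φ y))) y :=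
      HasDerivAt.fun_sum fun j _ => (hdκ j).mul (hd j)
    have e : (shiftedDeriv w)^[n] φ = fun t => w ^ n - β n t (Ring.inverse (1 - A t) (c t)) +
        ∑ j ∈ Finset.range n, κ j t * (shiftedDeriv w)^[j] φ t := funext (ih w c hc)
    have h2 := ((h.hasDerivAt_pairing n hc y).const_sub (w ^ n)).add hsum
    have h3 : deriv ((shiftedDeriv w)^[n] φ) y = _ := (congrArg (fun g => deriv g y) e).trans h2.deriv
    have h4 : (shiftedDeriv w)^[n + 1] φ y =
        w * (shiftedDeriv w)^[n] φ y + deriv ((shiftedDeriv w)^[n] φ) y := by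
      rw [Function.iterate_succ_apply']; rfl
    rw [h4, h3, ih w c hc y]
    have h5 : ∑ j ∈ Finset.range (n + 1), (κ₁ j y + if j < n then deriv (κ j) y else 0) *
        (shiftedDeriv w)^[j] φ y =
        -p y * φ y + (∑ j ∈ Finset.range n, κ j y * (shiftedDeriv w)^[j + 1] φ y +
          ∑ j ∈ Finset.range n, deriv (κ j) y * (shiftedDeriv w)^[j] φ y) := by
      have a1 : ∑ j ∈ Finset.range (n + 1), κ₁ j y * (shiftedDeriv w)^[j] φ y =
          ∑ j ∈ Finset.range n, κ j y * (shiftedDeriv w)^[j + 1] φ y + -p y * φ y := by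
        rw [Finset.sum_range_succ', hκ0]
        simp only [hκs, Function.iterate_zero, id]
      have a2 : ∑ j ∈ Finset.range (n + 1), (if j < n then deriv (κ j) y else 0) *
          (shiftedDeriv w)^[j] φ y = ∑ j ∈ Finset.range n, deriv (κ j) y *
            (shiftedDeriv w)^[j] φ y := by
        rw [Finset.sum_range_succ, if_neg (lt_irrefl n), zero_mul, add_zero]
        exact Finset.sum_congr rfl fun j hj => by rw [if_pos (Finset.mem_range.1 hj)]
      simp only [add_mul, Finset.sum_add_distrib]
      rw [a1, a2]
      ring
    rw [h5]
    have h6 : ∑ j ∈ Finset.range n, (deriv (κ j) y * (shiftedDeriv w)^[j] φ y +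
        κ j y * ((shiftedDeriv w)^[j + 1] φ y - w * (shiftedDeriv w)^[j] φ y)) =
        ∑ j ∈ Finset.range n, deriv (κ j) y * (shiftedDeriv w)^[j] φ y +
        ∑ j ∈ Finset.range n, κ j y * (shiftedDeriv w)^[j + 1] φ y -
        w * ∑ j ∈ Finset.range n, κ j y * (shiftedDeriv w)^[j] φ y := by
      rw [Finset.mul_sum, ← Finset.sum_add_distrib, ← Finset.sum_sub_distrib]
      exact Finset.sum_congr rfl fun j _ => by ring
    rw [h6]
    simp only [hφ, hp]
    ring

end RankOneFlow

end Resolvent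

/-! ### The function `f` and the hierarchy of its derivatives -/

theorem curve_sum {κ M : ℝ} (hκ : κ < M) {ι : Type*} (s : Finset ι) (c : ι → ℂ) (g : ι → ℝ → ℂ)
    (hg : ∀ i, ExpGrowth κ (g i)) (hc : ∀ i, Continuous (g i)) (b y : ℝ) :
    curve b M (fun u => ∑ i ∈ s, c i * g i u) y = ∑ i ∈ s, c i • curve b M (g i) y := by
  classical
  have hgs : ∀ s : Finset ι, Continuous fun u => ∑ i ∈ s, c i * g i u := fun s =>
    continuous_finsetSum _ fun i _ => continuous_const.mul (hc i)
  induction s using Finset.induction_on with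
  | empty =>
    rw [Finset.sum_empty, Lp.eq_zero_iff_ae_eq_zero]
    refine (coeFn_curve (expGrowth_sum ∅ c g hg) (hgs ∅) hκ b y).trans
      (Eventually.of_forall fun u => by simp)
  | insert i s hi ih =>
    rw [Finset.sum_insert hi, ← ih]
    refine Lp.ext ?_
    filter_upwards [coeFn_curve (expGrowth_sum (insert i s) c g hg) (hgs _) hκ b y,
      Lp.coeFn_add (c i • curve b M (g i) y) (curve b M (fun u => ∑ i ∈ s, c i * g i u) y),
      Lp.coeFn_smul (c i) (curve b M (g i) y), coeFn_curve (hg i) (hc i) hκ b y,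
      coeFn_curve (expGrowth_sum s c g hg) (hgs s) hκ b y] with u e1 e2 e3 e4 e5
    rw [e1, e2, Pi.add_apply, e3, Pi.smul_apply, e4, e5, Finset.sum_insert hi, smul_eq_mul]
    ring

/-- The functional `h ↦ ⟨h, Ai^{(n)}⟩` over `(y, ∞)`, on the weighted space. -/
def derivFunctional (M : ℝ) (n : ℕ) (y : ℝ) : Lp ℂ 2 (halfLine 0) →L[ℂ] ℂ :=
  pair 0 (curve 0 (-M) (airyDeriv n) y)

theorem rankOneFlow_airy (M : ℝ) :
    RankOneFlow (airyWeightedOp 0 M) (curve 0 M airy) (derivFunctional M) where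
  hasDerivAt_op y := by
    refine (hasDerivAt_airyWeightedOp 0 M y).congr_deriv ?_
    rw [airyRankOne, derivFunctional, airyDeriv_zero]
  hasDerivAt_functional n y :=
    ((pair 0).restrictScalars ℝ).hasFDerivAt.comp_hasDerivAt y
      (hasDerivAt_curve_airyDeriv 0 (-M) n y)
  contDiff_vector := by
    rw [← airyDeriv_zero]
    exact contDiff_of_hasDerivAt_succ (hasDerivAt_curve_airyDeriv 0 M) 0
  isUnit_one_sub y := isUnit_one_sub_airyWeightedOp y M

/-- `⟨(1 - A_x)⁻¹ s, Ai^{(n)}⟩` for the function `s` which corresponds to `h` in the weighted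
space. -/
def moment (M x : ℝ) (n : ℕ) (h : Lp ℂ 2 (halfLine 0)) : ℂ :=
  derivFunctional M n x (weightedResolvent M x h)

theorem pairing_tFun {x κ M : ℝ} {s : ℝ → ℂ} (hs : ExpGrowth κ s) (hsc : Continuous s) (hκ : κ < M)
    {n N : ℕ} (w : Fin n → ℂ) (hN : n < N) : pairing x s (tFun w) =
      ∑ k ∈ Finset.range N, (nodePoly w).coeff k * moment M x k (curve 0 M s x) := by
  rw [pairing_eq hs hsc hκ (fun κ' => expGrowth_tFun κ' w) (continuous_tFun w),
    show tFun w = fun v => ∑ k ∈ Finset.range N, (nodePoly w).coeff k * airyDeriv k v from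
      funext (tFun_eq w hN),
    curve_sum (sub_one_lt (-M)) _ _ _ (fun k => expGrowth_airyDeriv _ k) continuous_airyDeriv]
  simp only [map_sum, map_smul, sum_apply, smul_apply, smul_eq_mul, moment, derivFunctional]

theorem continuous_cFun (w : ℂ) : Continuous (cFun w) := cFun_eq_sFun w ▸ continuous_sFun _

theorem f_eq {w : ℂ} {M : ℝ} (hM : 1 + 2 * ‖w‖ < M) (y : ℝ) :
    f y w = 1 - derivFunctional M 0 y
      (Ring.inverse (1 - airyWeightedOp 0 M y) (curve 0 M (cFun w) y)) := by
  rw [f, pairing_eq (expGrowth_cFun le_rfl) (continuous_cFun w) hM expGrowth_airy continuous_airy,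
    derivFunctional, airyDeriv_zero]
  rfl

theorem hasDerivAt_curve_cFun {w : ℂ} {M : ℝ} (hM : 1 + 2 * ‖w‖ < M) (y : ℝ) :
    HasDerivAt (curve 0 M (cFun w)) (curve 0 M airy y - w • curve 0 M (cFun w) y) y := by
  set K := 1 + 2 * ‖w‖
  have hg : ExpGrowth K (cFun w) := expGrowth_cFun le_rfl
  have hg' : ExpGrowth K fun u => airy u - w * cFun w u := by
    simpa only [neg_mul, ← sub_eq_add_neg] using (expGrowth_airy K).add (hg.const_mul (-w))
  have hg'' : ExpGrowth K fun u => airyDeriv 1 u - w * (airy u - w * cFun w u) := by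
    simpa only [neg_mul, ← sub_eq_add_neg] using (expGrowth_airyDeriv K 1).add (hg'.const_mul (-w))
  refine (hasDerivAt_curve hM hg hg' hg'' (hasDerivAt_cFun w) (fun u => ?_) 0 y).congr_deriv ?_
  · have h := hasDerivAt_airyDeriv 0 u
    rw [airyDeriv_zero] at h
    exact h.sub ((hasDerivAt_cFun w u).const_mul w)
  · refine Lp.ext ?_
    have hc' : Continuous fun u => airy u - w * cFun w u :=
      continuous_airy.sub (continuous_const.mul (continuous_cFun w))
    filter_upwards [coeFn_curve hg' hc' hM 0 y,
      Lp.coeFn_sub (curve 0 M airy y) (w • curve 0 M (cFun w) y),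
      Lp.coeFn_smul w (curve 0 M (cFun w) y), coeFn_curve (expGrowth_airy K) continuous_airy hM 0 y,
      coeFn_curve hg (continuous_cFun w) hM 0 y] with u e1 e2 e3 e4 e5
    rw [e1, e2, Pi.sub_apply, e3, Pi.smul_apply, e4, e5, smul_eq_mul]
    ring

theorem contDiff_f (w : ℂ) : ContDiff ℝ ∞ fun y => f y w := by
  have hM : 1 + 2 * ‖w‖ < 2 + 2 * ‖w‖ := by linarith
  have h := rankOneFlow_airy (2 + 2 * ‖w‖)
  rw [funext (f_eq hM)]
  exact contDiff_const.sub (h.contDiff_pairing 0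
    (contDiff_of_hasDerivAt_sub_smul h.contDiff_vector (hasDerivAt_curve_cFun hM)))

/-- Up to a unipotent triangular matrix with entries independent of `w`, the functions
`(w + D)^n f(·, w)` are the functions `w^n - ⟨(1 - A_x)⁻¹ C_w, Ai^{(n)}⟩`. -/
theorem exists_shiftedDeriv_f (M x : ℝ) : ∃ κ : ℕ → ℕ → ℂ, ∀ (w : ℂ), 1 + 2 * ‖w‖ < M → ∀ n,
    (shiftedDeriv w)^[n] (fun y => f y w) x = w ^ n - moment M x n (curve 0 M (cFun w) x) +
      ∑ j ∈ Finset.range n, κ n j * (shiftedDeriv w)^[j] (fun y => f y w) x := by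
  choose κ _ h using (rankOneFlow_airy M).exists_triangular
  refine ⟨fun n j => κ n j x, fun w hw n => ?_⟩
  rw [funext (f_eq hw)]
  exact h n w _ (hasDerivAt_curve_cFun hw) x

/-! ### Partial fractions -/

/-- The coefficient of `1/(w_l - z)` in the partial fraction expansion of `∏_j 1/(w_j - z)`. -/
def residue {m : ℕ} (w : Fin m → ℂ) (l : Fin m) : ℂ := ∏ j ∈ Finset.univ.erase l, (w j - w l)⁻¹

/-- Partial fractions, by Lagrange interpolation of the constant `1`. -/
theorem prod_inv_sub_eq_sum {m : ℕ} {w : Fin (m + 1) → ℂ} (hw : Function.Injective w) {z : ℂ}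
    (hz : ∀ j, w j - z ≠ 0) : ∏ j, 1 / (w j - z) = ∑ l, residue w l * (1 / (w l - z)) := by
  have h := congrArg (Polynomial.eval z)
    (Lagrange.sum_basis (s := Finset.univ) (v := w) hw.injOn Finset.univ_nonempty)
  simp only [Polynomial.eval_finsetSum, Lagrange.basis, Lagrange.basisDivisor, Polynomial.eval_prod,
    Polynomial.eval_mul, Polynomial.eval_C, Polynomial.eval_sub, Polynomial.eval_X,
    Polynomial.eval_one] at h
  refine (mul_one (∏ j, 1 / (w j - z))).symm.trans ((congrArg _ h.symm).trans ?_)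
  rw [Finset.mul_sum]
  refine Finset.sum_congr rfl fun l _ => ?_
  rw [← Finset.mul_prod_erase _ _ (Finset.mem_univ l), mul_assoc, ← Finset.prod_mul_distrib, mul_comm,
    residue]
  congr 1
  refine Finset.prod_congr rfl fun j hj => ?_
  have h1 := hz j
  have h2 : w l - w j ≠ 0 := sub_ne_zero.2 fun e => (Finset.mem_erase.1 hj).1 (hw e).symm
  have h3 : w j - w l ≠ 0 := sub_ne_zero.2 fun e => (Finset.mem_erase.1 hj).1 (hw e)
  field_simp
  ring

/-- The highest coefficient of the Lagrange interpolation formula. -/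
theorem sum_residue_mul_eval {m : ℕ} {w : Fin (m + 1) → ℂ} (hw : Function.Injective w)
    {P : Polynomial ℂ} (hP : P.natDegree < m + 1) :
    ∑ l, residue w l * P.eval (w l) = (-1) ^ m * P.coeff m := by
  have hd : P.degree < (Finset.univ : Finset (Fin (m + 1))).card := by
    rw [Finset.card_univ, Fintype.card_fin]
    exact (Polynomial.degree_le_natDegree).trans_lt (by exact_mod_cast hP)
  have h := Lagrange.coeff_eq_sum (s := Finset.univ) (v := w) hw.injOn hd
  rw [Finset.card_univ, Fintype.card_fin, Nat.add_sub_cancel] at h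
  rw [h, Finset.mul_sum]
  refine Finset.sum_congr rfl fun l _ => ?_
  have e : residue w l = (-1) ^ m * (∏ j ∈ Finset.univ.erase l, (w l - w j))⁻¹ := by
    have hc : (Finset.univ.erase l).card = m := by simp
    have h1 : ∏ j ∈ Finset.univ.erase l, (-1 : ℂ) = (-1) ^ m := by rw [Finset.prod_const, hc]
    rw [residue, ← Finset.prod_inv_distrib, ← h1, ← Finset.prod_mul_distrib]
    refine Finset.prod_congr rfl fun j _ => ?_
    rw [← neg_sub, inv_neg, neg_one_mul]
  rw [e]
  ring

theorem RayBound.mono {q κ κ' B : ℝ} {φ : ℂ → ℂ} (hB : 0 ≤ B) (h : RayBound q κ B φ)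
    (hκ : κ ≤ κ') : RayBound q κ' B φ where
  meas := h.meas
  bound e he r hr := (h.bound e he r hr).trans (by gcongr)

theorem airyWedge_sum {ι : Type*} (s : Finset ι) (c : ι → ℂ) (φ : ι → ℂ → ℂ) {q : ℝ}
    (hφ : ∀ i, ∃ κ B, 0 ≤ B ∧ RayBound q κ B (φ i)) (u : ℂ) :
    airyWedge q (fun a => ∑ i ∈ s, c i * φ i a) u = ∑ i ∈ s, c i * airyWedge q (φ i) u := by
  classical
  have hc : ∀ i, ∃ κ B, 0 ≤ B ∧ RayBound q κ B (fun a => c i * φ i a) := fun i => by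
    obtain ⟨κ, B, hB, h⟩ := hφ i
    exact ⟨_, _, by positivity, (RayBound.const q (c i)).mul (norm_nonneg _) h⟩
  have key : (∃ κ B, 0 ≤ B ∧ RayBound q κ B (fun a => ∑ i ∈ s, c i * φ i a)) ∧
      airyWedge q (fun a => ∑ i ∈ s, c i * φ i a) u = ∑ i ∈ s, c i * airyWedge q (φ i) u := by
    induction s using Finset.induction_on with
    | empty =>
      refine ⟨⟨0, ‖(0 : ℂ)‖, norm_nonneg _, by simpa using RayBound.const q 0⟩, ?_⟩
      simpa using airyWedge_const_mul q 0 (fun _ => 0) u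
    | insert i s hi ih =>
      obtain ⟨⟨κ, B, hB, h⟩, e⟩ := ih
      obtain ⟨κ', B', hB', h'⟩ := hc i
      simp only [Finset.sum_insert hi]
      refine ⟨⟨max κ' κ, B' + B, by positivity,
        (h'.mono hB' (le_max_left _ _)).add (h.mono hB (le_max_right _ _))⟩, ?_⟩
      rw [airyWedge_add hB' hB h' h, airyWedge_const_mul, e]
  exact key.2

/-- For distinct poles `s^{(m)}` is a linear combination of functions `C_w`. -/
theorem sFun_eq_sum_cFun {m : ℕ} {w : Fin (m + 1) → ℂ} (hw : Function.Injective w) (u : ℝ) :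
    sFun w u = ∑ l, residue w l * cFun (w l) u := by
  set K := 1 + 2 * ∑ j, ‖w j‖
  have hK : ∀ j, 1 + 2 * ‖w j‖ ≤ K := one_add_two_mul_norm_le w
  have hφ : ∀ l, ∃ κ B, 0 ≤ B ∧ RayBound (-K) κ B (fun a => 1 / (w l + Complex.I * a)) := fun l => by
    have h := rayBound_poleWeight (w := ![w l]) (K := K) (by simpa using hK l)
    rwa [show poleWeight ![w l] = fun a => 1 / (w l + Complex.I * a) from
      funext (poleWeight_one (w l))] at h
  simp only [sFun_eq hK, fun l => cFun_eq (hK l) u]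
  rw [← airyWedge_sum Finset.univ _ _ hφ]
  refine airyWedge_congr (fun e he r _ => ?_) u
  have hz : ∀ j, w j - -(Complex.I * (((-K : ℝ) : ℂ) * Complex.I + r * e)) ≠ 0 := fun j => by
    rw [sub_neg_eq_add, ← norm_pos_iff]
    exact lt_of_lt_of_le (by norm_num) (half_le_norm_add (hK j) he)
  simpa only [sub_neg_eq_add, poleWeight] using prod_inv_sub_eq_sum hw hz

/-! ### The determinantal formula for distinct parameters -/

theorem sum_fin_castLE {k m : ℕ} (h : m ≤ k) (F : Fin m → ℂ) (G : Fin k → ℂ) :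
    ∑ l : Fin k, (if hl : (l : ℕ) < m then F ⟨l, hl⟩ else 0) * G l =
      ∑ l : Fin m, F l * G (Fin.castLE h l) := by
  symm
  refine Fintype.sum_of_injective (Fin.castLE h) (Fin.castLE_injective h) _ _ (fun l hl => ?_)
    fun l => ?_
  · rw [dif_neg, zero_mul]
    intro hlm
    exact hl ⟨⟨l, hlm⟩, rfl⟩
  · simp

/-- The coefficients of the partial fraction expansions of `∏_{j ≤ m} 1/(w_j - z)`. This matrix is
lower triangular. -/
def residueMatrix {k : ℕ} (w : Fin k → ℂ) : Matrix (Fin k) (Fin k) ℂ := Matrix.of fun m l =>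
  if hl : (l : ℕ) < m + 1 then residue (fun j : Fin (m + 1) => w (Fin.castLE m.isLt j)) ⟨l, hl⟩ else 0

/-- The coefficients of the polynomials `∏_{j < n} (w_j - X)`. This matrix is upper triangular. -/
def nodeMatrix {k : ℕ} (w : Fin k → ℂ) : Matrix (Fin k) (Fin k) ℂ := Matrix.of fun i n =>
  (nodePoly fun j : Fin n => w (Fin.castLE n.isLt.le j)).coeff i

theorem coeff_nodePoly_self {n : ℕ} (w : Fin n → ℂ) : (nodePoly w).coeff n = (-1) ^ n := by
  have h : ∀ s : Finset (Fin n), (∏ j ∈ s, (Polynomial.C (w j) - Polynomial.X)).coeff s.card =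
      (-1) ^ s.card := by
    intro s
    have := Polynomial.coeff_prod_of_natDegree_le (s := s)
      (f := fun j => Polynomial.C (w j) - Polynomial.X) (n := 1) fun j _ =>
        (Polynomial.natDegree_sub_le _ _).trans (by simp)
    rw [mul_one] at this
    rw [this]
    simp
  simpa [nodePoly] using h Finset.univ

/-- The residues of the rational function `∏_{j < n} (w_j - z) / ∏_{j ≤ m} (w_j - z)` at the points
`w_l` add up to `δ_{mn}`. -/
theorem residueMatrix_mul_vandermonde_mul_nodeMatrix {k : ℕ} {w : Fin k → ℂ}
    (hw : Function.Injective w) :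
    residueMatrix w * (Matrix.vandermonde w * nodeMatrix w) = 1 := by
  have hVQ : ∀ l n : Fin k, (Matrix.vandermonde w * nodeMatrix w) l n =
      (nodePoly fun j : Fin n => w (Fin.castLE n.isLt.le j)).eval (w l) := by
    intro l n
    rw [Matrix.mul_apply, Polynomial.eval_eq_sum_range'
      ((natDegree_nodePoly_le _).trans_lt n.isLt), Finset.sum_range]
    simp [nodeMatrix, Matrix.vandermonde_apply, mul_comm]
  ext m n
  rw [Matrix.mul_apply]
  simp only [hVQ, residueMatrix, Matrix.of_apply]
  rw [sum_fin_castLE m.isLt (residue fun j : Fin (m + 1) => w (Fin.castLE m.isLt j))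
    fun l => (nodePoly fun j : Fin n => w (Fin.castLE n.isLt.le j)).eval (w l)]
  rcases lt_or_ge (m : ℕ) n with hmn | hmn
  · -- the nodes `w_l`, `l ≤ m`, are roots of the polynomial
    rw [Matrix.one_apply_ne (fun h => by simp [h] at hmn)]
    refine Finset.sum_eq_zero fun l _ => ?_
    rw [eval_nodePoly, Finset.prod_eq_zero (Finset.mem_univ (⟨l, by omega⟩ : Fin n)) (by
      simp [Fin.castLE]), mul_zero]
  · have hw' : Function.Injective fun j : Fin (m + 1) => w (Fin.castLE m.isLt j) :=
      hw.comp (Fin.castLE_injective _)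
    rw [sum_residue_mul_eval hw' ((natDegree_nodePoly_le _).trans_lt (by omega))]
    rcases eq_or_lt_of_le hmn with h | h
    · have : m = n := Fin.ext h.symm
      subst this
      rw [coeff_nodePoly_self, Matrix.one_apply_eq, ← mul_pow]
      simp
    · rw [Polynomial.coeff_eq_zero_of_natDegree_lt ((natDegree_nodePoly_le _).trans_lt h), mul_zero,
        Matrix.one_apply_ne (fun e => by simp [e] at h)]

theorem Fk_eq_detFormula (x : ℝ) {k : ℕ} {w : Fin k → ℂ} (hw : Function.Injective w) :
    Fk x w = detFormula x w := by
  set K := 1 + 2 * ∑ j, ‖w j‖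
  have hK : ∀ j, 1 + 2 * ‖w j‖ ≤ K := one_add_two_mul_norm_le w
  set M := K + 1 with hM
  have hKM : K < M := lt_add_one K
  obtain ⟨κ, hκ⟩ := exists_shiftedDeriv_f M x
  set N : Matrix (Fin k) (Fin k) ℂ := Matrix.of fun m n : Fin k =>
    (shiftedDeriv (w m))^[(n : ℕ)] (fun y => f y (w m)) x with hN
  set G : Matrix (Fin k) (Fin k) ℂ := Matrix.of fun m n : Fin k =>
    moment M x n (curve 0 M (cFun (w m)) x) with hG
  set U : Matrix (Fin k) (Fin k) ℂ := Matrix.of fun j n : Fin k =>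
    if (j : ℕ) < n then κ n j else 0 with hU
  set S : Matrix (Fin k) (Fin k) ℂ := Matrix.of fun m n : Fin k =>
    pairing x (sFun fun j : Fin (m + 1) => w (Fin.castLE m.isLt j))
      (tFun fun j : Fin n => w (Fin.castLE n.isLt.le j)) with hS
  -- the hierarchy of derivatives, with `U` strictly upper triangular
  have e1 : N = Matrix.vandermonde w - G + N * U := by
    ext m n
    have h := hκ (w m) ((hK m).trans_lt hKM) n
    have hs : ∑ j ∈ Finset.range n, κ n j * (shiftedDeriv (w m))^[j] (fun y => f y (w m)) x =
        (N * U) m n := by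
      rw [Matrix.mul_apply, Finset.sum_range]
      have := sum_fin_castLE n.isLt.le (fun j => κ n j)
        (fun j : Fin k => (shiftedDeriv (w m))^[(j : ℕ)] (fun y => f y (w m)) x)
      simp only [Fin.val_castLE] at this
      rw [← this]
      refine Finset.sum_congr rfl fun j _ => ?_
      simp [hN, hU, mul_comm]
    rw [hs] at h
    rw [Matrix.add_apply, Matrix.sub_apply, Matrix.vandermonde_apply]
    exact h
  have e2 : N * (1 - U) = Matrix.vandermonde w - G := by
    rw [mul_sub, mul_one]
    nth_rewrite 1 [e1]
    exact add_sub_cancel_right _ _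
  have hdetU : (1 - U).det = 1 := by
    rw [Matrix.det_of_isUpperTriangular]
    · simp [hU]
    · intro i j hij
      have hij' : j < i := hij
      rw [Matrix.sub_apply, Matrix.one_apply_ne hij'.ne']
      simp [hU, hij'.le]
  -- expand `s^{(m)}` in partial fractions and `t^{(n)}` in derivatives of `Ai`
  have e3 : S = residueMatrix w * (G * nodeMatrix w) := by
    ext m n
    have hw' : Function.Injective fun j : Fin (m + 1) => w (Fin.castLE m.isLt j) :=
      hw.comp (Fin.castLE_injective _)
    rw [hS, Matrix.of_apply, pairing_tFun (expGrowth_sFun (K := K) fun j => hK _) (continuous_sFun _)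
      hKM _ n.isLt, show (sFun fun j : Fin (m + 1) => w (Fin.castLE m.isLt j)) = _ from
        funext (sFun_eq_sum_cFun hw'), curve_sum hKM _ _ _ (fun l => expGrowth_cFun (hK _))
          fun l => continuous_cFun _, Matrix.mul_apply]
    simp only [residueMatrix, Matrix.of_apply]
    rw [sum_fin_castLE m.isLt (residue fun j : Fin (m + 1) => w (Fin.castLE m.isLt j))
      fun l => (G * nodeMatrix w) l n]
    simp only [moment, map_sum, map_smul, smul_eq_mul, Finset.mul_sum, Matrix.mul_apply]
    rw [Finset.sum_comm]
    refine Finset.sum_congr rfl fun l _ => ?_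
    rw [Finset.sum_range]
    refine Finset.sum_congr rfl fun i _ => ?_
    simp only [hG, nodeMatrix, Matrix.of_apply, moment]
    ring
  have e4 := residueMatrix_mul_vandermonde_mul_nodeMatrix hw
  have e5 : 1 - S = residueMatrix w * ((N * (1 - U)) * nodeMatrix w) := by
    rw [e2, sub_mul, mul_sub, e4, e3]
  have hV : (Matrix.vandermonde w).det ≠ 0 := Matrix.det_vandermonde_ne_zero_iff.2 hw
  have e6 : (1 - S).det = N.det / (Matrix.vandermonde w).det := by
    have h1 := congrArg Matrix.det e4
    rw [Matrix.det_mul, Matrix.det_mul, Matrix.det_one] at h1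
    rw [e5, Matrix.det_mul, Matrix.det_mul, Matrix.det_mul, hdetU, eq_div_iff hV]
    linear_combination N.det * h1
  have e7 : (Matrix.of fun m n : Fin k => (if m = n then 1 else 0) - S m n) = 1 - S := by
    ext m n
    simp [Matrix.one_apply]
  rw [Fk, detFormula, ← Matrix.det_vandermonde, ← e6, ← e7]
  rfl

/-! ### Continuity and symmetry -/

theorem sum_norm_bound {k : ℕ} {w₀ w : Fin k → ℂ} (hw : w ∈ Metric.closedBall w₀ 1) (j : Fin k) :
    1 + 2 * ‖w j‖ ≤ 3 + 2 * ‖w₀‖ := by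
  have h1 : ‖w j‖ ≤ ‖w‖ := norm_le_pi_norm w j
  have h2 : ‖w‖ ≤ ‖w - w₀‖ + ‖w₀‖ := by simpa using norm_add_le (w - w₀) w₀
  rw [Metric.mem_closedBall, dist_eq_norm] at hw
  linarith

/-- The curve of `s^{(m)}` depends continuously on the poles. -/
theorem continuousOn_curve_sFun (M x : ℝ) {K : ℝ} (hK : K < M) (m : ℕ) :
    ContinuousOn (fun w : Fin m → ℂ => curve 0 M (sFun w) x) {w | ∀ j, 1 + 2 * ‖w j‖ ≤ K} := by
  obtain ⟨C, hC, h⟩ := sFun_sub_le (m := m) (K := K) x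
  have hδ := sub_pos.2 hK
  set B := ‖(memLp_exp_mul (x := 0) hδ).toLp‖
  have hlip : ∀ w ∈ {w : Fin m → ℂ | ∀ j, 1 + 2 * ‖w j‖ ≤ K}, ∀ w' ∈ {w : Fin m → ℂ |
      ∀ j, 1 + 2 * ‖w j‖ ≤ K}, ‖curve 0 M (sFun w) x - curve 0 M (sFun w') x‖ ≤
      C * Real.exp (K * x) * B * ‖w - w'‖ := by
    intro w hw w' hw'
    have hae : (curve 0 M (sFun w) x - curve 0 M (sFun w') x : Lp ℂ 2 (halfLine 0))
        =ᵐ[halfLine 0] fun u => (Real.exp (-(M * u)) : ℂ) * (sFun w (x + u) - sFun w' (x + u)) := by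
      filter_upwards [Lp.coeFn_sub (curve 0 M (sFun w) x) (curve 0 M (sFun w') x),
        coeFn_curve (expGrowth_sFun hw) (continuous_sFun w) hK 0 x,
        coeFn_curve (expGrowth_sFun hw') (continuous_sFun w') hK 0 x] with u e1 e2 e3
      rw [e1, Pi.sub_apply, e2, e3, mul_sub]
    refine (norm_le_of_ae_le hδ hae (c := C * Real.exp (K * x) * ‖w - w'‖) fun u hu => ?_).trans
      (le_of_eq (by ring))
    rw [norm_mul, Complex.norm_real, Real.norm_of_nonneg (Real.exp_pos _).le]
    calc _ ≤ Real.exp (-(M * u)) * (C * ‖w - w'‖ * Real.exp (K * (x + u))) := by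
          gcongr
          exact h w w' hw hw' _ (by linarith)
      _ = C * ‖w - w'‖ * (Real.exp (-(M * u)) * Real.exp (K * (x + u))) := by ring
      _ = C * ‖w - w'‖ * (Real.exp (K * x) * Real.exp (-((M - K) * u))) := by
          rw [← Real.exp_add, ← Real.exp_add]; congr 2; ring
      _ = _ := by ring
  refine (LipschitzOnWith.of_dist_le_mul (K := ⟨C * Real.exp (K * x) * B, by positivity⟩)
    fun w hw w' hw' => ?_).continuousOn
  rw [dist_eq_norm, dist_eq_norm]
  exact hlip w hw w' hw'

theorem continuous_Fk (x : ℝ) (k : ℕ) : Continuous fun w : Fin k → ℂ => Fk x w := by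
  refine continuous_iff_continuousAt.2 fun w₀ => ?_
  set K := 3 + 2 * ‖w₀‖
  have hnhds : Metric.closedBall w₀ 1 ∈ 𝓝 w₀ := Metric.closedBall_mem_nhds w₀ one_pos
  refine ContinuousOn.continuousAt ?_ hnhds
  have hentry : ∀ m n : Fin k, ContinuousOn (fun w : Fin k → ℂ =>
      pairing x (sFun fun j : Fin (m + 1) => w (Fin.castLE m.isLt j))
        (tFun fun j : Fin n => w (Fin.castLE n.isLt.le j))) (Metric.closedBall w₀ 1) := by
    intro m n
    have hc : ContinuousOn (fun w : Fin k → ℂ => ∑ i ∈ Finset.range k,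
        (nodePoly fun j : Fin n => w (Fin.castLE n.isLt.le j)).coeff i * moment (K + 1) x i
          (curve 0 (K + 1) (sFun fun j : Fin (m + 1) => w (Fin.castLE m.isLt j)) x))
        (Metric.closedBall w₀ 1) := by
      refine continuousOn_finsetSum _ fun i _ => ContinuousOn.mul ?_ ?_
      · exact ((continuous_coeff_nodePoly n i).comp (by fun_prop)).continuousOn
      · refine (derivFunctional (K + 1) i x).continuous.comp_continuousOn
          ((weightedResolvent (K + 1) x).continuous.comp_continuousOn ?_)
        refine (continuousOn_curve_sFun (K + 1) x (lt_add_one K) (m + 1)).comp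
          (f := fun (w : Fin k → ℂ) (j : Fin (m + 1)) => w (Fin.castLE m.isLt j)) ?_ ?_
        · exact Continuous.continuousOn (by fun_prop)
        · exact fun w hw j => sum_norm_bound hw _
    refine hc.congr fun w hw => ?_
    exact pairing_tFun (expGrowth_sFun (K := K) fun j => sum_norm_bound hw _) (continuous_sFun _)
      (lt_add_one K) _ n.isLt
  simp only [Fk, Matrix.det_apply]
  refine continuousOn_const.mul (continuousOn_finsetSum _ fun σ _ => ContinuousOn.const_smul ?_ _)
  refine continuousOn_finsetProd _ fun i _ => ?_
  exact continuousOn_const.sub (hentry _ _)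

/-- A permutation of the parameters multiplies both determinants by its sign. -/
theorem detFormula_comp_perm (x : ℝ) {k : ℕ} {w : Fin k → ℂ} (σ : Equiv.Perm (Fin k)) :
    detFormula x (w ∘ σ) = detFormula x w := by
  rw [detFormula, detFormula, ← Matrix.det_vandermonde, ← Matrix.det_vandermonde]
  have h1 : Matrix.vandermonde (w ∘ σ) = (Matrix.vandermonde w).submatrix σ id := by
    ext i j; simp [Matrix.vandermonde_apply]
  rw [h1, Matrix.det_permute]
  have h2 : (Matrix.of fun m n : Fin k =>
      (shiftedDeriv ((w ∘ σ) m))^[(n : ℕ)] (fun y => f y ((w ∘ σ) m)) x) =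
      (Matrix.of fun m n : Fin k =>
        (shiftedDeriv (w m))^[(n : ℕ)] (fun y => f y (w m)) x).submatrix σ id := rfl
  rw [h2, Matrix.det_permute, mul_div_mul_left]
  exact_mod_cast (Equiv.Perm.sign σ).ne_zero

/-- The tuple `w + t (0, 1, …, k - 1)` has distinct entries for all small `t ≠ 0`. -/
theorem dense_injective (k : ℕ) : Dense {w : Fin k → ℂ | Function.Injective w} := by
  intro w
  have ht : Tendsto (fun (t : ℂ) (j : Fin k) => w j + t * (j : ℕ)) (𝓝[≠] 0) (𝓝 w) := by
    have hc : Continuous fun (t : ℂ) (j : Fin k) => w j + t * (j : ℕ) := by fun_prop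
    have := hc.tendsto 0
    simp only [zero_mul, add_zero] at this
    exact this.mono_left nhdsWithin_le_nhds
  refine mem_closure_of_tendsto ht ?_
  have h : ∀ i j : Fin k, i ≠ j → ∀ᶠ t : ℂ in 𝓝[≠] 0, w i + t * (i : ℕ) ≠ w j + t * (j : ℕ) := by
    intro i j hij
    by_cases hw : w i = w j
    · filter_upwards [self_mem_nhdsWithin] with t ht0
      rw [hw, Ne, add_right_inj, mul_right_inj' ht0, Nat.cast_inj]
      exact fun e => hij (Fin.ext e)
    · have h1 := (tendsto_pi_nhds.1 ht i).sub (tendsto_pi_nhds.1 ht j)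
      filter_upwards [h1.eventually_ne (sub_ne_zero.2 hw)] with t ht0
      exact sub_ne_zero.1 ht0
  filter_upwards [eventually_all.2 fun i => eventually_all.2 fun j => eventually_all.2 (h i j)]
    with t ht0 i j hij
  by_contra hne
  exact ht0 i j hne hij

theorem tendsto_detFormula (x : ℝ) {k : ℕ} (w : Fin k → ℂ) :
    Tendsto (detFormula x) (𝓝[{w' : Fin k → ℂ | Function.Injective w'}] w) (𝓝 (Fk x w)) := by
  refine ((continuous_Fk x k).continuousWithinAt (x := w)).tendsto.congr' ?_
  filter_upwards [self_mem_nhdsWithin] with w' hw'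
  exact Fk_eq_detFormula x hw'

theorem Fk_comp_perm (x : ℝ) {k : ℕ} (w : Fin k → ℂ) (σ : Equiv.Perm (Fin k)) :
    Fk x (w ∘ σ) = Fk x w := by
  have hc : Continuous fun w : Fin k → ℂ => Fk x (w ∘ σ) :=
    (continuous_Fk x k).comp (by fun_prop)
  refine congrFun (hc.ext_on (dense_injective k) (continuous_Fk x k) fun w' hw' => ?_) w
  have hw' : Function.Injective w' := hw'
  dsimp only
  rw [Fk_eq_detFormula x (hw'.comp σ.injective), Fk_eq_detFormula x hw', detFormula_comp_perm]

end AirySpiked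

end

open AirySpiked
theorem theorem1p1 (x : ℝ) :
    -- the objects are well defined: `1 - A_x` is invertible, the Fredholm series and the pairings
    -- converge, and `f(·, w)` can be differentiated arbitrarily often
    IsUnit (1 - airyOp x) ∧
    (∀ n : ℕ, Integrable (fun u : Fin n → ℝ => (Matrix.of fun i j => airyKernel (u i) (u j)).det)
      (Measure.pi fun _ => halfLine x)) ∧
    (Summable fun n : ℕ => (-1) ^ n / (n.factorial : ℂ) * fredholmTerm x n) ∧
    (∀ (m n : ℕ) (w : Fin m → ℂ) (w' : Fin n → ℂ), 0 < m →
      PairingConverges x (sFun w) (tFun w')) ∧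
    (∀ w : ℂ, PairingConverges x (cFun w) airy) ∧
    (∀ w : ℂ, ContDiff ℝ ∞ fun y => f y w) ∧
    -- the determinantal formula for distinct `w_j`, for coinciding `w_j` as a limit, and symmetry
    ∀ k : ℕ,
      (∀ w : Fin k → ℂ, Function.Injective w → Fk x w = detFormula x w) ∧
      (∀ w : Fin k → ℂ,
        Tendsto (detFormula x) (𝓝[{w' : Fin k → ℂ | Function.Injective w'}] w) (𝓝 (Fk x w))) ∧
      (∀ (w : Fin k → ℂ) (σ : Equiv.Perm (Fin k)), Fk x (w ∘ σ) = Fk x w) := by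
  refine ⟨isUnit_one_sub_airyOp x, integrable_det_airyKernel x, summable_fredholm x,
    fun m n w w' _ => ?_, fun w => ?_, contDiff_f, fun k => ⟨fun w hw => Fk_eq_detFormula x hw,
      tendsto_detFormula x, Fk_comp_perm x⟩⟩
  · exact pairingConverges_of_growth (expGrowth_sFun (one_add_two_mul_norm_le w))
      (continuous_sFun w) (fun κ => expGrowth_tFun κ w') (continuous_tFun w')
  · exact pairingConverges_of_growth (expGrowth_cFun le_rfl) (continuous_cFun w) expGrowth_airy
      continuous_airy
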